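/- Let $A$ be a Hopf algebra over a field $k$, with coproduct $\Delta a=a_{(1)}\otimes a_{(2)}$, counit $\epsilon$ and antipode $S$; let $A^+=\ker\epsilon$ and $\pi_\epsilon:A\to A^+$, $\pi_\epsilon(a)=a-\epsilon(a)1$. A right crossed module is a vector space $V$ that is a right $A$-module and a right $A$-comodule, $\Delta_Rv=v_{(\bar 0)}\otimes v_{(\bar 1)}$, with $\Delta_R(v\triangleleft a)=v_{(\bar0)}\triangleleft a_{(2)}\otimes (Sa_{(1)})v_{(\bar1)}a_{(3)}$. Between crossed modules put $\Psi(v\otimes w)=w_{(\bar 0)}\otimes v\triangleleft w_{(\bar1)}$. Regard $A^+$ as a crossed module by right multiplication and $\mathrm{Ad}_R(a)=a_{(2)}\otimes (Sa_{(1)})a_{(3)}$. A super-braided Hopf algebra is an $\mathbb N$-graded algebra in the category of right crossed modules with a coproduct $\underline\Delta$, counit and antipode, all structure maps being degree-preserving morphisms, which satisfy the Hopf algebra axioms with $\underline\Delta$ multiplicative for the product $(x\otimes y)(z\otimes w)=(-1)^{|y||z|}\,x\,\Psi(y\otimes z)\,w$ on the tensor square. Let $\varpi:A^+\to\Lambda^1$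 be a surjective morphism of right crossed modules, and let $$\Lambda_{max}=T\Lambda^1/\langle(\varpi\pi_\epsilon\otimes\varpi\pi_\epsilon)\Delta\ker\varpi\rangle ,$$ graded with $\Lambda^1$ in degree $1$. Then: 1. $\Lambda_{max}$ has the structure of a super-braided Hopf algebra in the category of right crossed modules for which $\Lambda^1\to\Lambda_{max}$ is a morphism and the elements of $\Lambda^1$ are primitive. 2. There is exactly one super-derivation $\mathrm d$ of $\Lambda_{max}$ obeying the Maurer–Cartan equation $$\mathrm d\varpi(a)+(\varpi\pi_\epsilon a_{(1)})(\varpi\pi_\epsilon a_{(2)})=0\qquad(a\in A^+).$$ It makes $\Lambda_{max}$ a differential graded algebra (it raises degree by one and $\mathrm d^2=0$), it is a right $A$-comodule map, and for all $a\in A$ and all $\eta\in\Lambda_{max}$ (homogeneous in the first equation) $$(\mathrm d\eta)\triangleleft a-\mathrm d(\eta\triangleleft a)=(\varpi\pi_\epsilon a_{(1)})(\eta\triangleleft a_{(2)})-(-1)^{|\eta|}(\eta\triangleleft a_{(1)})\,\varpi\pi_\epsilon a_{(2)},$$ $$\underline\Delta\mathrm d\eta-(\mathrm d\otimes\mathrm{id}+(-1)^{|\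 |}\otimes\mathrm d)\underline\Delta\eta=(-1)^{|\eta_{\underline{(1)}}|}\,\eta_{\underline{(1)}(\bar0)}\otimes(\varpi\pi_\epsilon\,\eta_{\underline{(1)}(\bar1)})\,\eta_{\underline{(2)}} .$$ 3. Let $\Omega_{max}$ be the super-bosonisation of $\Lambda_{max}$: the space $A\otimes\Lambda_{max}$, graded by the degree of $\Lambda_{max}$, with $$(a\otimes\eta)(b\otimes\omega)=ab_{(1)}\otimes(\eta\triangleleft b_{(2)})\omega,$$ $$\Delta(a\otimes\eta)=a_{(1)}\otimes\eta_{\underline{(1)}(\bar0)}\otimes a_{(2)}\eta_{\underline{(1)}(\bar1)}\otimes\eta_{\underline{(2)}},$$ the counit $a\otimes\eta\mapsto\epsilon(a)\underline\epsilon(\eta)$ and $$\mathrm d(a\otimes\eta)=a_{(1)}\otimes(\varpi\pi_\epsilon a_{(2)})\eta+a\otimes\mathrm d\eta .$$ Then $\Omega_{max}$ is a super-Hopf algebra, $\mathrm d$ is a super-coderivation of it, and $(\Omega_{max},\mathrm d)$ is the maximal prolongation of the first order calculus $\Omega^1=A\otimes\Lambda^1$ given by $b(a\otimes v)c=bac_{(1)}\otimes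 v\triangleleft c_{(2)}$, $\mathrm da=a_{(1)}\otimes\varpi\pi_\epsilon a_{(2)}$. That is, $(\Omega_{max},\mathrm d)$ is a differential graded algebra, generated by its degrees $0$ and $1$, with degree $0$ equal to $A$ and degree $1$ equal to $\Omega^1$ (including $\mathrm d:A\to\Omega^1$). Moreover, for every differential graded algebra $B$, every algebra map $j_0:A\to B^0$ and every linear map $j_1:\Omega^1\to B^1$ with $j_1(a\,m)=j_0(a)j_1(m)$, $j_1(m\,a)=j_1(m)j_0(a)$ and $j_1(\mathrm da)=\mathrm dj_0(a)$, there is exactly one map of differential graded algebras $\Omega_{max}\to B$ that extends $j_0$ and $j_1$. In particular every exterior algebra on $A$ that extends $(\Omega^1,\mathrm d)$ is a quotient of $\Omega_{max}$. -/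

import Mathlib

open scoped TensorProduct DirectSum

universe w u v x

noncomputable section

namespace BraidedCalculus

/-! ### Sweedler sums and tensor bookkeeping -/

section Sweedler

variable {k A M : Type*} [Field k] [Ring A] [HopfAlgebra k A] [AddCommMonoid M] [Module k M]

/-- `sweedler f a = ∑ f(a₁, a₂)`, where `Δ a = ∑ a₁ ⊗ a₂`. -/
def sweedler (f : A →ₗ[k] A →ₗ[k] M) : A →ₗ[k] M :=
  TensorProduct.lift f ∘ₗ Coalgebra.comul

/-- `sweedler₃ f a = ∑ f(a₁, a₂, a₃)`, where `(id ⊗ Δ) Δ a = ∑ a₁ ⊗ a₂ ⊗ a₃`. -/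
def sweedler₃ (f : A →ₗ[k] A →ₗ[k] A →ₗ[k] M) : A →ₗ[k] M :=
  TensorProduct.lift (TensorProduct.uncurry (RingHom.id k) A A M ∘ₗ f) ∘ₗ
    (Coalgebra.comul (R := k) (A := A)).lTensor A ∘ₗ Coalgebra.comul

end Sweedler

section Middle

variable {k U V W V' W' Z : Type*} [Field k]
  [AddCommGroup U] [Module k U] [AddCommGroup V] [Module k V] [AddCommGroup W] [Module k W]
  [AddCommGroup V'] [Module k V'] [AddCommGroup W'] [Module k W'] [AddCommGroup Z] [Module k Z]

/-- `id ⊗ τ ⊗ id`, with the outer brackets `(U ⊗ V) ⊗ (W ⊗ Z) → (U ⊗ W') ⊗ (V' ⊗ Z)`. -/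
def middle (τ : V ⊗[k] W →ₗ[k] W' ⊗[k] V') :
    (U ⊗[k] V) ⊗[k] (W ⊗[k] Z) →ₗ[k] (U ⊗[k] W') ⊗[k] (V' ⊗[k] Z) :=
  (TensorProduct.assoc k U W' (V' ⊗[k] Z)).symm.toLinearMap ∘ₗ
    ((TensorProduct.assoc k W' V' Z).toLinearMap ∘ₗ τ.rTensor Z ∘ₗ
      (TensorProduct.assoc k V W Z).symm.toLinearMap).lTensor U ∘ₗ
    (TensorProduct.assoc k U V (W ⊗[k] Z)).toLinearMap

end Middle

/-! ### Right crossed modules over a Hopf algebra -/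

/-- A right action `v ◁ a` and a right coaction `Δ_R v = v₀ ⊗ v₁` of `A` on `V`
(only the two maps; the axioms are `ActCoact.IsCrossedModule`). -/
@[ext]
structure ActCoact (k A V : Type*) [Field k] [Ring A] [HopfAlgebra k A] [AddCommGroup V]
    [Module k V] where
  /-- the action `v, a ↦ v ◁ a` -/
  act : V →ₗ[k] A →ₗ[k] V
  /-- the coaction `v ↦ v₀ ⊗ v₁` -/
  coact : V →ₗ[k] V ⊗[k] A

namespace ActCoact

variable {k A V W : Type*} [Field k] [Ring A] [HopfAlgebra k A]
  [AddCommGroup V] [Module k V] [AddCommGroup W] [Module k W]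

/-- `X.twistedAct a₁ a₂ a₃ (v ⊗ b) = v ◁ a₂ ⊗ (S a₁) b a₃`. -/
def twistedAct (X : ActCoact k A V) : A →ₗ[k] A →ₗ[k] A →ₗ[k] (V ⊗[k] A →ₗ[k] V ⊗[k] A) :=
  LinearMap.mk₂ k
    (fun a₁ a₂ =>
      TensorProduct.mapBilinear (RingHom.id k) V A V A (X.act.flip a₂) ∘ₗ
        LinearMap.llcomp k A A A (LinearMap.mul k A (HopfAlgebra.antipode k a₁)) ∘ₗ
          (LinearMap.mul k A).flip)
    (fun a a' b => by ext; simp [TensorProduct.tmul_add])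
    (fun c a b => by ext; simp)
    (fun a b b' => by ext; simp)
    (fun c a b => by ext; simp [TensorProduct.smul_tmul'])

@[simp]
theorem twistedAct_tmul (X : ActCoact k A V) (a₁ a₂ a₃ b : A) (v : V) :
    X.twistedAct a₁ a₂ a₃ (v ⊗ₜ b) = X.act v a₂ ⊗ₜ (HopfAlgebra.antipode k a₁ * (b * a₃)) := by
  simp [twistedAct]

/-- Right crossed (Drinfeld-Radford-Yetter) modules: a right module and right comodule with
`Δ_R (v ◁ a) = v₀ ◁ a₂ ⊗ (S a₁) v₁ a₃`. -/
structure IsCrossedModule (X : ActCoact k A V) : Prop where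
  act_one : ∀ v, X.act v 1 = v
  act_mul : ∀ v a b, X.act v (a * b) = X.act (X.act v a) b
  coact_coassoc : ∀ v, TensorProduct.assoc k V A A (X.coact.rTensor A (X.coact v)) =
    (Coalgebra.comul (R := k) (A := A)).lTensor V (X.coact v)
  coact_counit : ∀ v, TensorProduct.rid k V
    ((Coalgebra.counit (R := k) (A := A)).lTensor V (X.coact v)) = v
  coact_act : ∀ v a, X.coact (X.act v a) = sweedler₃ X.twistedAct a (X.coact v)

/-- A morphism of right crossed modules: a linear map commuting with actions and coactions. -/
structure IsHom (X : ActCoact k A V) (Y : ActCoact k A W) (f : V →ₗ[k] W) : Prop where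
  map_act : ∀ v a, f (X.act v a) = Y.act (f v) a
  map_coact : ∀ v, Y.coact (f v) = f.rTensor A (X.coact v)

/-- The tensor product: `(v ⊗ w) ◁ a = v ◁ a₁ ⊗ w ◁ a₂`, `v ⊗ w ↦ v₀ ⊗ w₀ ⊗ v₁ w₁`. -/
def tensor (X : ActCoact k A V) (Y : ActCoact k A W) : ActCoact k A (V ⊗[k] W) where
  act := (sweedler ((TensorProduct.mapBilinear (RingHom.id k) V W V W).compl₁₂
    X.act.flip Y.act.flip)).flip
  coact := (LinearMap.mul' k A).lTensor (V ⊗[k] W) ∘ₗ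
    (TensorProduct.tensorTensorTensorComm k V A W A).toLinearMap ∘ₗ
    TensorProduct.map X.coact Y.coact

variable (k A) in
/-- The unit object: `c ◁ a = ε(a) c`, `c ↦ c ⊗ 1`. -/
def unitObject : ActCoact k A k where
  act := (LinearMap.lsmul k k).flip.compl₁₂ LinearMap.id Coalgebra.counit
  coact := (TensorProduct.mk k k A).flip 1

/-- The braiding `Ψ(v ⊗ w) = w₀ ⊗ v ◁ w₁`. -/
def braiding (X : ActCoact k A V) (Y : ActCoact k A W) : V ⊗[k] W →ₗ[k] W ⊗[k] V :=
  (TensorProduct.lift X.act).lTensor W ∘ₗ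
    (TensorProduct.leftComm k V W A).toLinearMap ∘ₗ Y.coact.lTensor V

end ActCoact

/-! ### The augmentation ideal -/

section Augmentation

variable (k A : Type*) [Field k] [Ring A] [HopfAlgebra k A]

/-- The augmentation ideal `A⁺ = ker ε`. -/
abbrev APlus : Submodule k A := LinearMap.ker (Coalgebra.counit (R := k) (A := A))

/-- The counit projection `π_ε : A → A⁺`, `a ↦ a - ε(a) 1`. -/
def counitProj : A →ₗ[k] APlus k A :=
  (LinearMap.id - Algebra.linearMap k A ∘ₗ Coalgebra.counit).codRestrict (APlus k A)
    (fun a => by simp)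

/-- The right adjoint coaction `Ad_R a = a₂ ⊗ (S a₁) a₃`. -/
def adR : A →ₗ[k] A ⊗[k] A :=
  sweedler₃ (LinearMap.mk₂ k
    (fun a₁ a₂ => TensorProduct.mk k A A a₂ ∘ₗ
      LinearMap.mul k A (HopfAlgebra.antipode k a₁))
    (fun a a' b => by ext; simp [TensorProduct.tmul_add])
    (fun c a b => by ext; simp)
    (fun a b b' => by ext; simp)
    (fun c a b => by ext; simp [TensorProduct.smul_tmul']))

theorem rTensor_counit_adR (a : A) :
    (Coalgebra.counit (R := k) (A := A)).rTensor A (adR k A a) =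
      1 ⊗ₜ algebraMap k A (Coalgebra.counit a) := by
  have h : ∀ t : A ⊗[k] A, (Coalgebra.counit (R := k) (A := A)).rTensor A
      (TensorProduct.lift (TensorProduct.uncurry (RingHom.id k) A A (A ⊗[k] A) ∘ₗ
        LinearMap.mk₂ k (fun a₁ a₂ => TensorProduct.mk k A A a₂ ∘ₗ
          LinearMap.mul k A (HopfAlgebra.antipode k a₁))
        (fun a a' b => by ext; simp [TensorProduct.tmul_add])
        (fun c a b => by ext; simp)
        (fun a b b' => by ext; simp)
        (fun c a b => by ext; simp [TensorProduct.smul_tmul']))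
        ((Coalgebra.comul (R := k) (A := A)).lTensor A t)) =
      1 ⊗ₜ[k] LinearMap.mul' k A ((HopfAlgebra.antipode k).rTensor A t) := by
    intro t
    induction t with
    | zero => simp
    | add s t hs ht => simp only [map_add, hs, ht, TensorProduct.tmul_add]
    | tmul b c =>
      have h' : ∀ s : A ⊗[k] A, (Coalgebra.counit (R := k) (A := A)).rTensor A
          (TensorProduct.uncurry (RingHom.id k) A A (A ⊗[k] A) (LinearMap.mk₂ k
            (fun a₁ a₂ => TensorProduct.mk k A A a₂ ∘ₗ
              LinearMap.mul k A (HopfAlgebra.antipode k a₁))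
            (fun a a' b => by ext; simp [TensorProduct.tmul_add])
            (fun c a b => by ext; simp)
            (fun a b b' => by ext; simp)
            (fun c a b => by ext; simp [TensorProduct.smul_tmul']) b) s) =
          (LinearMap.mulLeft k (HopfAlgebra.antipode k b)).lTensor k
            ((Coalgebra.counit (R := k) (A := A)).rTensor A s) := by
        intro s
        induction s with
        | zero => simp
        | add s t hs ht => simp only [map_add, hs, ht]
        | tmul p q => simp [TensorProduct.uncurry_apply]
      simp only [LinearMap.lTensor_tmul, TensorProduct.lift.tmul, LinearMap.comp_apply]
      rw [h', Coalgebra.rTensor_counit_comul]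
      simp
  rw [adR, sweedler₃, LinearMap.comp_apply, LinearMap.comp_apply, h,
    HopfAlgebra.mul_antipode_rTensor_comul_apply]

/-- `A⁺` with right multiplication and the adjoint coaction. The coaction is
`(π_ε ⊗ id) ∘ Ad_R`, which is `Ad_R` with its values viewed in `A⁺ ⊗ A`. -/
def augmentation : ActCoact k A (APlus k A) where
  act := LinearMap.mk₂ k (fun a b => ⟨(a : A) * b, by
      have := a.2
      rw [LinearMap.mem_ker] at this ⊢
      rw [Bialgebra.counit_mul, this, zero_mul]⟩)
    (fun a a' b => by ext; simp [add_mul]) (fun c a b => by ext; simp)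
    (fun a b b' => by ext; simp [mul_add]) (fun c a b => by ext; simp)
  coact := (counitProj k A).rTensor A ∘ₗ adR k A ∘ₗ (APlus k A).subtype

/-- The coaction of `A⁺` is the restriction of `Ad_R`. -/
theorem subtype_rTensor_augmentation_coact (a : APlus k A) :
    (APlus k A).subtype.rTensor A ((augmentation k A).coact a) = adR k A a := by
  have h : (APlus k A).subtype ∘ₗ counitProj k A =
      LinearMap.id - Algebra.linearMap k A ∘ₗ Coalgebra.counit := rfl
  have ha : Coalgebra.counit (R := k) (a : A) = 0 := a.2
  rw [augmentation, LinearMap.comp_apply, ← LinearMap.comp_apply, ← LinearMap.rTensor_comp, h,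
    LinearMap.rTensor_sub, LinearMap.sub_apply, LinearMap.rTensor_comp, LinearMap.comp_apply,
    LinearMap.comp_apply, Submodule.subtype_apply, rTensor_counit_adR, ha]
  simp

end Augmentation

/-! ### Graded signs -/

section Graded

variable {k Λ M : Type*} [Field k] [Ring Λ] [Algebra k Λ] [AddCommGroup M] [Module k M]
  (𝒜 : ℕ → Submodule k Λ) [GradedAlgebra 𝒜]

/-- The linear map that is `f n` on the component of degree `n`. -/
def gradedMap (f : ℕ → Λ →ₗ[k] M) : Λ →ₗ[k] M :=
  DirectSum.toModule k ℕ M (fun n => f n ∘ₗ (𝒜 n).subtype) ∘ₗ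
    (DirectSum.decomposeLinearEquiv 𝒜).toLinearMap

theorem gradedMap_of_mem (f : ℕ → Λ →ₗ[k] M) {n : ℕ} {x : Λ} (hx : x ∈ 𝒜 n) :
    gradedMap 𝒜 f x = f n x := by
  have := DirectSum.decomposeLinearEquiv_apply_coe (R := k) 𝒜 n ⟨x, hx⟩
  simp only [gradedMap, LinearMap.comp_apply, LinearEquiv.coe_coe]
  rw [this, DirectSum.toModule_lof]
  rfl

/-- The parity `(-1)^{| |}`: `x ↦ (-1)^n x` for `x` of degree `n`. -/
def parity : Λ →ₗ[k] Λ := gradedMap 𝒜 (fun n => (-1 : k) ^ n • LinearMap.id)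

/-- The sign `x ⊗ y ↦ (-1)^{|x||y|} x ⊗ y`. -/
def koszul : Λ ⊗[k] Λ →ₗ[k] Λ ⊗[k] Λ :=
  TensorProduct.lift (gradedMap 𝒜 (fun n =>
    gradedMap 𝒜 (fun m => (-1 : k) ^ (n * m) • (TensorProduct.mk k Λ Λ).flip) |>.flip))

theorem koszul_tmul {n m : ℕ} {x y : Λ} (hx : x ∈ 𝒜 n) (hy : y ∈ 𝒜 m) :
    koszul 𝒜 (x ⊗ₜ y) = (-1 : k) ^ (n * m) • (x ⊗ₜ[k] y) := by
  rw [koszul, TensorProduct.lift.tmul, gradedMap_of_mem 𝒜 _ hx, LinearMap.flip_apply,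
    gradedMap_of_mem 𝒜 _ hy]
  rfl

/-- The degree `n` part of `Λ ⊗ Λ`. -/
def tensorDeg (n : ℕ) : Submodule k (Λ ⊗[k] Λ) :=
  ⨆ (p : ℕ × ℕ) (_ : p.1 + p.2 = n), LinearMap.range (TensorProduct.mapIncl (𝒜 p.1) (𝒜 p.2))

/-- `d` makes the graded algebra into a differential graded algebra: it raises degree by one, is a
super-derivation and squares to zero. -/
structure IsDGA (d : Λ →ₗ[k] Λ) : Prop where
  map_deg : ∀ n, ∀ x ∈ 𝒜 n, d x ∈ 𝒜 (n + 1)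
  leibniz : ∀ n, ∀ x ∈ 𝒜 n, ∀ y, d (x * y) = d x * y + (-1 : k) ^ n • (x * d y)
  sq_zero : ∀ x, d (d x) = 0

/-- `(Δ, ε)` makes the graded algebra into a super-Hopf algebra. The product of the super tensor
square is `(x ⊗ y)(z ⊗ w) = (-1)^{|y||z|} x z ⊗ y w`. -/
structure IsSuperHopf (Δ : Λ →ₗ[k] Λ ⊗[k] Λ) (ε : Λ →ₗ[k] k) : Prop where
  comul_deg : ∀ n, ∀ x ∈ 𝒜 n, Δ x ∈ tensorDeg 𝒜 n
  counit_deg : ∀ n, n ≠ 0 → ∀ x ∈ 𝒜 n, ε x = 0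
  coassoc : ∀ x, TensorProduct.assoc k Λ Λ Λ (Δ.rTensor Λ (Δ x)) = Δ.lTensor Λ (Δ x)
  counit_comul : ∀ x, TensorProduct.lid k Λ (ε.rTensor Λ (Δ x)) = x
  comul_counit : ∀ x, TensorProduct.rid k Λ (ε.lTensor Λ (Δ x)) = x
  comul_one : Δ 1 = 1 ⊗ₜ 1
  counit_one : ε 1 = 1
  counit_mul : ∀ x y, ε (x * y) = ε x * ε y
  comul_mul : ∀ x y, Δ (x * y) =
    TensorProduct.map (LinearMap.mul' k Λ) (LinearMap.mul' k Λ)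
      (middle ((TensorProduct.comm k Λ Λ).toLinearMap ∘ₗ koszul 𝒜) (Δ x ⊗ₜ Δ y))
  exists_antipode : ∃ S : Λ →ₗ[k] Λ, (∀ n, ∀ x ∈ 𝒜 n, S x ∈ 𝒜 n) ∧
    (∀ x, LinearMap.mul' k Λ (S.rTensor Λ (Δ x)) = algebraMap k Λ (ε x)) ∧
    (∀ x, LinearMap.mul' k Λ (S.lTensor Λ (Δ x)) = algebraMap k Λ (ε x))

end Graded

/-! ### Super-braided Hopf algebras in the category of right crossed modules -/

/-- A super-braided Hopf algebra structure, in the category of right `A`-crossed modules, on the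
graded algebra `Λ`: all structure maps are morphisms of crossed modules and preserve degree, and
the coproduct is multiplicative for the super-braided tensor square, with product
`(x ⊗ y)(z ⊗ w) = (-1)^{|y||z|} x z₀ ⊗ (y ◁ z₁) w`. -/
structure SuperBraidedHopf (k A : Type*) {Λ : Type*} [Field k] [Ring A] [HopfAlgebra k A]
    [Ring Λ] [Algebra k Λ] (𝒜 : ℕ → Submodule k Λ) [GradedAlgebra 𝒜]
    extends ActCoact k A Λ where
  /-- the braided coproduct -/
  comul : Λ →ₗ[k] Λ ⊗[k] Λ
  /-- the braided counit -/
  counit : Λ →ₗ[k] k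
  /-- the braided antipode -/
  antipode : Λ →ₗ[k] Λ
  isCrossedModule : toActCoact.IsCrossedModule
  mul_hom : (toActCoact.tensor toActCoact).IsHom toActCoact (LinearMap.mul' k Λ)
  one_hom : (ActCoact.unitObject k A).IsHom toActCoact (Algebra.linearMap k Λ)
  comul_hom : toActCoact.IsHom (toActCoact.tensor toActCoact) comul
  counit_hom : toActCoact.IsHom (ActCoact.unitObject k A) counit
  antipode_hom : toActCoact.IsHom toActCoact antipode
  act_deg : ∀ n, ∀ x ∈ 𝒜 n, ∀ a, act x a ∈ 𝒜 n
  coact_deg : ∀ n, ∀ x ∈ 𝒜 n, coact x ∈ LinearMap.range ((𝒜 n).subtype.rTensor A)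
  comul_deg : ∀ n, ∀ x ∈ 𝒜 n, comul x ∈ tensorDeg 𝒜 n
  counit_deg : ∀ n, n ≠ 0 → ∀ x ∈ 𝒜 n, counit x = 0
  antipode_deg : ∀ n, ∀ x ∈ 𝒜 n, antipode x ∈ 𝒜 n
  coassoc : ∀ x, TensorProduct.assoc k Λ Λ Λ (comul.rTensor Λ (comul x)) =
    comul.lTensor Λ (comul x)
  counit_comul : ∀ x, TensorProduct.lid k Λ (counit.rTensor Λ (comul x)) = x
  comul_counit : ∀ x, TensorProduct.rid k Λ (counit.lTensor Λ (comul x)) = x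
  comul_one : comul 1 = 1 ⊗ₜ 1
  counit_one : counit 1 = 1
  counit_mul : ∀ x y, counit (x * y) = counit x * counit y
  comul_mul : ∀ x y, comul (x * y) =
    TensorProduct.map (LinearMap.mul' k Λ) (LinearMap.mul' k Λ)
      (middle (toActCoact.braiding toActCoact ∘ₗ koszul 𝒜) (comul x ⊗ₜ comul y))
  antipode_left : ∀ x, LinearMap.mul' k Λ (antipode.rTensor Λ (comul x)) =
    algebraMap k Λ (counit x)
  antipode_right : ∀ x, LinearMap.mul' k Λ (antipode.lTensor Λ (comul x)) =
    algebraMap k Λ (counit x)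

namespace SuperBraidedHopf

variable {k A Λ : Type*} [Field k] [Ring A] [HopfAlgebra k A] [Ring Λ] [Algebra k Λ]
  {𝒜 : ℕ → Submodule k Λ} [GradedAlgebra 𝒜]

theorem one_act (H : SuperBraidedHopf k A 𝒜) (a : A) :
    H.act 1 a = algebraMap k Λ (Coalgebra.counit a) := by
  have := H.one_hom.map_act 1 a
  simpa [ActCoact.unitObject] using this.symm

/-- `(x y) ◁ a = (x ◁ a₁) (y ◁ a₂)`. -/
theorem mul_act (H : SuperBraidedHopf k A 𝒜) (x y : Λ) (a : A) :
    H.act (x * y) a =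
      sweedler ((LinearMap.mul k Λ).compl₁₂ (H.act x) (H.act y)) a := by
  have := H.mul_hom.map_act (x ⊗ₜ y) a
  rw [LinearMap.mul'_apply] at this
  rw [← this, ActCoact.tensor, LinearMap.flip_apply, sweedler, sweedler, LinearMap.comp_apply,
    LinearMap.comp_apply]
  induction (Coalgebra.comul (R := k) a) with
  | zero => simp
  | tmul b c => simp
  | add s t hs ht => simp only [map_add, LinearMap.add_apply, hs, ht]

/-- The cross relation of the bosonisation: `twist H η a = a₁ ⊗ η ◁ a₂`. -/
def twist (H : SuperBraidedHopf k A 𝒜) : Λ →ₗ[k] A →ₗ[k] A ⊗[k] Λ :=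
  LinearMap.mk₂ k (fun η a => (H.act η).lTensor A (Coalgebra.comul a))
    (fun η η' a => by simp [LinearMap.lTensor_add]) (fun c η a => by simp [LinearMap.lTensor_smul])
    (fun η a a' => by simp) (fun c η a => by simp)

end SuperBraidedHopf

/-! ### Super-bosonisation -/

namespace Bosonisation

variable {k A Λ : Type*} [Field k] [Ring A] [HopfAlgebra k A] [Ring Λ] [Algebra k Λ]
  {𝒜 : ℕ → Submodule k Λ} [GradedAlgebra 𝒜] (H : SuperBraidedHopf k A 𝒜)

/-- The product `(a ⊗ η)(b ⊗ ω) = a b₁ ⊗ (η ◁ b₂) ω` on `A ⊗ Λ`. -/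
def mulMap : A ⊗[k] Λ →ₗ[k] A ⊗[k] Λ →ₗ[k] A ⊗[k] Λ :=
  TensorProduct.curry (TensorProduct.map (LinearMap.mul' k A) (LinearMap.mul' k Λ) ∘ₗ
    middle (TensorProduct.lift H.twist))

theorem mulMap_mk (a b : A) (η ω : Λ) : mulMap H (a ⊗ₜ η) (b ⊗ₜ ω) =
    TensorProduct.map (LinearMap.mulLeft k a) (LinearMap.mulRight k ω) (H.twist η b) := by
  change (TensorProduct.map (LinearMap.mul' k A) (LinearMap.mul' k Λ))
    (middle (TensorProduct.lift H.twist) ((a ⊗ₜ η) ⊗ₜ (b ⊗ₜ ω))) = _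
  simp only [middle, LinearMap.comp_apply, LinearEquiv.coe_coe, TensorProduct.assoc_tmul,
    LinearMap.lTensor_tmul, TensorProduct.assoc_symm_tmul, LinearMap.rTensor_tmul,
    TensorProduct.lift.tmul]
  induction H.twist η b with
  | zero => simp
  | tmul c ζ => simp
  | add s t hs ht => simp only [TensorProduct.add_tmul, TensorProduct.tmul_add, map_add, hs, ht]

theorem twist_mul_left (η : Λ) (b c : A) {ι : Type*} (R : Coalgebra.Repr k b ι) :
    H.twist η (b * c) = ∑ i ∈ R.index,
      (LinearMap.mulLeft k (R.left i)).rTensor Λ (H.twist (H.act η (R.right i)) c) := by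
  simp only [SuperBraidedHopf.twist, LinearMap.mk₂_apply, Bialgebra.comul_mul]
  rw [← R.eq, Finset.sum_mul, map_sum]
  refine Finset.sum_congr rfl fun i _ => ?_
  induction (Coalgebra.comul (R := k) c) with
  | zero => simp
  | add s t hs ht => simp only [mul_add, map_add, hs, ht]
  | tmul c₁ c₂ => simp [H.isCrossedModule.act_mul]

theorem twist_mul_right (η ω : Λ) (b : A) : H.twist (η * ω) b =
    (LinearMap.mul' k Λ).lTensor A (TensorProduct.assoc k A Λ Λ
      ((H.twist η).rTensor Λ (H.twist ω b))) := by
  have h1 : H.twist (η * ω) b = (TensorProduct.lift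
      ((LinearMap.mul k Λ).compl₁₂ (H.act η) (H.act ω))).lTensor A
        ((Coalgebra.comul (R := k) (A := A)).lTensor A (Coalgebra.comul b)) := by
    simp only [SuperBraidedHopf.twist, LinearMap.mk₂_apply]
    rw [← LinearMap.comp_apply (LinearMap.lTensor A (TensorProduct.lift _)), ← LinearMap.lTensor_comp]
    congr 2
    ext a
    exact H.mul_act η ω a
  rw [h1, ← Coalgebra.coassoc_apply]
  simp only [SuperBraidedHopf.twist, LinearMap.mk₂_apply]
  induction (Coalgebra.comul (R := k) b) with
  | zero => simp
  | add s t hs ht => simp only [map_add, hs, ht]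
  | tmul b₁ b₂ =>
    simp only [LinearMap.rTensor_tmul, LinearMap.lTensor_tmul, LinearMap.mk₂_apply]
    induction (Coalgebra.comul (R := k) b₁) with
    | zero => simp
    | add s t hs ht => simp only [TensorProduct.add_tmul, map_add, hs, ht]
    | tmul c₁ c₂ => simp

theorem twist_one_left (b : A) : H.twist 1 b = b ⊗ₜ 1 := by
  have : H.act 1 = Algebra.linearMap k Λ ∘ₗ Coalgebra.counit := by
    ext a; exact H.one_act a
  simp only [SuperBraidedHopf.twist, LinearMap.mk₂_apply, this, LinearMap.lTensor_comp,
    LinearMap.comp_apply, Coalgebra.lTensor_counit_comul]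
  simp

theorem twist_one_right (η : Λ) : H.twist η 1 = 1 ⊗ₜ η := by
  simp [SuperBraidedHopf.twist, H.isCrossedModule.act_one, Algebra.TensorProduct.one_def]

theorem mulMap_assoc (x y z : A ⊗[k] Λ) :
    mulMap H (mulMap H x y) z = mulMap H x (mulMap H y z) := by
  induction x with
  | zero => simp
  | add s t hs ht => simp only [map_add, LinearMap.add_apply, hs, ht]
  | tmul a η =>
  induction y with
  | zero => simp
  | add s t hs ht => simp only [map_add, LinearMap.add_apply, hs, ht]
  | tmul b ω =>
  induction z with
  | zero => simp
  | add s t hs ht => simp only [map_add, hs, ht]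
  | tmul c ζ =>
  have R := Coalgebra.Repr.arbitrary k b
  have L : H.twist η b = ∑ i ∈ R.index, R.left i ⊗ₜ[k] H.act η (R.right i) := by
    simp only [SuperBraidedHopf.twist, LinearMap.mk₂_apply]
    rw [← R.eq, map_sum]
    simp
  rw [mulMap_mk, mulMap_mk, L]
  simp only [map_sum, LinearMap.sum_apply, TensorProduct.map_tmul, LinearMap.mulLeft_apply,
    LinearMap.mulRight_apply, mulMap_mk, twist_mul_right]
  induction H.twist ω c with
  | zero => simp
  | add s t hs ht => simp only [map_add, Finset.sum_add_distrib, hs, ht]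
  | tmul c₁ u =>
    simp only [TensorProduct.map_tmul, LinearMap.mulLeft_apply, LinearMap.mulRight_apply,
      mulMap_mk, twist_mul_left H η b c₁ R, map_sum, LinearMap.rTensor_tmul]
    refine Finset.sum_congr rfl fun i _ => ?_
    induction H.twist (H.act η (R.right i)) c₁ with
    | zero => simp
    | add s t hs ht => simp only [TensorProduct.add_tmul, map_add, hs, ht]
    | tmul p q => simp [mul_assoc]

theorem one_mulMap (x : A ⊗[k] Λ) : mulMap H (1 ⊗ₜ 1) x = x := by
  induction x with
  | zero => simp
  | add s t hs ht => rw [map_add, hs, ht]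
  | tmul a η => rw [mulMap_mk, twist_one_left]; simp

theorem mulMap_one (x : A ⊗[k] Λ) : mulMap H x (1 ⊗ₜ 1) = x := by
  induction x with
  | zero => simp
  | add s t hs ht => rw [map_add, LinearMap.add_apply, hs, ht]
  | tmul a η => rw [mulMap_mk, twist_one_right]; simp

end Bosonisation

/-- The super-bosonisation `A ·▷< Λ`, with underlying space `A ⊗ Λ`. -/
def Bosonisation {k A Λ : Type*} [Field k] [Ring A] [HopfAlgebra k A] [Ring Λ] [Algebra k Λ]
    {𝒜 : ℕ → Submodule k Λ} [GradedAlgebra 𝒜] (_H : SuperBraidedHopf k A 𝒜) : Type _ :=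
  A ⊗[k] Λ

namespace Bosonisation

variable {k A Λ : Type*} [Field k] [Ring A] [HopfAlgebra k A] [Ring Λ] [Algebra k Λ]
  {𝒜 : ℕ → Submodule k Λ} [GradedAlgebra 𝒜] (H : SuperBraidedHopf k A 𝒜)

instance : AddCommGroup (Bosonisation H) := inferInstanceAs (AddCommGroup (A ⊗[k] Λ))
instance : Module k (Bosonisation H) := inferInstanceAs (Module k (A ⊗[k] Λ))

/-- The identification of `A ⊗ Λ` with the bosonisation. -/
def ofTensor : A ⊗[k] Λ ≃ₗ[k] Bosonisation H := LinearEquiv.refl k (A ⊗[k] Λ)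

/-- The product of the bosonisation is `Bosonisation.mulMap`, its unit is `1 ⊗ 1`. -/
instance : Ring (Bosonisation H) :=
  { (inferInstance : AddCommGroup (Bosonisation H)) with
    mul := fun x y => ofTensor H (mulMap H ((ofTensor H).symm x) ((ofTensor H).symm y))
    one := ofTensor H (1 ⊗ₜ 1)
    left_distrib := fun x y z => map_add (mulMap H x) y z
    right_distrib := fun x y z => LinearMap.congr_fun (map_add (mulMap H) x y) z
    zero_mul := fun x => LinearMap.congr_fun (map_zero (mulMap H)) x
    mul_zero := fun x => map_zero (mulMap H x)
    mul_assoc := mulMap_assoc H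
    one_mul := one_mulMap H
    mul_one := mulMap_one H }

instance : Algebra k (Bosonisation H) :=
  Algebra.ofModule (fun r x y => LinearMap.congr_fun (map_smul (mulMap H) r x) y)
    (fun r x y => map_smul (mulMap H x) r y)

theorem ofTensor_mul (x y : A ⊗[k] Λ) :
    ofTensor H x * ofTensor H y = ofTensor H (mulMap H x y) := rfl

theorem one_def : (1 : Bosonisation H) = ofTensor H (1 ⊗ₜ 1) := rfl

/-- The component `A ⊗ Λⁿ` of degree `n`. -/
def deg (n : ℕ) : Submodule k (Bosonisation H) :=
  (LinearMap.range ((𝒜 n).subtype.lTensor A)).map (ofTensor H).toLinearMap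

theorem tmul_mem_deg (a : A) {n : ℕ} {x : Λ} (hx : x ∈ 𝒜 n) :
    ofTensor H (a ⊗ₜ x) ∈ deg H n :=
  ⟨_, ⟨a ⊗ₜ ⟨x, hx⟩, rfl⟩, rfl⟩

theorem deg_induction {n : ℕ} {P : Bosonisation H → Prop} (zero : P 0)
    (tmul : ∀ a, ∀ x ∈ 𝒜 n, P (ofTensor H (a ⊗ₜ x)))
    (add : ∀ x y, P x → P y → P (x + y)) {y : Bosonisation H} (hy : y ∈ deg H n) : P y := by
  obtain ⟨_, ⟨t, rfl⟩, rfl⟩ := hy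
  induction t with
  | zero => simpa using zero
  | add s t hs ht => simpa only [map_add] using add _ _ hs ht
  | tmul a x => exact tmul a x x.2

instance : SetLike.GradedMonoid (deg H) where
  one_mem := tmul_mem_deg H 1 (SetLike.GradedOne.one_mem)
  mul_mem := fun {i j} x y hx hy => by
    refine deg_induction H (P := fun x => x * y ∈ deg H (i + j)) (by simp) (fun a η hη => ?_)
      (fun x x' h h' => by rw [add_mul]; exact add_mem h h') hx
    refine deg_induction H (P := fun y => ofTensor H (a ⊗ₜ η) * y ∈ deg H (i + j)) (by simp)
      (fun b ω hω => ?_) (fun x x' h h' => by rw [mul_add]; exact add_mem h h') hy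
    rw [ofTensor_mul, mulMap_mk, SuperBraidedHopf.twist, LinearMap.mk₂_apply]
    induction (Coalgebra.comul (R := k) b) with
    | zero => simp
    | add s t hs ht => simpa only [map_add] using add_mem hs ht
    | tmul b₁ b₂ =>
      exact tmul_mem_deg H _ (SetLike.GradedMul.mul_mem (H.act_deg i η hη b₂) hω)

/-- The inclusion of `A ⊗ Λⁿ` as the component of degree `n` (auxiliary). -/
def degIncl (n : ℕ) : A ⊗[k] 𝒜 n →ₗ[k] deg H n :=
  ((ofTensor H).toLinearMap ∘ₗ (𝒜 n).subtype.lTensor A).codRestrict (deg H n)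
    (fun t => ⟨_, ⟨t, rfl⟩, rfl⟩)

/-- The decomposition of `A ⊗ Λ` into the components `A ⊗ Λⁿ` (auxiliary). -/
def degDecompose : Bosonisation H →ₗ[k] ⨁ n, deg H n :=
  DirectSum.toModule k ℕ _ (fun n => DirectSum.lof k ℕ (fun n => deg H n) n ∘ₗ degIncl H n) ∘ₗ
    (TensorProduct.directSumRight k k A (fun n => 𝒜 n)).toLinearMap ∘ₗ
    (DirectSum.decomposeLinearEquiv 𝒜).toLinearMap.lTensor A ∘ₗ (ofTensor H).symm.toLinearMap

theorem degDecompose_tmul (a : A) {n : ℕ} {x : Λ} (hx : x ∈ 𝒜 n) :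
    degDecompose H (ofTensor H (a ⊗ₜ x)) =
      DirectSum.lof k ℕ (fun n => deg H n) n ⟨_, tmul_mem_deg H a hx⟩ := by
  have := DirectSum.decomposeLinearEquiv_apply_coe (R := k) 𝒜 n ⟨x, hx⟩
  simp only [degDecompose, LinearMap.comp_apply, LinearEquiv.coe_coe, LinearEquiv.symm_apply_apply,
    LinearMap.lTensor_tmul]
  rw [this, TensorProduct.directSumRight_tmul_lof, DirectSum.toModule_lof]
  rfl

instance : GradedAlgebra (deg H) where
  toDecomposition := DirectSum.Decomposition.ofLinearMap (deg H) (degDecompose H)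
    (by
      suffices h : ∀ x, DirectSum.coeLinearMap (deg H) (degDecompose H (ofTensor H x)) =
          ofTensor H x from LinearMap.ext h
      intro x
      induction x with
      | zero => simp
      | add s t hs ht => simp only [map_add, hs, ht]
      | tmul a x =>
        induction x using DirectSum.Decomposition.inductionOn 𝒜 with
        | zero => simp
        | add s t hs ht => simp only [TensorProduct.tmul_add, map_add, hs, ht]
        | homogeneous x => rw [degDecompose_tmul H a x.2, DirectSum.coeLinearMap_lof])
    (by
      ext n ⟨_, _, ⟨t, rfl⟩, rfl⟩ : 2
      simp only [LinearMap.comp_apply, LinearMap.id_apply, DirectSum.coeLinearMap_lof]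
      suffices h : degDecompose H (ofTensor H ((𝒜 n).subtype.lTensor A t)) =
          DirectSum.lof k ℕ (fun n => deg H n) n (degIncl H n t) from h
      induction t with
      | zero => simp
      | add s t hs ht => simp only [map_add, hs, ht]
      | tmul a x => exact degDecompose_tmul H a x.2)

/-- The coproduct `Δ(a ⊗ η) = a₁ ⊗ (η₁)₀ ⊗ a₂ (η₁)₁ ⊗ η₂`, with `η₁ ⊗ η₂` the braided coproduct
of `η`. -/
def comul : Bosonisation H →ₗ[k] Bosonisation H ⊗[k] Bosonisation H :=
  TensorProduct.map (ofTensor H).toLinearMap (ofTensor H).toLinearMap ∘ₗ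
    ((LinearMap.mul' k A).rTensor Λ ∘ₗ
      (TensorProduct.assoc k A A Λ).symm.toLinearMap).lTensor (A ⊗[k] Λ) ∘ₗ
    (TensorProduct.tensorTensorTensorComm k A A Λ (A ⊗[k] Λ)).toLinearMap ∘ₗ
    TensorProduct.map Coalgebra.comul
      ((TensorProduct.assoc k Λ A Λ).toLinearMap ∘ₗ H.coact.rTensor Λ ∘ₗ H.comul) ∘ₗ
    (ofTensor H).symm.toLinearMap

/-- The counit `ε(a ⊗ η) = ε(a) ε(η)`. -/
def counit : Bosonisation H →ₗ[k] k :=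
  LinearMap.mul' k k ∘ₗ TensorProduct.map Coalgebra.counit H.counit ∘ₗ (ofTensor H).symm.toLinearMap

/-- The inclusion `a ↦ a ⊗ 1`. -/
def inclA : A →ₐ[k] Bosonisation H :=
  AlgHom.ofLinearMap ((ofTensor H).toLinearMap ∘ₗ (TensorProduct.mk k A Λ).flip 1) rfl
    (fun a b => by
      have h := ofTensor_mul H (a ⊗ₜ 1) (b ⊗ₜ 1)
      rw [mulMap_mk, twist_one_left, TensorProduct.map_tmul, LinearMap.mulLeft_apply,
        LinearMap.mulRight_apply, mul_one] at h
      exact h.symm)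

/-- The operator `a ⊗ η ↦ a₁ ⊗ θ(a₂) η + a ⊗ d η` on the bosonisation. For `θ = ϖ π_ε` this is the
exterior derivative `a η ↦ (d a) η + a d η` with `d a = a₁ ϖ π_ε a₂`. -/
def extD (θ : A →ₗ[k] Λ) (d : Λ →ₗ[k] Λ) : Bosonisation H →ₗ[k] Bosonisation H :=
  (ofTensor H).toLinearMap ∘ₗ
    ((TensorProduct.lift (LinearMap.mul k Λ ∘ₗ θ)).lTensor A ∘ₗ
      (TensorProduct.assoc k A A Λ).toLinearMap ∘ₗ
      (Coalgebra.comul (R := k) (A := A)).rTensor Λ + d.lTensor A) ∘ₗ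
    (ofTensor H).symm.toLinearMap

end Bosonisation

/-! ### Differential calculi and maximal prolongations -/

/-- The data of a first order calculus `(M, d)` on `A`: left and right multiplication by `A`
(`left a m = a m`, `right a m = m a`) and `d : A → M`. The axioms are `Calculus.IsFirstOrder`. -/
structure Calculus (k A M : Type*) [Field k] [Ring A] [Algebra k A] [AddCommGroup M]
    [Module k M] where
  /-- left multiplication -/
  left : A →ₗ[k] M →ₗ[k] M
  /-- right multiplication -/
  right : A →ₗ[k] M →ₗ[k] M
  /-- the differential -/
  d : A →ₗ[k] M

namespace Calculus

variable {k A M B : Type*} [Field k] [Ring A] [Algebra k A] [AddCommGroup M] [Module k M]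
  [Ring B] [Algebra k B]

/-- First order differential calculi on `A`: `M` is an `A`-bimodule, `d` is a derivation and `M` is
spanned by the elements `a d b`. -/
structure IsFirstOrder (C : Calculus k A M) : Prop where
  left_one : ∀ m, C.left 1 m = m
  left_mul : ∀ a b m, C.left (a * b) m = C.left a (C.left b m)
  right_one : ∀ m, C.right 1 m = m
  right_mul : ∀ a b m, C.right (a * b) m = C.right b (C.right a m)
  left_right : ∀ a b m, C.left a (C.right b m) = C.right b (C.left a m)
  leibniz : ∀ a b, C.d (a * b) = C.right b (C.d a) + C.left a (C.d b)
  span_eq_top : Submodule.span k {m | ∃ a b, m = C.left a (C.d b)} = ⊤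

/-- `(B, d)` is a differential graded algebra that receives `(M, d)`: the algebra map `i₀` maps `A`
to degree `0`, the bimodule map `i₁` maps `M` to degree `1`, and `d i₀ = i₁ d`. -/
structure MapsTo (C : Calculus k A M) (ℬ : ℕ → Submodule k B) [GradedAlgebra ℬ]
    (d : B →ₗ[k] B) (i₀ : A →ₐ[k] B) (i₁ : M →ₗ[k] B) : Prop where
  isDGA : IsDGA ℬ d
  deg_zero : ∀ a, i₀ a ∈ ℬ 0
  deg_one : ∀ m, i₁ m ∈ ℬ 1
  left : ∀ a m, i₁ (C.left a m) = i₀ a * i₁ m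
  right : ∀ a m, i₁ (C.right a m) = i₁ m * i₀ a
  d_comm : ∀ a, d (i₀ a) = i₁ (C.d a)

/-- `(B, d)` is an exterior algebra over `A` extending the first order calculus `(M, d)`: its
degree `0` is `A`, its degree `1` is `M`, and it is generated by these. -/
structure IsExteriorAlgebra (C : Calculus k A M) (ℬ : ℕ → Submodule k B) [GradedAlgebra ℬ]
    (d : B →ₗ[k] B) (i₀ : A →ₐ[k] B) (i₁ : M →ₗ[k] B) : Prop
    extends C.MapsTo ℬ d i₀ i₁ where
  injective_zero : Function.Injective i₀
  range_zero : LinearMap.range i₀.toLinearMap = ℬ 0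
  injective_one : Function.Injective i₁
  range_one : LinearMap.range i₁ = ℬ 1
  generated : Algebra.adjoin k (Set.range i₀ ∪ Set.range i₁) = ⊤

/-- `(B, d)` is the maximal prolongation of the first order calculus `(M, d)` on `A`: it is an
exterior algebra extending `(M, d)`, and every differential graded algebra that receives `(M, d)`
receives a unique map of differential graded algebras from `B` that is compatible with the maps of
`A` and `M`. In particular every exterior algebra extending `(M, d)` is a quotient of `B`. -/
structure IsMaximalProlongation (C : Calculus k A M) (ℬ : ℕ → Submodule k B) [GradedAlgebra ℬ]
    (d : B →ₗ[k] B) (i₀ : A →ₐ[k] B) (i₁ : M →ₗ[k] B) : Prop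
    extends C.IsExteriorAlgebra ℬ d i₀ i₁ where
  universal : ∀ (B' : Type w) [Ring B'] [Algebra k B'] (ℬ' : ℕ → Submodule k B')
    [GradedAlgebra ℬ'] (d' : B' →ₗ[k] B') (j₀ : A →ₐ[k] B') (j₁ : M →ₗ[k] B'),
    C.MapsTo ℬ' d' j₀ j₁ →
      ∃! F : B →ₐ[k] B', (∀ n, ∀ x ∈ ℬ n, F x ∈ ℬ' n) ∧ (∀ x, F (d x) = d' (F x)) ∧
        (∀ a, F (i₀ a) = j₀ a) ∧ (∀ m, F (i₁ m) = j₁ m)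

end Calculus

/-! ### The algebra `Λ_max` -/

section MaxExterior

variable {k A V : Type*} [Field k] [Ring A] [HopfAlgebra k A] [AddCommGroup V] [Module k V]

/-- The relations of `Λ_max`: `(ϖ π_ε ⊗ ϖ π_ε) Δ a = 0` in `T V` for `a ∈ ker ϖ ⊆ A⁺`. -/
inductive MaxRel (ϖ : APlus k A →ₗ[k] V) : TensorAlgebra k V → TensorAlgebra k V → Prop
  | of (a : APlus k A) (ha : ϖ a = 0) :
    MaxRel ϖ (sweedler ((LinearMap.mul k (TensorAlgebra k V)).compl₁₂
      (TensorAlgebra.ι k ∘ₗ ϖ ∘ₗ counitProj k A) (TensorAlgebra.ι k ∘ₗ ϖ ∘ₗ counitProj k A)) a) 0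

/-- `Λ_max`, the quotient of the tensor algebra `T V` by the two-sided ideal generated by
`(ϖ π_ε ⊗ ϖ π_ε) Δ (ker ϖ)`. -/
def MaxExterior (ϖ : APlus k A →ₗ[k] V) : Type _ := RingQuot (MaxRel ϖ)

namespace MaxExterior

variable (ϖ : APlus k A →ₗ[k] V)

instance : Ring (MaxExterior ϖ) := inferInstanceAs (Ring (RingQuot (MaxRel ϖ)))
instance : Algebra k (MaxExterior ϖ) := inferInstanceAs (Algebra k (RingQuot (MaxRel ϖ)))

/-- The quotient map `T V → Λ_max`. -/
def proj : TensorAlgebra k V →ₐ[k] MaxExterior ϖ := RingQuot.mkAlgHom k (MaxRel ϖ)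

/-- The map of generators `V → Λ_max`. -/
def ι : V →ₗ[k] MaxExterior ϖ := (proj ϖ).toLinearMap ∘ₗ TensorAlgebra.ι k

/-- The map `ϖ π_ε : A → Λ_max`, with values in degree one. -/
def mcForm : A →ₗ[k] MaxExterior ϖ := ι ϖ ∘ₗ ϖ ∘ₗ counitProj k A

/-- The degree `n` part of `Λ_max`: the span of the products of `n` generators. -/
abbrev deg (n : ℕ) : Submodule k (MaxExterior ϖ) := LinearMap.range (ι ϖ) ^ n

/-- The lift of an algebra map on generators that respects the relations (auxiliary). -/
def lift {B : Type*} [Ring B] [Algebra k B] (f : V →ₗ[k] B)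
    (hf : ∀ a : APlus k A, ϖ a = 0 → sweedler ((LinearMap.mul k B).compl₁₂
      (f ∘ₗ ϖ ∘ₗ counitProj k A) (f ∘ₗ ϖ ∘ₗ counitProj k A)) (a : A) = 0) :
    MaxExterior ϖ →ₐ[k] B :=
  RingQuot.liftAlgHom k ⟨TensorAlgebra.lift k f, by
    rintro _ _ ⟨a, ha⟩
    rw [map_zero, ← hf a ha, sweedler, sweedler, LinearMap.comp_apply, LinearMap.comp_apply]
    induction (Coalgebra.comul (R := k) (a : A)) with
    | zero => simp
    | add s t hs ht => simp only [map_add, hs, ht]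
    | tmul b c => simp⟩

theorem lift_ι {B : Type*} [Ring B] [Algebra k B] (f : V →ₗ[k] B) (hf) (v : V) :
    lift ϖ f hf (ι ϖ v) = f v := by
  change RingQuot.liftAlgHom k _ (RingQuot.mkAlgHom k _ _) = _
  rw [RingQuot.liftAlgHom_mkAlgHom_apply, TensorAlgebra.lift_ι_apply]

theorem mcForm_rel (a : APlus k A) (ha : ϖ a = 0) :
    sweedler ((LinearMap.mul k (MaxExterior ϖ)).compl₁₂ (mcForm ϖ) (mcForm ϖ)) (a : A) = 0 := by
  have h : proj ϖ _ = proj ϖ 0 := RingQuot.mkAlgHom_rel k (MaxRel.of a ha)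
  rw [map_zero] at h
  rw [← h, sweedler, sweedler, LinearMap.comp_apply, LinearMap.comp_apply]
  induction (Coalgebra.comul (R := k) (a : A)) with
  | zero => simp
  | add s t hs ht => simp only [map_add, hs, ht]
  | tmul b c => simp [mcForm, ι]

@[ext]
theorem algHom_ext {B : Type*} [Ring B] [Algebra k B] {f g : MaxExterior ϖ →ₐ[k] B}
    (h : f.toLinearMap ∘ₗ ι ϖ = g.toLinearMap ∘ₗ ι ϖ) : f = g := by
  have : f.comp (proj ϖ) = g.comp (proj ϖ) := TensorAlgebra.hom_ext h
  exact RingQuot.ringQuot_ext' k f g this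

instance : SetLike.GradedMonoid (deg ϖ) :=
  Submodule.nat_power_gradedMonoid (LinearMap.range (ι ϖ))

/-- The generators in the direct sum of the components (auxiliary). -/
def gradedι : V →ₗ[k] ⨁ n, deg ϖ n :=
  DirectSum.lof k ℕ (fun n => deg ϖ n) 1 ∘ₗ
    (ι ϖ).codRestrict _ fun m => by simpa only [pow_one] using LinearMap.mem_range_self _ m

/-- The decomposition, on the tensor algebra (auxiliary). -/
def gradedLift₀ : TensorAlgebra k V →ₐ[k] ⨁ n, deg ϖ n :=
  TensorAlgebra.lift k (by apply gradedι ϖ)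

theorem gradedLift₀_ι (v : V) : gradedLift₀ ϖ (TensorAlgebra.ι k v) =
    DirectSum.of (fun n => deg ϖ n) 1
      ⟨ι ϖ v, by simpa only [pow_one] using LinearMap.mem_range_self _ v⟩ := by
  rw [gradedLift₀, TensorAlgebra.lift_ι_apply]
  rfl

theorem gradedLift₀_rel {x y : TensorAlgebra k V} (h : MaxRel ϖ x y) :
    gradedLift₀ ϖ x = gradedLift₀ ϖ y := by
  obtain ⟨a, ha⟩ := h
  have key : ∀ t : A ⊗[k] A, ∃ y : deg ϖ (1 + 1),
      gradedLift₀ ϖ (TensorProduct.lift ((LinearMap.mul k (TensorAlgebra k V)).compl₁₂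
        (TensorAlgebra.ι k ∘ₗ ϖ ∘ₗ counitProj k A)
        (TensorAlgebra.ι k ∘ₗ ϖ ∘ₗ counitProj k A)) t) =
        DirectSum.of (fun n => deg ϖ n) (1 + 1) y ∧
      (y : MaxExterior ϖ) = TensorProduct.lift ((LinearMap.mul k (MaxExterior ϖ)).compl₁₂
        (mcForm ϖ) (mcForm ϖ)) t := by
    intro t
    induction t with
    | zero => exact ⟨0, by simp⟩
    | add s t hs ht =>
      obtain ⟨y, hy, hy'⟩ := hs
      obtain ⟨z, hz, hz'⟩ := ht
      exact ⟨y + z, by simp only [map_add, hy, hz], by simp [hy', hz']⟩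
    | tmul b c =>
      refine ⟨⟨ι ϖ (ϖ (counitProj k A b)) * ι ϖ (ϖ (counitProj k A c)), SetLike.GradedMul.mul_mem
        (by simpa only [pow_one] using LinearMap.mem_range_self _ _)
        (by simpa only [pow_one] using LinearMap.mem_range_self _ _)⟩, ?_, rfl⟩
      simp only [TensorProduct.lift.tmul, LinearMap.compl₁₂_apply, LinearMap.comp_apply,
        LinearMap.mul_apply', map_mul]
      rw [gradedLift₀_ι, gradedLift₀_ι, DirectSum.of_mul_of]
      rfl
  obtain ⟨y, hy, hy'⟩ := key (Coalgebra.comul (a : A))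
  have h0 : y = 0 := Subtype.ext (hy'.trans (mcForm_rel ϖ a ha))
  rw [h0, map_zero] at hy
  rw [map_zero]
  exact hy

/-- The decomposition into components (auxiliary). -/
def gradedLift : MaxExterior ϖ →ₐ[k] ⨁ n, deg ϖ n :=
  RingQuot.liftAlgHom k ⟨gradedLift₀ ϖ, fun _ _ h => gradedLift₀_rel ϖ h⟩

theorem gradedLift_ι (v : V) : gradedLift ϖ (ι ϖ v) =
    DirectSum.of (fun n => deg ϖ n) 1
      ⟨ι ϖ v, by simpa only [pow_one] using LinearMap.mem_range_self _ v⟩ := by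
  rw [← gradedLift₀_ι]
  exact RingQuot.liftAlgHom_mkAlgHom_apply k _ _ _

instance : GradedAlgebra (deg ϖ) :=
  GradedAlgebra.ofAlgHom _ (gradedLift ϖ)
    (by
      ext v
      rw [LinearMap.comp_apply, AlgHom.toLinearMap_apply, AlgHom.comp_apply, gradedLift_ι,
        DirectSum.coeAlgHom_of]
      rfl)
    (by
      rintro i ⟨x, hx⟩
      dsimp only
      induction hx using Submodule.pow_induction_on_left' with
      | algebraMap r => simp_rw [AlgHom.commutes, DirectSum.algebraMap_apply]; rfl
      | add _ _ _ _ _ ihx ihy => simp_rw [map_add, ihx, ihy, ← map_add]; rfl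
      | mem_mul _ hm _ _ _ ih =>
        obtain ⟨_, rfl⟩ := hm
        simp_rw [map_mul, ih, gradedLift_ι, DirectSum.of_mul_of]
        exact DirectSum.of_eq_of_gradedMonoid_eq (Sigma.subtype_ext (add_comm _ _) rfl))

end MaxExterior

/-- The first order calculus `Ω¹ = A ⊗ V` defined by `ϖ`: `a (b ⊗ v) = a b ⊗ v`,
`(b ⊗ v) a = b a₁ ⊗ v ◁ a₂` and `d a = a₁ ⊗ ϖ π_ε a₂`. -/
def firstOrder (X : ActCoact k A V) (ϖ : APlus k A →ₗ[k] V) : Calculus k A (A ⊗[k] V) where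
  left := LinearMap.rTensorHom V ∘ₗ LinearMap.mul k A
  right := sweedler ((TensorProduct.mapBilinear (RingHom.id k) A V A V).compl₁₂
    (LinearMap.mul k A).flip X.act.flip)
  d := (ϖ ∘ₗ counitProj k A).lTensor A ∘ₗ Coalgebra.comul

/-- The degree one inclusion `A ⊗ V → A ·▷< Λ_max`, `a ⊗ v ↦ a ⊗ v`. -/
def inclOne {ϖ : APlus k A →ₗ[k] V} (H : SuperBraidedHopf k A (MaxExterior.deg ϖ)) :
    A ⊗[k] V →ₗ[k] Bosonisation H :=
  (Bosonisation.ofTensor H).toLinearMap ∘ₗ (MaxExterior.ι ϖ).lTensor A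

/-- The Maurer-Cartan equation `d ϖ(a) + (ϖ π_ε a₁)(ϖ π_ε a₂) = 0` for `a ∈ A⁺`. -/
def MaurerCartan (ϖ : APlus k A →ₗ[k] V) (d : MaxExterior ϖ →ₗ[k] MaxExterior ϖ) : Prop :=
  ∀ a : APlus k A, d (MaxExterior.ι ϖ (ϖ a)) +
    sweedler ((LinearMap.mul k (MaxExterior ϖ)).compl₁₂
      (MaxExterior.mcForm ϖ) (MaxExterior.mcForm ϖ)) (a : A) = 0

/-- `(d η) ◁ a - d (η ◁ a) = (ϖ π_ε a₁) (η ◁ a₂) - (-1)^{|η|} (η ◁ a₁) (ϖ π_ε a₂)`. -/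
def ActionCompatible {ϖ : APlus k A →ₗ[k] V} (H : SuperBraidedHopf k A (MaxExterior.deg ϖ))
    (d : MaxExterior ϖ →ₗ[k] MaxExterior ϖ) : Prop :=
  ∀ n, ∀ η ∈ MaxExterior.deg ϖ n, ∀ a : A,
    H.act (d η) a - d (H.act η a) =
      sweedler ((LinearMap.mul k (MaxExterior ϖ)).compl₁₂
        (MaxExterior.mcForm ϖ) (H.act η)) a -
      (-1 : k) ^ n • sweedler ((LinearMap.mul k (MaxExterior ϖ)).compl₁₂
        (H.act η) (MaxExterior.mcForm ϖ)) a

/-- `Δ d η - (d ⊗ id + (-1)^{| |} ⊗ d) Δ η = (-1)^{|η₁|} (η₁)₀ ⊗ (ϖ π_ε (η₁)₁) η₂`, with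
`Δ η = η₁ ⊗ η₂` the braided coproduct. -/
def CoproductCompatible {ϖ : APlus k A →ₗ[k] V} (H : SuperBraidedHopf k A (MaxExterior.deg ϖ))
    (d : MaxExterior ϖ →ₗ[k] MaxExterior ϖ) : Prop :=
  ∀ η, H.comul (d η) - (d.rTensor (MaxExterior ϖ) (H.comul η) +
      TensorProduct.map (parity (MaxExterior.deg ϖ)) d (H.comul η)) =
    (TensorProduct.lift (LinearMap.mul k (MaxExterior ϖ) ∘ₗ
      MaxExterior.mcForm ϖ)).lTensor (MaxExterior ϖ)
      (TensorProduct.assoc k (MaxExterior ϖ) A (MaxExterior ϖ)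
        ((H.coact ∘ₗ parity (MaxExterior.deg ϖ)).rTensor (MaxExterior ϖ) (H.comul η)))

end MaxExterior

end BraidedCalculus

end

open BraidedCalculus

/-! Write `V` for `Λ¹`, `mcV` for `ϖ π_ε : A → V`, and `Λ` for `Λ_max`. The relations of `Λ` are
quadratic and indexed by `ker ϖ`, so a linear map `f` from `V` to an algebra extends to `Λ` as soon
as `f(mcV a₁) f(mcV a₂)` vanishes whenever `a ∈ A⁺` and `mcV a = 0` (`exists_lift`). Each structure
on `Λ` comes from this one universal property, with a suitable target algebra: the convolution
algebra `Hom(A, Λ)` for the action, `Λ ⊗ A` for the coaction, `End(Λ ⊗ Λ)` for the coproduct, `End(Λ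
× Λ)` for the differential, and an arbitrary differential graded algebra for maximality. Most
identities on `Λ` are then checked by induction on left multiplication by a generator (`lin_ext`).

That the relations are respected rests on a few computations with `mcV`. Right linearity of `ϖ`
gives `mcV a ◁ b = mcV (a b) - ε(a) mcV b` (`act_mcV`), so the relations are stable under the
action. The adjoint coaction commutes with the coproduct of `A` (`sw_coact_coact_mcV`), so they are
stable under the coaction. Finally `Ψ(mcV a₁ ⊗ mcV a₂)` equals `mcV a₁ ⊗ mcV a₂` up to a term that
depends only on `mcV a` (`sw_braid_mcV`), so the relations are fixed by `Ψ`. With the super sign the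
mixed terms in the square of a primitive element are `id - Ψ`; they cancel on the relations, and the
coproduct exists (`sw_leftOp_leftOp`). The antipode is the geometric series for the convolution
inverse of `id`, finite in each degree because `Λ` is connected.

The square `mcV a₁ mcV a₂`, taken in `Λ`, depends only on `mcV a` (`exists_mcForm_sq`), which gives
`q : V → Λ²`, and the Maurer-Cartan equation says `d = -q` on `V`. Coassociativity yields `q(mcV a₁)
mcV a₂ = mcV a₁ q(mcV a₂)`; this makes `d` well defined and also gives `d² = 0`. The failure of `d`
to commute with the action is already visible on `q` (`q_act`) and propagates by the Leibniz rule
(`act_d`). The failure to commute with the coproduct comes from the correction term in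
`sw_braid_mcV` (`tensorDeriv_leftOp`).

On the bosonisation the two failures are what is needed. The differential of `a` is `a₁ mcV a₂`, so
`act_d` makes `d` compatible with the cross relation, and the correction in `tensorDeriv` is the
differential of the `A`-factor that the braided coproduct creates (`tensorD_comulΛ`).
Multiplicativity of the coproduct is reduced to products of elements of `A` and of `Λ` by
associativity of the super tensor square.

For maximality, `d² = 0` on the image of `A` in another differential graded algebra, with the factor
from `A` stripped off by the antipode, is the Maurer-Cartan equation there (`mapsTo_maurerCartan`).
For `mcV a = 0` it becomes the defining relation of `Λ`. Degree one is not too small because the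
square-zero extension of `k` by `V` satisfies all quadratic relations (`ι_injective`). -/

noncomputable section

namespace BraidedCalculus

set_option linter.unusedSectionVars false

/-! ### Linear dependence and sums over tensors -/

section LinearDependence

/-- `Lin k f` says that the function `f` is `k`-linear; proved by `fun_prop`. -/
@[fun_prop]
def Lin (k : Type*) {U M : Type*} [Field k] [AddCommMonoid U] [Module k U] [AddCommMonoid M]
    [Module k M] (f : U → M) : Prop := IsLinearMap k f

variable {k U W M B C : Type*} [Field k] [AddCommMonoid U] [Module k U] [AddCommMonoid W]
  [Module k W] [AddCommMonoid M] [Module k M] [Ring B] [Algebra k B] [Ring C] [Algebra k C]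

namespace Lin

@[fun_prop]
theorem id : Lin k (fun x : U => x) := ⟨fun _ _ => rfl, fun _ _ => rfl⟩

@[fun_prop]
theorem comp {f : W → M} {g : U → W} (hf : Lin k f) (hg : Lin k g) : Lin k (fun x => f (g x)) :=
  ⟨fun x y => by rw [hg.map_add, hf.map_add], fun c x => by rw [hg.map_smul, hf.map_smul]⟩

@[fun_prop]
theorem zero : Lin k (fun _ : U => (0 : M)) := ⟨fun _ _ => by simp, fun _ _ => by simp⟩

@[fun_prop]
theorem add {f g : U → M} (hf : Lin k f) (hg : Lin k g) : Lin k (fun x => f x + g x) :=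
  ⟨fun x y => by rw [hf.map_add, hg.map_add, add_add_add_comm],
    fun c x => by rw [hf.map_smul, hg.map_smul, smul_add]⟩

@[fun_prop]
theorem sub {M : Type*} [AddCommGroup M] [Module k M] {f g : U → M} (hf : Lin k f) (hg : Lin k g) : Lin k (fun x => f x - g x) :=
  ⟨fun x y => by rw [hf.map_add, hg.map_add]; abel,
    fun c x => by rw [hf.map_smul, hg.map_smul, smul_sub]⟩

@[fun_prop]
theorem neg {M : Type*} [AddCommGroup M] [Module k M] {f : U → M} (hf : Lin k f) : Lin k (fun x => -f x) :=
  ⟨fun x y => by rw [hf.map_add]; abel, fun c x => by rw [hf.map_smul, smul_neg]⟩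

@[fun_prop]
theorem const_smul {f : U → M} (c : k) (hf : Lin k f) : Lin k (fun x => c • f x) :=
  ⟨fun x y => by rw [hf.map_add, smul_add], fun c x => by rw [hf.map_smul, smul_comm]⟩

@[fun_prop]
theorem smul_const {f : U → k} (c : M) (hf : Lin k f) : Lin k (fun x => f x • c) :=
  ⟨fun x y => by rw [hf.map_add, add_smul], fun c x => by rw [hf.map_smul, smul_assoc]⟩

@[fun_prop]
theorem tmul_const {f : U → W} (c : M) (hf : Lin k f) : Lin k (fun x => f x ⊗ₜ[k] c) :=
  ⟨fun x y => by rw [hf.map_add, TensorProduct.add_tmul],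
    fun c x => by rw [hf.map_smul, TensorProduct.smul_tmul']⟩

@[fun_prop]
theorem const_tmul {f : U → W} (c : M) (hf : Lin k f) : Lin k (fun x => c ⊗ₜ[k] f x) :=
  ⟨fun x y => by rw [hf.map_add, TensorProduct.tmul_add],
    fun c x => by rw [hf.map_smul, TensorProduct.tmul_smul]⟩

@[fun_prop]
theorem linearMap {f : U → W} (F : W →ₗ[k] M) (hf : Lin k f) : Lin k (fun x => F (f x)) :=
  ⟨fun x y => by rw [hf.map_add, map_add], fun c x => by rw [hf.map_smul, map_smul]⟩

@[fun_prop]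
theorem linearMap_const {F : U → (W →ₗ[k] M)} (w : W) (hf : Lin k F) : Lin k (fun x => F x w) :=
  ⟨fun x y => by rw [hf.map_add, LinearMap.add_apply],
    fun c x => by rw [hf.map_smul, LinearMap.smul_apply]⟩

@[fun_prop]
theorem linearEquiv {f : U → W} (F : W ≃ₗ[k] M) (hf : Lin k f) : Lin k (fun x => F (f x)) :=
  ⟨fun x y => by rw [hf.map_add, map_add], fun c x => by rw [hf.map_smul, map_smul]⟩

@[fun_prop]
theorem algHom {f : U → B} (F : B →ₐ[k] C) (hf : Lin k f) : Lin k (fun x => F (f x)) :=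
  ⟨fun x y => by rw [hf.map_add, map_add], fun c x => by rw [hf.map_smul, map_smul]⟩

@[fun_prop]
theorem algebraMap {f : U → k} (hf : Lin k f) : Lin k (fun x => algebraMap k B (f x)) :=
  ⟨fun x y => by rw [hf.map_add, map_add],
    fun c x => by rw [hf.map_smul, smul_eq_mul, map_mul, Algebra.smul_def]⟩

@[fun_prop]
theorem mul_const {f : U → B} (c : B) (hf : Lin k f) : Lin k (fun x => f x * c) :=
  ⟨fun x y => by rw [hf.map_add, add_mul], fun c x => by rw [hf.map_smul, smul_mul_assoc]⟩

@[fun_prop]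
theorem const_mul {f : U → B} (c : B) (hf : Lin k f) : Lin k (fun x => c * f x) :=
  ⟨fun x y => by rw [hf.map_add, mul_add], fun c x => by rw [hf.map_smul, mul_smul_comm]⟩

/-- The bundled linear map. -/
def toMap (f : U → M) (hf : Lin k f) : U →ₗ[k] M := IsLinearMap.mk' f hf

@[simp]
theorem toMap_apply (f : U → M) (hf : Lin k f) (x : U) : toMap f hf x = f x := rfl

end Lin

/-- The bilinear map with the given values. -/
def mkBilin (f : U → W → M) (h₁ : ∀ y, Lin k (fun x => f x y)) (h₂ : ∀ x, Lin k (fun y => f x y)) :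
    U →ₗ[k] W →ₗ[k] M :=
  LinearMap.mk₂ k f (fun _ _ _ => (h₁ _).map_add _ _) (fun _ _ _ => (h₁ _).map_smul _ _)
    (fun _ _ _ => (h₂ _).map_add _ _) (fun _ _ _ => (h₂ _).map_smul _ _)

@[simp]
theorem mkBilin_apply (f : U → W → M) (h₁ : ∀ y, Lin k (fun x => f x y))
    (h₂ : ∀ x, Lin k (fun y => f x y)) (x : U) (y : W) : mkBilin f h₁ h₂ x y = f x y := rfl

end LinearDependence

section SumOverTensor

variable {k U W U' W' M N B : Type*} [Field k] [AddCommMonoid U] [Module k U] [AddCommMonoid W]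
  [Module k W] [AddCommMonoid M] [Module k M] [AddCommMonoid N] [Module k N]
  [AddCommMonoid U'] [Module k U'] [AddCommMonoid W'] [Module k W'] [Ring B] [Algebra k B]

/-- `sw t f = ∑ f(x, y)` for a chosen expression `t = ∑ x ⊗ y`. It does not depend on the choice
if `f` is bilinear. -/
def sw (t : U ⊗[k] W) (f : U → W → M) : M :=
  ∑ i ∈ (TensorProduct.exists_finset t).choose, f i.1 i.2

theorem sw_tmul_self (t : U ⊗[k] W) : sw t (fun x y => x ⊗ₜ[k] y) = t :=
  (TensorProduct.exists_finset t).choose_spec.symm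

theorem sw_apply (t : U ⊗[k] W) (f : U →ₗ[k] W →ₗ[k] M) :
    sw t (fun x y => f x y) = TensorProduct.lift f t := by
  conv_rhs => rw [(TensorProduct.exists_finset t).choose_spec]
  simp [sw]

theorem sw_eq_lift (t : U ⊗[k] W) (f : U → W → M) (h₁ : ∀ y, Lin k (fun x => f x y))
    (h₂ : ∀ x, Lin k (fun y => f x y)) : sw t f = TensorProduct.lift (mkBilin f h₁ h₂) t :=
  sw_apply t (mkBilin f h₁ h₂)

@[fun_prop]
theorem Lin.sw_left {T : N → U ⊗[k] W} (hT : Lin k T) {f : U → W → M}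
    (h₁ : ∀ y, Lin k (fun x => f x y)) (h₂ : ∀ x, Lin k (fun y => f x y)) :
    Lin k (fun n => sw (T n) f) := by
  simp_rw [sw_eq_lift _ f h₁ h₂]
  fun_prop

@[fun_prop]
theorem Lin.sw_right (t : U ⊗[k] W) {f : N → U → W → M} (h : ∀ x y, Lin k (fun n => f n x y)) :
    Lin k (fun n => sw t (f n)) := by
  constructor
  · intro x y
    simp [sw, (h _ _).map_add, Finset.sum_add_distrib]
  · intro x y
    simp [sw, (h _ _).map_smul, Finset.smul_sum]

theorem sw_tmul (x : U) (y : W) (f : U → W → M) (h₁ : ∀ y, Lin k (fun x => f x y))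
    (h₂ : ∀ x, Lin k (fun y => f x y)) : sw (x ⊗ₜ[k] y) f = f x y := by
  rw [sw_eq_lift _ f h₁ h₂]; rfl

/-- Only `f` has to be bilinear: both sides use the same chosen expression of `t`, so nothing is
asked of `g`. This is what makes nested sums rewrite freely. -/
theorem sw_sw (t : U ⊗[k] W) (g : U → W → U' ⊗[k] W') (f : U' → W' → M)
    (h₁ : ∀ y, Lin k (fun x => f x y)) (h₂ : ∀ x, Lin k (fun y => f x y)) :
    sw (sw t g) f = sw t (fun x y => sw (g x y) f) := by
  simp only [sw_eq_lift _ f h₁ h₂]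
  simp [sw]

theorem sw_zero (f : U → W → M) (h₁ : ∀ y, Lin k (fun x => f x y))
    (h₂ : ∀ x, Lin k (fun y => f x y)) : sw (0 : U ⊗[k] W) f = 0 := by
  rw [sw_eq_lift _ f h₁ h₂, map_zero]

theorem sw_add (s t : U ⊗[k] W) (f : U → W → M) (h₁ : ∀ y, Lin k (fun x => f x y))
    (h₂ : ∀ x, Lin k (fun y => f x y)) : sw (s + t) f = sw s f + sw t f := by
  simp only [sw_eq_lift _ f h₁ h₂, map_add]

theorem sw_neg {U W M : Type*} [AddCommGroup U] [Module k U] [AddCommGroup W] [Module k W]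
    [AddCommGroup M] [Module k M] (t : U ⊗[k] W) (f : U → W → M) (h₁ : ∀ y, Lin k (fun x => f x y))
    (h₂ : ∀ x, Lin k (fun y => f x y)) : sw (-t) f = -sw t f := by
  simp only [sw_eq_lift _ f h₁ h₂, map_neg]

theorem sw_smul (c : k) (t : U ⊗[k] W) (f : U → W → M) (h₁ : ∀ y, Lin k (fun x => f x y))
    (h₂ : ∀ x, Lin k (fun y => f x y)) : sw (c • t) f = c • sw t f := by
  simp only [sw_eq_lift _ f h₁ h₂, map_smul]

theorem sw_fun_zero (t : U ⊗[k] W) : sw t (fun _ _ => (0 : M)) = 0 := by simp [sw]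

theorem sw_fun_add (t : U ⊗[k] W) (f g : U → W → M) :
    sw t (fun x y => f x y + g x y) = sw t f + sw t g := Finset.sum_add_distrib

theorem sw_fun_sub {M : Type*} [AddCommGroup M] [Module k M] (t : U ⊗[k] W) (f g : U → W → M) :
    sw t (fun x y => f x y - g x y) = sw t f - sw t g := Finset.sum_sub_distrib _ _

theorem sw_fun_neg {M : Type*} [AddCommGroup M] [Module k M] (t : U ⊗[k] W) (f : U → W → M) :
    sw t (fun x y => -f x y) = -sw t f := Finset.sum_neg_distrib _

theorem sw_fun_smul (c : k) (t : U ⊗[k] W) (f : U → W → M) :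
    sw t (fun x y => c • f x y) = c • sw t f := Finset.smul_sum.symm

theorem sw_comm (t : U ⊗[k] W) (s : U' ⊗[k] W') (f : U → W → U' → W' → M) :
    sw t (fun x y => sw s (f x y)) = sw s (fun z w => sw t (fun x y => f x y z w)) :=
  Finset.sum_comm

theorem Lin.map_sw {F : M → N} (hF : Lin k F) (t : U ⊗[k] W) (f : U → W → M) :
    F (sw t f) = sw t (fun x y => F (f x y)) := map_sum (Lin.toMap F hF) _ _

theorem map_sw (F : M →ₗ[k] N) (t : U ⊗[k] W) (f : U → W → M) :
    F (sw t f) = sw t (fun x y => F (f x y)) := map_sum F _ _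

theorem map_sw_equiv (F : M ≃ₗ[k] N) (t : U ⊗[k] W) (f : U → W → M) :
    F (sw t f) = sw t (fun x y => F (f x y)) := map_sum F _ _

theorem map_sw_algHom {C : Type*} [Ring C] [Algebra k C] (F : B →ₐ[k] C) (t : U ⊗[k] W)
    (f : U → W → B) : F (sw t f) = sw t (fun x y => F (f x y)) := map_sum F _ _

theorem sw_apply_const (t : U ⊗[k] W) (f : U → W → M →ₗ[k] N) (m : M) :
    (sw t f) m = sw t (fun x y => f x y m) := by simp [sw]

theorem sw_mul (t : U ⊗[k] W) (f : U → W → B) (b : B) :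
    sw t f * b = sw t (fun x y => f x y * b) := Finset.sum_mul _ _ _

theorem mul_sw (t : U ⊗[k] W) (f : U → W → B) (b : B) :
    b * sw t f = sw t (fun x y => b * f x y) := Finset.mul_sum _ _ _

theorem tmul_sw (t : U ⊗[k] W) (f : U → W → M) (n : N) :
    n ⊗ₜ[k] sw t f = sw t (fun x y => n ⊗ₜ[k] f x y) := TensorProduct.tmul_sum _ _ _

theorem sw_tmul_const (t : U ⊗[k] W) (f : U → W → M) (n : N) :
    sw t f ⊗ₜ[k] n = sw t (fun x y => f x y ⊗ₜ[k] n) := TensorProduct.sum_tmul _ _ _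

theorem smul_sw (c : k) (t : U ⊗[k] W) (f : U → W → M) :
    c • sw t f = sw t (fun x y => c • f x y) := Finset.smul_sum

theorem sw_congr (t : U ⊗[k] W) {f g : U → W → M} (h : ∀ x y, f x y = g x y) : sw t f = sw t g :=
  Finset.sum_congr rfl fun _ _ => h _ _

theorem sw_map (F : U →ₗ[k] U') (G : W →ₗ[k] W') (t : U ⊗[k] W) (f : U' → W' → M)
    (h₁ : ∀ y, Lin k (fun x => f x y)) (h₂ : ∀ x, Lin k (fun y => f x y)) :
    sw (TensorProduct.map F G t) f = sw t (fun x y => f (F x) (G y)) := by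
  rw [sw_eq_lift _ f h₁ h₂, sw_eq_lift _ _ (by fun_prop) (by fun_prop), ← LinearMap.comp_apply]
  congr 1
  ext; simp

theorem sw_rTensor (F : U →ₗ[k] U') (t : U ⊗[k] W) (f : U' → W → M)
    (h₁ : ∀ y, Lin k (fun x => f x y)) (h₂ : ∀ x, Lin k (fun y => f x y)) :
    sw (F.rTensor W t) f = sw t (fun x y => f (F x) y) := sw_map F LinearMap.id t f h₁ h₂

theorem sw_lTensor (G : W →ₗ[k] W') (t : U ⊗[k] W) (f : U → W' → M)
    (h₁ : ∀ y, Lin k (fun x => f x y)) (h₂ : ∀ x, Lin k (fun y => f x y)) :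
    sw (G.lTensor U t) f = sw t (fun x y => f x (G y)) := sw_map LinearMap.id G t f h₁ h₂

theorem rTensor_eq_sw (F : U →ₗ[k] U') (t : U ⊗[k] W) :
    F.rTensor W t = sw t (fun x y => F x ⊗ₜ[k] y) := by
  conv_lhs => rw [← sw_tmul_self t, map_sw]
  rfl

theorem lTensor_eq_sw (G : W →ₗ[k] W') (t : U ⊗[k] W) :
    G.lTensor U t = sw t (fun x y => x ⊗ₜ[k] G y) := by
  conv_lhs => rw [← sw_tmul_self t, map_sw]
  rfl

theorem map_eq_sw (F : U →ₗ[k] U') (G : W →ₗ[k] W') (t : U ⊗[k] W) :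
    TensorProduct.map F G t = sw t (fun x y => F x ⊗ₜ[k] G y) := by
  conv_lhs => rw [← sw_tmul_self t, map_sw]
  rfl

theorem lift_eq_sw (f : U →ₗ[k] W →ₗ[k] M) (t : U ⊗[k] W) :
    TensorProduct.lift f t = sw t (fun x y => f x y) := (sw_apply t f).symm

theorem map_eq_sw_tmul (F : U ⊗[k] W →ₗ[k] M) (t : U ⊗[k] W) :
    F t = sw t (fun x y => F (x ⊗ₜ y)) := by
  conv_lhs => rw [← sw_tmul_self t, map_sw]

end SumOverTensor

/-! ### Sweedler rules in a Hopf algebra -/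

section SweedlerRules

variable {k A V M : Type*} [Field k] [Ring A] [HopfAlgebra k A] [AddCommMonoid M] [Module k M]
  [AddCommMonoid V] [Module k V]

local notation "δ" => Coalgebra.comul (R := k)
local notation "ε" => Coalgebra.counit (R := k)

/-- Both sides are linear in `t`, so pure tensors suffice. Every coassociativity axiom, stated with
`TensorProduct.assoc`, becomes a rule for nested sums through this lemma. -/
theorem sw_assoc {U W Z : Type*} [AddCommMonoid U] [Module k U] [AddCommMonoid W] [Module k W]
    [AddCommMonoid Z] [Module k Z] (t : (U ⊗[k] W) ⊗[k] Z) (F : U → W → Z → M)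
    (h₁ : ∀ b c, Lin k (fun a => F a b c)) (h₂ : ∀ a c, Lin k (fun b => F a b c))
    (h₃ : ∀ a b, Lin k (fun c => F a b c)) :
    sw t (fun s c => sw s (fun a b => F a b c)) =
      sw (TensorProduct.assoc k U W Z t) (fun a s => sw s (fun b c => F a b c)) := by
  rw [sw_eq_lift _ _ (by fun_prop) (by fun_prop), sw_eq_lift _ _ (by fun_prop) (by fun_prop)]
  refine LinearMap.congr_fun (f := TensorProduct.lift _)
    (g := TensorProduct.lift _ ∘ₗ (TensorProduct.assoc k U W Z).toLinearMap) ?_ t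
  ext a b c
  simp (disch := fun_prop) [sw_tmul]

theorem sw_coassoc (F : A → A → A → M) (h₁ : ∀ b c, Lin k (fun a => F a b c))
    (h₂ : ∀ a c, Lin k (fun b => F a b c)) (h₃ : ∀ a b, Lin k (fun c => F a b c)) (a : A) :
    sw (δ a) (fun a₁ a₂ => sw (δ a₁) (fun b c => F b c a₂)) =
      sw (δ a) (fun a₁ a₂ => sw (δ a₂) (fun b c => F a₁ b c)) := by
  have h := congrArg (fun t => sw t (fun a s => sw s (fun b c => F a b c)))
    (Coalgebra.coassoc_apply (R := k) a)
  rw [sw_lTensor _ _ _ (by fun_prop) (by fun_prop), ← sw_assoc _ _ h₁ h₂ h₃,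
    sw_rTensor _ _ _ (by fun_prop) (by fun_prop)] at h
  exact h

theorem sw_counit_left (f : A → M) (hf : Lin k f) (a : A) :
    sw (δ a) (fun a₁ a₂ => ε a₁ • f a₂) = f a := by
  have h := congrArg (fun t => sw t (fun c a => c • f a))
    (Coalgebra.rTensor_counit_comul (R := k) a)
  rw [sw_rTensor _ _ _ (by fun_prop) (by fun_prop), sw_tmul _ _ _ (by fun_prop) (by fun_prop),
    one_smul] at h
  exact h

theorem sw_counit_right (f : A → M) (hf : Lin k f) (a : A) :
    sw (δ a) (fun a₁ a₂ => ε a₂ • f a₁) = f a := by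
  have h := congrArg (fun t => sw t (fun a c => c • f a))
    (Coalgebra.lTensor_counit_comul (R := k) a)
  rw [sw_lTensor _ _ _ (by fun_prop) (by fun_prop), sw_tmul _ _ _ (by fun_prop) (by fun_prop),
    one_smul] at h
  exact h

theorem sw_antipode_left (f : A → M) (hf : Lin k f) (a : A) :
    sw (δ a) (fun a₁ a₂ => f (HopfAlgebra.antipode k a₁ * a₂)) = ε a • f 1 := by
  have h := congrArg f (HopfAlgebra.mul_antipode_rTensor_comul_apply (R := k) a)
  rw [rTensor_eq_sw, map_sw, hf.map_sw, Algebra.algebraMap_eq_smul_one, hf.map_smul] at h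
  exact h

theorem sw_antipode_right (f : A → M) (hf : Lin k f) (a : A) :
    sw (δ a) (fun a₁ a₂ => f (a₁ * HopfAlgebra.antipode k a₂)) = ε a • f 1 := by
  have h := congrArg f (HopfAlgebra.mul_antipode_lTensor_comul_apply (R := k) a)
  rw [lTensor_eq_sw, map_sw, hf.map_sw, Algebra.algebraMap_eq_smul_one, hf.map_smul] at h
  exact h

/-- `a₁ S(a₂) ⊗ a₃ = 1 ⊗ a`. -/
theorem sw_mul_antipode_cancel (F : A → A → M) (h₁ : ∀ b, Lin k (fun a => F a b))
    (h₂ : ∀ a, Lin k (fun b => F a b)) (a : A) :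
    sw (δ a) (fun a₁ a' => sw (δ a') (fun a₂ a₃ => F (a₁ * HopfAlgebra.antipode k a₂) a₃)) =
      F 1 a := by
  rw [← sw_coassoc (fun a₁ a₂ a₃ => F (a₁ * HopfAlgebra.antipode k a₂) a₃) (by fun_prop)
    (by fun_prop) (by fun_prop),
    sw_congr _ fun a₁ a₂ => sw_antipode_right (fun p => F p a₂) (by fun_prop) a₁,
    sw_counit_left _ (by fun_prop)]

/-- `S(a₁) a₂ ⊗ a₃ = 1 ⊗ a`. -/
theorem sw_antipode_mul_cancel (F : A → A → M) (h₁ : ∀ b, Lin k (fun a => F a b))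
    (h₂ : ∀ a, Lin k (fun b => F a b)) (a : A) :
    sw (δ a) (fun a₁ a' => sw (δ a') (fun a₂ a₃ => F (HopfAlgebra.antipode k a₁ * a₂) a₃)) =
      F 1 a := by
  rw [← sw_coassoc (fun a₁ a₂ a₃ => F (HopfAlgebra.antipode k a₁ * a₂) a₃) (by fun_prop)
    (by fun_prop) (by fun_prop),
    sw_congr _ fun a₁ a₂ => sw_antipode_left (fun p => F p a₂) (by fun_prop) a₁,
    sw_counit_left _ (by fun_prop)]

theorem comul_mul_eq_sw (a b : A) : δ (a * b) =
    sw (δ a) (fun a₁ a₂ => sw (δ b) (fun b₁ b₂ => (a₁ * b₁) ⊗ₜ[k] (a₂ * b₂))) := by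
  rw [Bialgebra.comul_mul]
  conv_lhs => rw [← sw_tmul_self (δ a), ← sw_tmul_self (δ b)]
  simp only [sw_mul, mul_sw, Algebra.TensorProduct.tmul_mul_tmul]
  exact sw_comm _ _ _

theorem comul_one_eq : δ (1 : A) = 1 ⊗ₜ 1 := Bialgebra.comul_one

theorem sweedler_eq_sw (f : A →ₗ[k] A →ₗ[k] M) (a : A) :
    sweedler f a = sw (δ a) (fun a₁ a₂ => f a₁ a₂) := lift_eq_sw f _

theorem sweedler₃_eq_sw (f : A →ₗ[k] A →ₗ[k] A →ₗ[k] M) (a : A) :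
    sweedler₃ f a = sw (δ a) (fun a₁ a₂ => sw (δ a₂) (fun b c => f a₁ b c)) := by
  rw [sweedler₃, LinearMap.comp_apply, lift_eq_sw, LinearMap.comp_apply,
    sw_lTensor _ _ _ (by fun_prop) (by fun_prop)]
  refine sw_congr _ fun x y => ?_
  rw [map_eq_sw_tmul]
  rfl

end SweedlerRules

/-! ### Sweedler calculus in crossed modules -/

section CrossedCalculus

variable {k A V W M : Type*} [Field k] [Ring A] [HopfAlgebra k A] [AddCommMonoid M] [Module k M]
  [AddCommGroup V] [Module k V] [AddCommGroup W] [Module k W]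

local notation "δ" => Coalgebra.comul (R := k)
local notation "ε" => Coalgebra.counit (R := k)
local notation "S" => HopfAlgebra.antipode k

theorem middle_tmul {U V W V' W' Z : Type*}
    [AddCommGroup U] [Module k U] [AddCommGroup V] [Module k V] [AddCommGroup W] [Module k W]
    [AddCommGroup V'] [Module k V'] [AddCommGroup W'] [Module k W'] [AddCommGroup Z] [Module k Z]
    (τ : V ⊗[k] W →ₗ[k] W' ⊗[k] V') (a : U) (v : V) (c : W) (z : Z) :
    middle τ ((a ⊗ₜ v) ⊗ₜ (c ⊗ₜ z)) = sw (τ (v ⊗ₜ c)) (fun p q => (a ⊗ₜ[k] p) ⊗ₜ[k] (q ⊗ₜ[k] z)) := by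
  simp only [middle, LinearMap.comp_apply, LinearEquiv.coe_coe, TensorProduct.assoc_tmul,
    LinearMap.lTensor_tmul, TensorProduct.assoc_symm_tmul, LinearMap.rTensor_tmul]
  conv_lhs => rw [← sw_tmul_self (τ (v ⊗ₜ c))]
  simp only [sw_tmul_const, tmul_sw, map_sw_equiv, TensorProduct.assoc_tmul,
    TensorProduct.assoc_symm_tmul]

namespace ActCoact

variable (X : ActCoact k A V) (Y : ActCoact k A W)

theorem tensor_act (t : V ⊗[k] W) (a : A) : (X.tensor Y).act t a =
    sw (δ a) (fun a₁ a₂ => sw t (fun x y => X.act x a₁ ⊗ₜ[k] Y.act y a₂)) := by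
  rw [tensor, LinearMap.flip_apply, sweedler_eq_sw, sw_apply_const]
  refine sw_congr _ fun a₁ a₂ => ?_
  rw [map_eq_sw_tmul]
  rfl

theorem tensor_coact (t : V ⊗[k] W) : (X.tensor Y).coact t =
    sw t (fun x y => sw (X.coact x) (fun x₀ x₁ => sw (Y.coact y) (fun y₀ y₁ =>
      (x₀ ⊗ₜ[k] y₀) ⊗ₜ[k] (x₁ * y₁)))) := by
  rw [tensor, map_eq_sw_tmul]
  refine sw_congr _ fun x y => ?_
  rw [LinearMap.comp_apply, LinearMap.comp_apply, TensorProduct.map_tmul]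
  conv_lhs => rw [← sw_tmul_self (X.coact x), ← sw_tmul_self (Y.coact y)]
  simp only [sw_tmul_const, tmul_sw, map_sw, LinearEquiv.coe_coe]
  rw [sw_comm]
  rfl

theorem braiding_tmul (v : V) (y : W) : X.braiding Y (v ⊗ₜ y) =
    sw (Y.coact y) (fun y₀ y₁ => y₀ ⊗ₜ[k] X.act v y₁) := by
  rw [braiding, LinearMap.comp_apply, LinearMap.comp_apply, LinearMap.lTensor_tmul]
  conv_lhs => rw [← sw_tmul_self (Y.coact y)]
  simp only [tmul_sw, map_sw, LinearEquiv.coe_coe]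
  rfl

variable {X} (F : V → A → M)

theorem sw_coact_act_of (h : ∀ v a, X.coact (X.act v a) = sweedler₃ X.twistedAct a (X.coact v))
    (v : V) (a : A) : X.coact (X.act v a) = sw (δ a) (fun a₁ a₂ => sw (δ a₂) (fun b c =>
      sw (X.coact v) (fun v₀ v₁ => X.act v₀ b ⊗ₜ[k] (S a₁ * (v₁ * c))))) := by
  rw [h, sweedler₃_eq_sw]
  simp only [sw_apply_const]
  refine sw_congr _ fun a₁ a₂ => sw_congr _ fun b c => ?_
  rw [map_eq_sw_tmul]
  simp only [twistedAct_tmul]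

/-- The compatibility of action and coaction, with the antipode cancelled:
`(v ◁ a₂)₀ ⊗ a₁ (v ◁ a₂)₁ = v₀ ◁ a₁ ⊗ v₁ a₂`. -/
theorem sw_mul_coact_act_of
    (h : ∀ v a, X.coact (X.act v a) = sweedler₃ X.twistedAct a (X.coact v))
    (h₁ : ∀ b, Lin k (fun a => F a b)) (h₂ : ∀ a, Lin k (fun b => F a b)) (v : V) (a : A) :
    sw (δ a) (fun a₁ a₂ => sw (X.coact (X.act v a₂)) (fun p q => F p (a₁ * q))) =
      sw (δ a) (fun a₁ a₂ => sw (X.coact v) (fun v₀ v₁ => F (X.act v₀ a₁) (v₁ * a₂))) := by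
  simp (disch := fun_prop) only [sw_coact_act_of h, sw_sw, sw_tmul]
  simp only [← mul_assoc (_ : A) (S _)]
  rw [sw_mul_antipode_cancel (fun p a' => sw (δ a') (fun b c => sw (X.coact v) (fun v₀ v₁ =>
    F (X.act v₀ b) (p * (v₁ * c))))) (by fun_prop) (by fun_prop)]
  simp only [one_mul]

/-- Converse of `sw_mul_coact_act_of`: multiply the `A`-leg on the left by `S a₁` and cancel. The
antipode-free form is the one that passes easily to products, so this is how the crossed-module
axiom is obtained on `Λ_max`. -/
theorem coact_act_of_sw (v : V) (h : ∀ a, sw (δ a) (fun a₁ a₂ => sw (X.coact (X.act v a₂))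
      (fun p q => p ⊗ₜ[k] (a₁ * q))) =
      sw (δ a) (fun a₁ a₂ => sw (X.coact v) (fun v₀ v₁ => X.act v₀ a₁ ⊗ₜ[k] (v₁ * a₂)))) (a : A) :
    X.coact (X.act v a) = sweedler₃ X.twistedAct a (X.coact v) := by
  have h₁ : sweedler₃ X.twistedAct a (X.coact v) = sw (δ a) (fun a₁ a₂ => 
      (LinearMap.mul k A (S a₁)).lTensor V (sw (δ a₂) (fun b c => sw (X.coact v) (fun v₀ v₁ =>
        X.act v₀ b ⊗ₜ[k] (v₁ * c))))) := by
    rw [sweedler₃_eq_sw]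
    simp only [sw_apply_const, map_sw]
    refine sw_congr _ fun a₁ a₂ => sw_congr _ fun b c => ?_
    rw [map_eq_sw_tmul]
    simp only [twistedAct_tmul]
    rfl
  rw [h₁]
  -- With `S a₁` pulled outside, the inner sum over `a₂` is the right side of `h`; afterwards `S(a₁)
  -- a₂` stands in front and cancels.
  simp only [← h, map_sw, LinearMap.lTensor_tmul, LinearMap.mul_apply']
  simp only [← mul_assoc (S _)]
  rw [sw_antipode_mul_cancel (fun r a' => sw (X.coact (X.act v a')) (fun p q => p ⊗ₜ[k] (r * q)))
    (by fun_prop) (by fun_prop)]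
  simp only [one_mul, sw_tmul_self]

namespace IsCrossedModule

variable (hX : X.IsCrossedModule)
include hX

theorem sw_coassoc (F : V → A → A → M) (h₁ : ∀ b c, Lin k (fun a => F a b c))
    (h₂ : ∀ a c, Lin k (fun b => F a b c)) (h₃ : ∀ a b, Lin k (fun c => F a b c)) (v : V) :
    sw (X.coact v) (fun v₀ v₁ => sw (X.coact v₀) (fun b c => F b c v₁)) =
      sw (X.coact v) (fun v₀ v₁ => sw (δ v₁) (fun b c => F v₀ b c)) := by
  have h := congrArg (fun t => sw t (fun a s => sw s (fun b c => F a b c))) (hX.coact_coassoc v)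
  rw [sw_lTensor _ _ _ (by fun_prop) (by fun_prop), ← sw_assoc _ _ h₁ h₂ h₃,
    sw_rTensor _ _ _ (by fun_prop) (by fun_prop)] at h
  exact h

theorem sw_counit (f : V → M) (hf : Lin k f) (v : V) :
    sw (X.coact v) (fun v₀ v₁ => ε v₁ • f v₀) = f v := by
  have h := congrArg f (hX.coact_counit v)
  rw [lTensor_eq_sw, map_sw_equiv, hf.map_sw] at h
  simpa only [TensorProduct.rid_tmul, hf.map_smul] using h

theorem sw_mul_coact_act (F : V → A → M) (h₁ : ∀ b, Lin k (fun a => F a b))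
    (h₂ : ∀ a, Lin k (fun b => F a b)) (v : V) (a : A) :
    sw (δ a) (fun a₁ a₂ => sw (X.coact (X.act v a₂)) (fun p q => F p (a₁ * q))) =
      sw (δ a) (fun a₁ a₂ => sw (X.coact v) (fun v₀ v₁ => F (X.act v₀ a₁) (v₁ * a₂))) :=
  sw_mul_coact_act_of F hX.coact_act h₁ h₂ v a

end IsCrossedModule

end ActCoact

/-! ### The Maurer-Cartan form with values in `V` -/

/-- The map `ϖ π_ε : A → V`. -/
def mcV (ϖ : APlus k A →ₗ[k] V) : A →ₗ[k] V := ϖ ∘ₗ counitProj k A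

variable {X : ActCoact k A V} {ϖ : APlus k A →ₗ[k] V}

theorem coe_counitProj (a : A) : (counitProj k A a : A) = a - ε a • (1 : A) := by
  rw [← Algebra.algebraMap_eq_smul_one]
  rfl

theorem counitProj_coe (a : APlus k A) : counitProj k A (a : A) = a := by
  ext
  have : ε (a : A) = 0 := a.2
  rw [coe_counitProj, this, zero_smul, sub_zero]

theorem counitProj_one : counitProj k A 1 = 0 := by
  ext
  simp [coe_counitProj]

theorem mcV_coe (a : APlus k A) : mcV ϖ (a : A) = ϖ a := by
  rw [mcV, LinearMap.comp_apply, counitProj_coe]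

theorem mcV_one : mcV ϖ (1 : A) = 0 := by
  rw [mcV, LinearMap.comp_apply, counitProj_one, map_zero]

theorem adR_eq_sw (a : A) : adR k A a = sw (δ a) (fun a₁ a₂ => sw (δ a₂) (fun b c =>
    b ⊗ₜ[k] (S a₁ * c))) := by
  rw [adR, sweedler₃_eq_sw]
  rfl

variable (hϖ : (augmentation k A).IsHom X ϖ)
include hϖ

/-- `ϖ` is right linear, and `π_ε(a) b = π_ε(a b) - ε(a) π_ε(b)` because the multiples of `1`
cancel. In particular the part of `A⁺` killed by `ϖ` is a right ideal. -/
theorem act_mcV (a b : A) : X.act (mcV ϖ a) b = mcV ϖ (a * b) - ε a • mcV ϖ b := by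
  rw [mcV, LinearMap.comp_apply, LinearMap.comp_apply, LinearMap.comp_apply, ← hϖ.map_act,
    ← map_smul, ← map_sub]
  congr 1
  ext
  simp [augmentation, coe_counitProj, sub_mul, smul_sub, mul_smul]

theorem mcV_mul (a b : A) : mcV ϖ (a * b) = X.act (mcV ϖ a) b + ε a • mcV ϖ b := by
  rw [act_mcV hϖ, sub_add_cancel]

/-- The adjoint coaction sends `1` to `1 ⊗ 1`, which `π_ε` kills, so it may be evaluated on `a`
itself instead of `π_ε a`. -/
theorem coact_mcV (a : A) : X.coact (mcV ϖ a) = sw (δ a) (fun a₁ a₂ => sw (δ a₂) (fun b c =>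
    mcV ϖ b ⊗ₜ[k] (S a₁ * c))) := by
  have h₁ : adR k A (1 : A) = 1 ⊗ₜ 1 := by
    rw [adR_eq_sw, comul_one_eq, sw_tmul _ _ _ (by fun_prop) (by fun_prop), comul_one_eq,
      sw_tmul _ _ _ (by fun_prop) (by fun_prop)]
    simp
  have h₂ : (counitProj k A).rTensor A (adR k A (counitProj k A a : A)) =
      (counitProj k A).rTensor A (adR k A a) := by
    rw [coe_counitProj, map_sub, map_smul, map_sub, map_smul, h₁, LinearMap.rTensor_tmul, counitProj_one]
    simp
  rw [mcV, LinearMap.comp_apply, hϖ.map_coact]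
  change ϖ.rTensor A ((counitProj k A).rTensor A (adR k A (counitProj k A a : A))) = _
  rw [h₂, adR_eq_sw, ← LinearMap.comp_apply, ← LinearMap.rTensor_comp]
  change (mcV ϖ).rTensor A _ = _
  simp only [map_sw, LinearMap.rTensor_tmul]
  rfl

/-- The factor `a₁` in front cancels the antipode in the adjoint coaction. Most computations with
the coaction of the Maurer-Cartan form end here. -/
theorem sw_mul_coact_mcV (F : V → A → M) (h₁ : ∀ b, Lin k (fun a => F a b))
    (h₂ : ∀ a, Lin k (fun b => F a b)) (a : A) :
    sw (δ a) (fun a₁ a₂ => sw (X.coact (mcV ϖ a₂)) (fun p q => F p (a₁ * q))) =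
      sw (δ a) (fun a₁ a₂ => F (mcV ϖ a₁) a₂) := by
  simp (disch := fun_prop) only [coact_mcV hϖ, sw_sw, sw_tmul]
  simp only [← mul_assoc (_ : A) (S _)]
  rw [sw_mul_antipode_cancel (fun p a' => sw (δ a') (fun b c => F (mcV ϖ b) (p * c)))
    (by fun_prop) (by fun_prop)]
  simp only [one_mul]

/-- The braiding on the symbols of the Maurer-Cartan equation. -/
theorem sw_braid_mcV {M : Type*} [AddCommGroup M] [Module k M] (F : V → V → M) (h₁ : ∀ b, Lin k (fun a => F a b))
    (h₂ : ∀ a, Lin k (fun b => F a b)) (a : A) :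
    sw (δ a) (fun a₁ a₂ => sw (X.coact (mcV ϖ a₂)) (fun p q => F p (X.act (mcV ϖ a₁) q))) =
      sw (δ a) (fun a₁ a₂ => F (mcV ϖ a₁) (mcV ϖ a₂)) -
        sw (X.coact (mcV ϖ a)) (fun p q => F p (mcV ϖ q)) := by
  have h₃ : ∀ a b c, F a (b - c) = F a b - F a c := fun a b c => (h₂ a).map_sub b c
  have h₄ : ∀ a b (c : k), F a (c • b) = c • F a b := fun a b c => (h₂ a).map_smul c b
  -- Expanding `mcV a₁ ◁ q` gives `mcV (a₁ q)`, where `a₁` is absorbed by the coaction of `mcV a₂`,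
  -- and `ε(a₁) mcV q`, where the counit collapses the sum to the correction term.
  simp only [act_mcV hϖ, h₃, h₄, sw_fun_sub, ← smul_sw]
  rw [sw_mul_coact_mcV hϖ (fun p q => F p (mcV ϖ q)) (by fun_prop) (by fun_prop),
    sw_counit_left (fun a => sw (X.coact (mcV ϖ a)) (fun p q => F p (mcV ϖ q))) (by fun_prop)]

/-- The correction in `sw_braid_mcV` depends on `a` only through `mcV a`, so the relations of
`Λ_max` are fixed by the braiding. -/
theorem sw_braid_of_mcV_eq_zero {M : Type*} [AddCommGroup M] [Module k M] (F : V → V → M) (h₁ : ∀ b, Lin k (fun a => F a b))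
    (h₂ : ∀ a, Lin k (fun b => F a b)) {a : A} (ha : mcV ϖ a = 0) :
    sw (δ a) (fun a₁ a₂ => sw (X.coact (mcV ϖ a₂)) (fun p q => F p (X.act (mcV ϖ a₁) q))) =
      sw (δ a) (fun a₁ a₂ => F (mcV ϖ a₁) (mcV ϖ a₂)) := by
  rw [sw_braid_mcV hϖ F h₁ h₂, ha, map_zero, sw_zero _ (by fun_prop) (by fun_prop), sub_zero]

/-- Expand both factors by `act_mcV` and remove the counits. For `a ∈ A⁺` with `mcV a = 0` the
subtracted sum vanishes and what remains is the relation attached to `a * b`. For general `a` the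
subtracted sum measures how far the square of the Maurer-Cartan form is from being equivariant. -/
theorem sw_act_act_mcV {M : Type*} [AddCommGroup M] [Module k M] (F : V → V → M) (h₁ : ∀ b, Lin k (fun a => F a b))
    (h₂ : ∀ a, Lin k (fun b => F a b)) (a b : A) :
    sw (δ a) (fun a₁ a₂ => sw (δ b) (fun b₁ b₂ =>
      F (X.act (mcV ϖ a₁) b₁) (X.act (mcV ϖ a₂) b₂))) =
    sw (δ (a * b)) (fun c₁ c₂ => F (mcV ϖ c₁) (mcV ϖ c₂)) -
      sw (δ b) (fun b₁ b₂ => F (mcV ϖ (a * b₁)) (mcV ϖ b₂) + F (mcV ϖ b₁) (mcV ϖ (a * b₂)) -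
        ε a • F (mcV ϖ b₁) (mcV ϖ b₂)) := by
  have e₁ : ∀ a b c, F a (b - c) = F a b - F a c := fun a b c => (h₂ a).map_sub b c
  have e₂ : ∀ a b (c : k), F a (c • b) = c • F a b := fun a b c => (h₂ a).map_smul c b
  have e₃ : ∀ a b c, F (a - b) c = F a c - F b c := fun a b c => (h₁ c).map_sub a b
  have e₄ : ∀ a b (c : k), F (c • a) b = c • F a b := fun a b c => (h₁ b).map_smul c a
  simp only [act_mcV hϖ, e₁, e₂, e₃, e₄, sw_fun_sub, sw_fun_add, comul_mul_eq_sw]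
  simp (disch := fun_prop) only [sw_sw, sw_tmul, ← smul_sw]
  simp only [sw_counit_left (fun a => sw (δ b) (fun b₁ b₂ => F (mcV ϖ b₁) (mcV ϖ (a * b₂))))
    (by fun_prop)]
  rw [sw_counit_right (fun x => sw (δ b) (fun b₁ b₂ => F (mcV ϖ (x * b₁)) (mcV ϖ b₂) -
    ε x • F (mcV ϖ b₁) (mcV ϖ b₂))) (by fun_prop), sw_fun_sub, ← smul_sw]
  abel

/-- In the product of the two coaction legs the inner factors form `a₃ (S a₄)`, which cancels. So
the diagonal coaction of `mcV a₁ ⊗ mcV a₂` is the adjoint coaction of `a` followed by the coproduct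
of its middle leg. -/
theorem sw_coact_coact_mcV (F : V → V → A → M) (h₁ : ∀ b c, Lin k (fun a => F a b c))
    (h₂ : ∀ a c, Lin k (fun b => F a b c)) (h₃ : ∀ a b, Lin k (fun c => F a b c)) (a : A) :
    sw (δ a) (fun a₁ a₂ => sw (X.coact (mcV ϖ a₁)) (fun p₀ p₁ =>
      sw (X.coact (mcV ϖ a₂)) (fun q₀ q₁ => F p₀ q₀ (p₁ * q₁)))) =
    sw (δ a) (fun a₁ a₂ => sw (δ a₂) (fun b c => sw (δ b) (fun b₁ b₂ =>
      F (mcV ϖ b₁) (mcV ϖ b₂) (S a₁ * c)))) := by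
  have h (a₁ a₂ : A) : sw (X.coact (mcV ϖ a₁)) (fun p₀ p₁ =>
      sw (X.coact (mcV ϖ a₂)) (fun q₀ q₁ => F p₀ q₀ (p₁ * q₁))) =
      sw (δ a₁) (fun x y => sw (δ y) (fun b c => sw (X.coact (mcV ϖ a₂)) (fun q₀ q₁ =>
        F (mcV ϖ b) q₀ (S x * (c * q₁))))) := by
    rw [coact_mcV hϖ a₁]
    simp (disch := fun_prop) only [sw_sw, sw_tmul, mul_assoc]
  simp (disch := fun_prop) only [h, BraidedCalculus.sw_coassoc]
  refine sw_congr _ fun x y => sw_congr _ fun b c => ?_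
  exact sw_mul_coact_mcV hϖ (fun q r => F (mcV ϖ b) q (S x * r)) (by fun_prop) (by fun_prop) c

end CrossedCalculus

/-! ### Action and coaction on `Λ_max` -/

section

variable {k U W U' W' M J : Type*} [Field k] [AddCommGroup U] [Module k U] [AddCommGroup W]
  [Module k W] [AddCommMonoid M] [Module k M] 

theorem sw_mem (t : U ⊗[k] W) {f : U → W → M} {N : Submodule k M} (h : ∀ x y, f x y ∈ N) :
    sw t f ∈ N := sum_mem fun _ _ => h _ _

theorem sw_mem_of_mem_range_rTensor {P : Submodule k U} {t : U ⊗[k] W}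
    (ht : t ∈ LinearMap.range (P.subtype.rTensor W)) {f : U → W → M}
    (h₁ : ∀ y, Lin k (fun x => f x y)) (h₂ : ∀ x, Lin k (fun y => f x y)) {N : Submodule k M}
    (h : ∀ x ∈ P, ∀ y, f x y ∈ N) : sw t f ∈ N := by
  obtain ⟨t, rfl⟩ := ht
  rw [sw_rTensor _ _ _ h₁ h₂]
  exact sw_mem _ fun x y => h _ x.2 _

theorem tmul_mem_range_rTensor {P : Submodule k U} {x : U} (hx : x ∈ P) (y : W) :
    x ⊗ₜ[k] y ∈ LinearMap.range (P.subtype.rTensor W) := ⟨⟨x, hx⟩ ⊗ₜ y, rfl⟩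

end

namespace MaxExterior

variable {k A V M J : Type*} [Field k] [Ring A] [HopfAlgebra k A] [AddCommMonoid M] [Module k M]
  [AddCommGroup V] [Module k V] {ϖ : APlus k A →ₗ[k] V}

local notation "δ" => Coalgebra.comul (R := k)
local notation "ε" => Coalgebra.counit (R := k)
local notation "S" => HopfAlgebra.antipode k

theorem mcForm_eq (a : A) : mcForm ϖ a = ι ϖ (mcV ϖ a) := rfl

/-- The universal property gives a map from `Λ_max` to the subalgebra generated by `V`; followed by
the inclusion it is the identity on generators, hence everywhere. -/
theorem adjoin_range_ι : Algebra.adjoin k (Set.range (ι ϖ)) = ⊤ := by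
  rw [eq_top_iff]
  let f : MaxExterior ϖ →ₐ[k] Algebra.adjoin k (Set.range (ι ϖ)) :=
    lift ϖ ((ι ϖ).codRestrict (Subalgebra.toSubmodule (Algebra.adjoin k (Set.range (ι ϖ))))
      fun v => Algebra.subset_adjoin ⟨v, rfl⟩) (fun a ha => by
        ext
        rw [sweedler_eq_sw]
        refine (map_sw_algHom (Algebra.adjoin k (Set.range (ι ϖ))).val _ _).trans ?_
        have := mcForm_rel ϖ a ha
        rw [sweedler_eq_sw] at this
        exact this)
  have hf : (Algebra.adjoin k (Set.range (ι ϖ))).val.comp f = AlgHom.id k _ := by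
    ext v
    exact congrArg Subtype.val (lift_ι ϖ _ _ v)
  intro x _
  rw [← AlgHom.id_apply (R := k) x, ← hf]
  exact (f x).2

/-- The statement proved for `x` is that left multiplication by `x` preserves `p`. Unlike `p x`, it
is closed under products in `x`, so induction over the generated subalgebra applies; evaluate at
`1`. -/
theorem induction_left {p : MaxExterior ϖ → Prop} (one : p 1)
    (ι_mul : ∀ v x, p x → p (ι ϖ v * x)) (add : ∀ x y, p x → p y → p (x + y))
    (smul : ∀ (c : k) x, p x → p (c • x)) (x : MaxExterior ϖ) : p x := by
  suffices h : ∀ y, p y → p (x * y) by simpa using h 1 one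
  have hx : x ∈ Algebra.adjoin k (Set.range (ι ϖ)) := by rw [adjoin_range_ι]; trivial
  induction hx using Algebra.adjoin_induction with
  | mem x hx =>
    obtain ⟨v, rfl⟩ := hx
    exact ι_mul v
  | algebraMap r =>
    intro y hy
    rw [← Algebra.smul_def]
    exact smul r y hy
  | add x y _ _ hx hy =>
    intro z hz
    rw [add_mul]
    exact add _ _ (hx z hz) (hy z hz)
  | mul x y _ _ hx hy =>
    intro z hz
    rw [mul_assoc]
    exact hx _ (hy z hz)

/-- The induction behind most identities on `Λ_max`. The index `j`, often an element of `A`, is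
quantified inside the induction hypothesis because the inductive step replaces `a` by its Sweedler
legs. -/
theorem lin_ext {f g : J → MaxExterior ϖ → M} (hf : ∀ j, Lin k (f j)) (hg : ∀ j, Lin k (g j))
    (one : ∀ j, f j 1 = g j 1)
    (ι_mul : ∀ v x, (∀ j, f j x = g j x) → ∀ j, f j (ι ϖ v * x) = g j (ι ϖ v * x))
    (j : J) (x : MaxExterior ϖ) : f j x = g j x := by
  revert j
  induction x using induction_left with
  | one => exact one
  | ι_mul v x h => exact ι_mul v x h
  | add x y hx hy => intro j; rw [(hf j).map_add, (hg j).map_add, hx, hy]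
  | smul c x hx => intro j; rw [(hf j).map_smul, (hg j).map_smul, hx]

/-- The family `N` is arbitrary, so the same induction serves for preserved degrees, shifted degrees
and, with `⊥` as value, vanishing. -/
theorem mem_of_mem_deg {f : J → MaxExterior ϖ → M} (hf : ∀ j, Lin k (f j))
    {N : ℕ → Submodule k M} (one : ∀ j, f j 1 ∈ N 0)
    (ι_mul : ∀ n v, ∀ x ∈ deg ϖ n, (∀ j, f j x ∈ N n) → ∀ j, f j (ι ϖ v * x) ∈ N (n + 1))
    {n : ℕ} {x : MaxExterior ϖ} (hx : x ∈ deg ϖ n) (j : J) : f j x ∈ N n := by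
  induction n generalizing x j with
  | zero =>
    rw [deg, pow_zero, Submodule.mem_one] at hx
    obtain ⟨c, rfl⟩ := hx
    rw [Algebra.algebraMap_eq_smul_one, (hf j).map_smul]
    exact Submodule.smul_mem _ _ (one j)
  | succ n ih =>
    rw [deg, pow_succ'] at hx
    induction hx using Submodule.mul_induction_on' with
    | mem_mul_mem y hy z hz =>
      obtain ⟨v, rfl⟩ := hy
      exact ι_mul n v z hz (fun j => ih hz j) j
    | add y _ z _ hy hz =>
      rw [(hf j).map_add]
      exact add_mem hy hz

theorem one_mem_deg : (1 : MaxExterior ϖ) ∈ deg ϖ 0 := SetLike.GradedOne.one_mem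

theorem ι_mul_mem_deg (v : V) {n : ℕ} {x : MaxExterior ϖ} (hx : x ∈ deg ϖ n) :
    ι ϖ v * x ∈ deg ϖ (n + 1) := by
  rw [deg, pow_succ']
  exact Submodule.mul_mem_mul ⟨v, rfl⟩ hx

theorem ι_mem_deg (v : V) : ι ϖ v ∈ deg ϖ 1 := by
  rw [deg, pow_one]
  exact ⟨v, rfl⟩

theorem mcForm_mem_deg (a : A) : mcForm ϖ a ∈ deg ϖ 1 := ι_mem_deg _

/-- The quadratic relations of `Λ_max`. -/
theorem sw_mcForm_mul {a : A} (ha : ε a = 0) (h : mcV ϖ a = 0) :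
    sw (δ a) (fun a₁ a₂ => mcForm ϖ a₁ * mcForm ϖ a₂) = 0 := by
  have := mcForm_rel ϖ ⟨a, ha⟩ (by rw [← mcV_coe, h])
  rwa [sweedler_eq_sw] at this

/-- Algebra maps out of `Λ_max`. -/
theorem exists_lift {B : Type*} [Ring B] [Algebra k B] (f : V →ₗ[k] B)
    (hf : ∀ a : A, ε a = 0 → mcV ϖ a = 0 →
      sw (δ a) (fun a₁ a₂ => f (mcV ϖ a₁) * f (mcV ϖ a₂)) = 0) :
    ∃ F : MaxExterior ϖ →ₐ[k] B, ∀ v, F (ι ϖ v) = f v :=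
  ⟨lift ϖ f fun a ha => by
    rw [sweedler_eq_sw]
    exact hf a a.2 (by rw [mcV_coe, ha]), lift_ι ϖ f _⟩

theorem exists_eq_mcV (hsurj : Function.Surjective ϖ) (v : V) :
    ∃ a : A, ε a = 0 ∧ v = mcV ϖ a := by
  obtain ⟨a, rfl⟩ := hsurj v
  exact ⟨a, a.2, (mcV_coe a).symm⟩

/-- The square of the Maurer-Cartan form factors through `V`. -/
theorem exists_mcForm_sq (hsurj : Function.Surjective ϖ) : ∃ q : V →ₗ[k] MaxExterior ϖ,
    ∀ a : A, sw (δ a) (fun a₁ a₂ => mcForm ϖ a₁ * mcForm ϖ a₂) = q (mcV ϖ a) := by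
  obtain ⟨s, hs⟩ := ϖ.exists_rightInverse_of_surjective (LinearMap.range_eq_top.2 hsurj)
  let g : A →ₗ[k] MaxExterior ϖ :=
    Lin.toMap (fun a => sw (δ a) (fun a₁ a₂ => mcForm ϖ a₁ * mcForm ϖ a₂)) (by fun_prop)
  have hg : ∀ a, ε a = 0 → mcV ϖ a = 0 → g a = 0 := fun a h h' => sw_mcForm_mul h h'
  have hg₁ : g 1 = 0 := by
    change sw (δ (1 : A)) (fun a₁ a₂ => mcForm ϖ a₁ * mcForm ϖ a₂) = 0
    rw [comul_one_eq, sw_tmul _ _ _ (by fun_prop) (by fun_prop), mcForm_eq, mcV_one]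
    simp
  refine ⟨g ∘ₗ (APlus k A).subtype ∘ₗ s, fun a => ?_⟩
  change g a = g (s (mcV ϖ a))
  have h₁ : ε (s (mcV ϖ a) : A) = 0 := (s (mcV ϖ a)).2
  have h₂ : mcV ϖ (s (mcV ϖ a) : A) = mcV ϖ a := by
    rw [mcV_coe]
    exact LinearMap.congr_fun hs _
  -- Here `s` is a linear section of `ϖ`. This element lies in `A⁺` and is killed by `mcV`, so it
  -- gives a relation; as `g 1 = 0`, the value `g a` depends only on `mcV a`.
  have := hg (a - ε a • 1 - s (mcV ϖ a)) (by simp [h₁]) (by simp [h₂, mcV_one])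
  rw [map_sub, map_sub, map_smul, hg₁, smul_zero, sub_zero, sub_eq_zero] at this
  exact this

variable {X : ActCoact k A V} 

theorem conv_mul_apply {C : Type*} [Ring C] [Algebra k C] (f g : WithConv (A →ₗ[k] C)) (a : A) :
    (f * g).ofConv a = sw (δ a) (fun a₁ a₂ => f.ofConv a₁ * g.ofConv a₂) := by
  rw [LinearMap.convMul_apply, map_eq_sw, map_sw]
  rfl

/-- The rule `(x y) ◁ a = (x ◁ a₁)(y ◁ a₂)` says that `x ↦ (a ↦ x ◁ a)` is an algebra map into the
convolution algebra `Hom(A, Λ_max)`, so the universal property applies with that target. -/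
theorem exists_act (hϖ : (augmentation k A).IsHom X ϖ) :
    ∃ act : MaxExterior ϖ →ₗ[k] A →ₗ[k] MaxExterior ϖ,
      (∀ a, act 1 a = ε a • 1) ∧ (∀ v a, act (ι ϖ v) a = ι ϖ (X.act v a)) ∧
      ∀ x y a, act (x * y) a = sw (δ a) (fun a₁ a₂ => act x a₁ * act y a₂) := by
  obtain ⟨F, hF⟩ := exists_lift (ϖ := ϖ) (B := WithConv (A →ₗ[k] MaxExterior ϖ))
    ((WithConv.linearEquiv k _).symm.toLinearMap ∘ₗ LinearMap.compRight k (ι ϖ) ∘ₗ X.act)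
    (fun a ha h => by
      ext b
      rw [← WithConv.linearEquiv_apply (R := k), ← LinearEquiv.coe_coe, map_sw, sw_apply_const]
      simp only [LinearEquiv.coe_coe, WithConv.linearEquiv_apply, conv_mul_apply]
      refine (sw_act_act_mcV hϖ (fun v w => ι ϖ v * ι ϖ w) (by fun_prop) (by fun_prop) a b).trans ?_
      -- As `a` lies in the right ideal of elements of `A⁺` killed by `ϖ`, so does `a * b`, and its
      -- quadratic relation holds too.
      have h₁ : ∀ b, mcV ϖ (a * b) = 0 := fun b => by
        rw [mcV_mul hϖ, h, ha, map_zero, LinearMap.zero_apply, zero_smul, add_zero]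
      have h₂ := sw_mcForm_mul (ϖ := ϖ) (a := a * b) (by rw [Bialgebra.counit_mul, ha, zero_mul])
        (h₁ b)
      simp only [mcForm_eq] at h₂
      simp only [h₂, h₁, ha, map_zero, zero_mul, mul_zero, zero_smul, add_zero, sub_zero,
        sw_fun_zero]
      rfl)
  refine ⟨(WithConv.linearEquiv k _).toLinearMap ∘ₗ F.toLinearMap, fun a => ?_, fun v a => ?_,
    fun x y a => ?_⟩
  · change (F 1).ofConv a = _
    rw [map_one, LinearMap.convOne_apply, Algebra.algebraMap_eq_smul_one]
  · change (F _).ofConv a = _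
    rw [hF]
    rfl
  · change (F _).ofConv a = _
    rw [map_mul, conv_mul_apply]
    rfl

theorem tmul_mul_sw (t s : MaxExterior ϖ ⊗[k] A) : t * s = sw t (fun x₀ x₁ => sw s (fun y₀ y₁ =>
    (x₀ * y₀) ⊗ₜ[k] (x₁ * y₁))) := by
  conv_lhs => rw [← sw_tmul_self t, ← sw_tmul_self s]
  simp only [sw_mul, mul_sw, Algebra.TensorProduct.tmul_mul_tmul]
  exact sw_comm _ _ _

/-- The target algebra is `Λ_max ⊗ A`. The image of the relation attached to `a` is `q ⊗ id` applied
to the coaction of `mcV a`, with `q` the square of the Maurer-Cartan form, hence zero when `mcV a =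
0`. -/
theorem exists_coact (hϖ : (augmentation k A).IsHom X ϖ) (hsurj : Function.Surjective ϖ) :
    ∃ coact : MaxExterior ϖ →ₗ[k] MaxExterior ϖ ⊗[k] A,
      coact 1 = 1 ⊗ₜ 1 ∧ (∀ v, coact (ι ϖ v) = sw (X.coact v) (fun v₀ v₁ => ι ϖ v₀ ⊗ₜ v₁)) ∧
      ∀ x y, coact (x * y) = sw (coact x) (fun x₀ x₁ => sw (coact y) (fun y₀ y₁ =>
        (x₀ * y₀) ⊗ₜ[k] (x₁ * y₁))) := by
  obtain ⟨F, hF⟩ := exists_lift (ϖ := ϖ) (B := MaxExterior ϖ ⊗[k] A)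
    ((ι ϖ).rTensor A ∘ₗ X.coact) (fun a ha h => by
      obtain ⟨q, hq⟩ := exists_mcForm_sq hsurj
      simp only [LinearMap.comp_apply, tmul_mul_sw]
      simp (disch := fun_prop) only [sw_rTensor]
      rw [sw_coact_coact_mcV hϖ (fun p q r => (ι ϖ p * ι ϖ q) ⊗ₜ[k] r) (by fun_prop) (by fun_prop)
        (by fun_prop)]
      simp only [← mcForm_eq, ← sw_tmul_const, hq]
      have h₁ := congrArg (fun t => sw t fun p r => q p ⊗ₜ[k] r) (coact_mcV hϖ a)
      simp (disch := fun_prop) only [sw_sw, sw_tmul, h, map_zero, sw_zero] at h₁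
      exact h₁.symm)
  refine ⟨F.toLinearMap, map_one F, fun v => ?_, fun x y => ?_⟩
  · rw [AlgHom.toLinearMap_apply, hF, LinearMap.comp_apply, rTensor_eq_sw]
  · rw [AlgHom.toLinearMap_apply, map_mul, tmul_mul_sw]
    rfl

/-- The action and coaction on `Λ_max` extend those of `V` multiplicatively. -/
structure Extends (X : ActCoact k A V) (Y : ActCoact k A (MaxExterior ϖ)) : Prop where
  one_act : ∀ a, Y.act 1 a = ε a • 1
  act_ι : ∀ v a, Y.act (ι ϖ v) a = ι ϖ (X.act v a)
  mul_act : ∀ x y a, Y.act (x * y) a = sw (δ a) (fun a₁ a₂ => Y.act x a₁ * Y.act y a₂)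
  coact_one : Y.coact 1 = 1 ⊗ₜ 1
  coact_ι : ∀ v, Y.coact (ι ϖ v) = sw (X.coact v) (fun v₀ v₁ => ι ϖ v₀ ⊗ₜ v₁)
  coact_mul : ∀ x y, Y.coact (x * y) = sw (Y.coact x) (fun x₀ x₁ => sw (Y.coact y) (fun y₀ y₁ =>
    (x₀ * y₀) ⊗ₜ[k] (x₁ * y₁)))

theorem exists_extends (hϖ : (augmentation k A).IsHom X ϖ) (hsurj : Function.Surjective ϖ) :
    ∃ Y : ActCoact k A (MaxExterior ϖ), Extends X Y := by
  obtain ⟨act, h₁, h₂, h₃⟩ := exists_act hϖ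
  obtain ⟨coact, h₄, h₅, h₆⟩ := exists_coact hϖ hsurj
  exact ⟨⟨act, coact⟩, h₁, h₂, h₃, h₄, h₅, h₆⟩

namespace Extends

variable {Y : ActCoact k A (MaxExterior ϖ)} (hY : Extends X Y)
include hY

theorem sw_coact_one (F : MaxExterior ϖ → A → M) (h₁ : ∀ y, Lin k (fun x => F x y))
    (h₂ : ∀ x, Lin k (fun y => F x y)) : sw (Y.coact 1) F = F 1 1 := by
  rw [hY.coact_one, sw_tmul _ _ _ h₁ h₂]

theorem sw_coact_ι (F : MaxExterior ϖ → A → M) (h₁ : ∀ y, Lin k (fun x => F x y))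
    (h₂ : ∀ x, Lin k (fun y => F x y)) (v : V) :
    sw (Y.coact (ι ϖ v)) F = sw (X.coact v) (fun v₀ v₁ => F (ι ϖ v₀) v₁) := by
  rw [hY.coact_ι]
  simp (disch := fun_prop) only [sw_sw, sw_tmul]

theorem sw_coact_mul (F : MaxExterior ϖ → A → M) (h₁ : ∀ y, Lin k (fun x => F x y))
    (h₂ : ∀ x, Lin k (fun y => F x y)) (x y : MaxExterior ϖ) :
    sw (Y.coact (x * y)) F = sw (Y.coact x) (fun x₀ x₁ => sw (Y.coact y) (fun y₀ y₁ =>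
      F (x₀ * y₀) (x₁ * y₁))) := by
  rw [hY.coact_mul]
  simp (disch := fun_prop) only [sw_sw, sw_tmul]

theorem sw_coact_ι_mul (F : MaxExterior ϖ → A → M) (h₁ : ∀ y, Lin k (fun x => F x y))
    (h₂ : ∀ x, Lin k (fun y => F x y)) (v : V) (y : MaxExterior ϖ) :
    sw (Y.coact (ι ϖ v * y)) F = sw (X.coact v) (fun v₀ v₁ => sw (Y.coact y) (fun y₀ y₁ =>
      F (ι ϖ v₀ * y₀) (v₁ * y₁))) := by
  rw [hY.sw_coact_mul F h₁ h₂, hY.sw_coact_ι _ (by fun_prop) (by fun_prop)]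

theorem ι_mul_act (v : V) (x : MaxExterior ϖ) (a : A) :
    Y.act (ι ϖ v * x) a = sw (δ a) (fun a₁ a₂ => ι ϖ (X.act v a₁) * Y.act x a₂) := by
  rw [hY.mul_act]
  simp only [hY.act_ι]

theorem ι_isHom : X.IsHom Y (ι ϖ) :=
  ⟨fun v a => (hY.act_ι v a).symm, fun v => by rw [hY.coact_ι, rTensor_eq_sw]⟩

theorem act_deg {n : ℕ} {x : MaxExterior ϖ} (hx : x ∈ deg ϖ n) (a : A) : Y.act x a ∈ deg ϖ n := by
  refine mem_of_mem_deg (f := fun a x => Y.act x a) (fun j => by fun_prop) (fun a => ?_)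
    (fun n v x hx h a => ?_) hx a
  · rw [hY.one_act]
    exact Submodule.smul_mem _ _ one_mem_deg
  · rw [hY.ι_mul_act]
    exact sw_mem _ fun a₁ a₂ => ι_mul_mem_deg _ (h a₂)

theorem coact_deg {n : ℕ} {x : MaxExterior ϖ} (hx : x ∈ deg ϖ n) :
    Y.coact x ∈ LinearMap.range ((deg ϖ n).subtype.rTensor A) := by
  refine mem_of_mem_deg (f := fun (_ : Unit) x => Y.coact x)
    (N := fun n => LinearMap.range ((deg ϖ n).subtype.rTensor A)) (fun j => by fun_prop)
    (fun _ => ?_) (fun n v x hx h _ => ?_) hx ()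
  · rw [hY.coact_one]
    exact tmul_mem_range_rTensor one_mem_deg 1
  · rw [hY.coact_mul, hY.sw_coact_ι _ (by fun_prop) (by fun_prop)]
    exact sw_mem _ fun v₀ v₁ => sw_mem_of_mem_range_rTensor (h ()) (by fun_prop) (by fun_prop)
      fun x hx a => tmul_mem_range_rTensor (ι_mul_mem_deg _ hx) _

theorem one_isHom : (ActCoact.unitObject k A).IsHom Y (Algebra.linearMap k (MaxExterior ϖ)) := by
  refine ⟨fun c a => ?_, fun c => ?_⟩
  · simp [ActCoact.unitObject, Algebra.algebraMap_eq_smul_one, hY.one_act, smul_smul, mul_comm]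
  · simp [ActCoact.unitObject, Algebra.algebraMap_eq_smul_one, hY.coact_one,
      TensorProduct.smul_tmul']

theorem mul_isHom : (Y.tensor Y).IsHom Y (LinearMap.mul' k (MaxExterior ϖ)) := by
  refine ⟨fun t a => ?_, fun t => ?_⟩
  · have h : Y.act (LinearMap.mul' k _ t) a = sw t (fun x y => Y.act (x * y) a) :=
      map_eq_sw_tmul (Y.act.flip a ∘ₗ LinearMap.mul' k _) t
    simp only [h, ActCoact.tensor_act, map_sw, LinearMap.mul'_apply, hY.mul_act]
    exact sw_comm _ _ _
  · have h : Y.coact (LinearMap.mul' k _ t) = sw t (fun x y => Y.coact (x * y)) :=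
      map_eq_sw_tmul (Y.coact ∘ₗ LinearMap.mul' k _) t
    rw [h, ActCoact.tensor_coact, rTensor_eq_sw]
    simp (disch := fun_prop) only [sw_sw, sw_tmul, LinearMap.mul'_apply, hY.coact_mul]

variable (hX : X.IsCrossedModule)
include hX

theorem act_one (x : MaxExterior ϖ) : Y.act x 1 = x := by
  refine lin_ext (J := Unit) (f := fun _ x => Y.act x 1) (g := fun _ x => x) (fun _ => by fun_prop)
    (fun _ => by fun_prop) (fun _ => ?_) (fun v x h _ => ?_) () x
  · simp [hY.one_act]
  · rw [hY.ι_mul_act, comul_one_eq, sw_tmul _ _ _ (by fun_prop) (by fun_prop), hX.act_one, h ()]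

theorem act_mul (x : MaxExterior ϖ) (a b : A) : Y.act x (a * b) = Y.act (Y.act x a) b := by
  refine lin_ext (J := A × A) (f := fun j x => Y.act x (j.1 * j.2))
    (g := fun j x => Y.act (Y.act x j.1) j.2) (fun _ => by fun_prop)
    (fun _ => by fun_prop) (fun j => ?_) (fun v x h j => ?_) (a, b) x
  · simp [hY.one_act, mul_smul]
  · simp (disch := fun_prop) only [hY.ι_mul_act, comul_mul_eq_sw, sw_sw, sw_tmul, map_sw,
      sw_apply_const, hX.act_mul]
    refine sw_congr _ fun a₁ a₂ => sw_congr _ fun b₁ b₂ => ?_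
    rw [h (a₂, b₂)]

theorem coact_coassoc (x : MaxExterior ϖ) :
    TensorProduct.assoc k (MaxExterior ϖ) A A (Y.coact.rTensor A (Y.coact x)) =
      (Coalgebra.comul (R := k) (A := A)).lTensor (MaxExterior ϖ) (Y.coact x) := by
  refine lin_ext (J := Unit)
    (f := fun _ x => TensorProduct.assoc k (MaxExterior ϖ) A A (Y.coact.rTensor A (Y.coact x)))
    (g := fun _ x => (Coalgebra.comul (R := k) (A := A)).lTensor (MaxExterior ϖ) (Y.coact x))
    (fun _ => by fun_prop) (fun _ => by fun_prop) (fun _ => ?_) (fun v x h _ => ?_) () x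
  · rw [hY.coact_one, LinearMap.rTensor_tmul, hY.coact_one, LinearMap.lTensor_tmul, comul_one_eq]
    rfl
  -- `G p₀ p₁ p₂` is left multiplication by `p₀ ⊗ p₁ ⊗ p₂`. On `v x` both iterated coactions are
  -- sums of such multiplications applied to their values on `x`, so only coassociativity on `v`
  -- remains.
  · let G (p₀ : V) (p₁ p₂ : A) : MaxExterior ϖ ⊗[k] (A ⊗[k] A) →ₗ[k]
        MaxExterior ϖ ⊗[k] (A ⊗[k] A) := TensorProduct.map (LinearMap.mulLeft k (ι ϖ p₀))
          (TensorProduct.map (LinearMap.mulLeft k p₁) (LinearMap.mulLeft k p₂))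
    have e₁ : ∀ p₀ p₁ p₂ (t : MaxExterior ϖ ⊗[k] (A ⊗[k] A)), G p₀ p₁ p₂ t =
        sw t (fun y₀ s => sw s (fun y₁ y₂ => (ι ϖ p₀ * y₀) ⊗ₜ ((p₁ * y₁) ⊗ₜ (p₂ * y₂)))) := by
      intro p₀ p₁ p₂ t
      simp only [G, map_eq_sw, tmul_sw]
      rfl
    have e₂ : TensorProduct.assoc k (MaxExterior ϖ) A A
        (Y.coact.rTensor A (Y.coact (ι ϖ v * x))) =
        sw (X.coact v) (fun v₀ p₂ => sw (X.coact v₀) (fun p₀ p₁ => G p₀ p₁ p₂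
          (TensorProduct.assoc k (MaxExterior ϖ) A A (Y.coact.rTensor A (Y.coact x))))) := by
      simp only [e₁]
      simp (disch := fun_prop) only [rTensor_eq_sw, hY.sw_coact_ι_mul, map_sw_equiv, ← sw_assoc,
        sw_sw, sw_tmul]
      refine sw_congr _ fun v₀ p₂ => ?_
      rw [sw_comm]
      refine sw_congr _ fun y₀ p₂ => ?_
      rw [hY.coact_mul, hY.sw_coact_ι _ (by fun_prop) (by fun_prop)]
      simp only [sw_tmul_const, map_sw_equiv, TensorProduct.assoc_tmul]
    have e₃ : (Coalgebra.comul (R := k) (A := A)).lTensor (MaxExterior ϖ)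
        (Y.coact (ι ϖ v * x)) =
        sw (X.coact v) (fun p₀ v₁ => sw (δ v₁) (fun p₁ p₂ => G p₀ p₁ p₂
          ((Coalgebra.comul (R := k) (A := A)).lTensor (MaxExterior ϖ) (Y.coact x)))) := by
      simp only [e₁]
      simp (disch := fun_prop) only [lTensor_eq_sw, hY.sw_coact_ι_mul, sw_sw, sw_tmul,
        comul_mul_eq_sw, tmul_sw]
      refine sw_congr _ fun v₀ p₂ => ?_
      rw [sw_comm]
    rw [e₂, e₃, h ()]
    simp only [e₁]
    exact hX.sw_coassoc (fun p₀ p₁ p₂ => sw _ (fun y₀ s => sw s (fun y₁ y₂ =>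
      (ι ϖ p₀ * y₀) ⊗ₜ ((p₁ * y₁) ⊗ₜ (p₂ * y₂))))) (by fun_prop) (by fun_prop) (by fun_prop) v

theorem coact_counit (x : MaxExterior ϖ) : TensorProduct.rid k (MaxExterior ϖ)
    ((Coalgebra.counit (R := k) (A := A)).lTensor (MaxExterior ϖ) (Y.coact x)) = x := by
  refine lin_ext (J := Unit) (f := fun _ x => TensorProduct.rid k (MaxExterior ϖ)
    ((Coalgebra.counit (R := k) (A := A)).lTensor (MaxExterior ϖ) (Y.coact x)))
    (g := fun _ x => x) (fun _ => by fun_prop) (fun _ => by fun_prop) (fun _ => ?_)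
    (fun v x h _ => ?_) () x
  · rw [hY.coact_one, LinearMap.lTensor_tmul]
    simp
  · simp (disch := fun_prop) only [lTensor_eq_sw, map_sw_equiv, TensorProduct.rid_tmul,
      hY.sw_coact_ι_mul] at h ⊢
    simp only [Bialgebra.counit_mul, mul_smul, ← mul_smul_comm, ← smul_sw, ← mul_sw, h ()]
    simp only [mul_smul_comm]
    exact hX.sw_counit (fun v => ι ϖ v * x) (by fun_prop) v

/-- In this antipode-free form the condition passes to products: the leg of `a` in front is carried
past the coaction of the generator by the condition on `V`, then past that of the rest by the
induction hypothesis. -/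
theorem sw_mul_coact_act (x : MaxExterior ϖ) (a : A) :
    sw (δ a) (fun a₁ a₂ => sw (Y.coact (Y.act x a₂)) (fun p q => p ⊗ₜ[k] (a₁ * q))) =
      sw (δ a) (fun a₁ a₂ => sw (Y.coact x) (fun x₀ x₁ => Y.act x₀ a₁ ⊗ₜ[k] (x₁ * a₂))) := by
  refine lin_ext (f := fun a x => sw (δ a) (fun a₁ a₂ => sw (Y.coact (Y.act x a₂))
    (fun p q => p ⊗ₜ[k] (a₁ * q)))) (g := fun a x => sw (δ a) (fun a₁ a₂ =>
      sw (Y.coact x) (fun x₀ x₁ => Y.act x₀ a₁ ⊗ₜ[k] (x₁ * a₂)))) (fun _ => by fun_prop)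
    (fun _ => by fun_prop) (fun a => ?_) (fun v x h a => ?_) a x
  · simp (disch := fun_prop) only [hY.one_act, map_smul, sw_smul, hY.sw_coact_one, mul_one, one_mul]
    simp only [← TensorProduct.smul_tmul', sw_counit_right (fun a => (1 : MaxExterior ϖ) ⊗ₜ[k] a) (by fun_prop) a,
      sw_counit_left (fun a => (1 : MaxExterior ϖ) ⊗ₜ[k] a) (by fun_prop) a]
  -- The induction hypothesis is an equality of tensors; summing `F` over both sides gives it for
  -- every bilinear `F`.
  · have h' (F : MaxExterior ϖ → A → MaxExterior ϖ ⊗[k] A) (h₁ : ∀ y, Lin k (fun x => F x y))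
        (h₂ : ∀ x, Lin k (fun y => F x y)) (a : A) :
        sw (δ a) (fun a₁ a₂ => sw (Y.coact (Y.act x a₂)) (fun p q => F p (a₁ * q))) =
          sw (δ a) (fun a₁ a₂ => sw (Y.coact x) (fun x₀ x₁ => F (Y.act x₀ a₁) (x₁ * a₂))) := by
      have := congrArg (fun t => sw t F) (h a)
      simpa (disch := fun_prop) only [sw_sw, sw_tmul] using this
    calc _ = sw (δ a) (fun b' c => sw (δ b') (fun a₁ b => sw (X.coact (X.act v b)) (fun p₀ p₁ =>
          sw (Y.coact (Y.act x c)) (fun q₀ q₁ => (ι ϖ p₀ * q₀) ⊗ₜ[k] (a₁ * p₁ * q₁))))) := by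
          simp (disch := fun_prop) only [hY.ι_mul_act, map_sw, sw_sw, hY.sw_coact_ι_mul,
            BraidedCalculus.sw_coassoc, mul_assoc]
      _ = sw (δ a) (fun b' c => sw (δ b') (fun a₁ b => sw (X.coact v) (fun v₀ v₁ =>
          sw (Y.coact (Y.act x c)) (fun q₀ q₁ =>
            (ι ϖ (X.act v₀ a₁) * q₀) ⊗ₜ[k] (v₁ * b * q₁))))) := by
          refine sw_congr _ fun b' c => ?_
          exact hX.sw_mul_coact_act (fun p r => sw (Y.coact (Y.act x c)) (fun q₀ q₁ =>
            (ι ϖ p * q₀) ⊗ₜ[k] (r * q₁))) (by fun_prop) (by fun_prop) v b'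
      _ = sw (δ a) (fun a₁ b' => sw (X.coact v) (fun v₀ v₁ => sw (δ b') (fun b c =>
          sw (Y.coact (Y.act x c)) (fun q₀ q₁ =>
            (ι ϖ (X.act v₀ a₁) * q₀) ⊗ₜ[k] (v₁ * (b * q₁)))))) := by
          simp (disch := fun_prop) only [BraidedCalculus.sw_coassoc, mul_assoc]
          exact sw_congr _ fun a₁ b' => sw_comm _ _ _
      _ = sw (δ a) (fun a₁ b' => sw (X.coact v) (fun v₀ v₁ => sw (δ b') (fun b c =>
          sw (Y.coact x) (fun x₀ x₁ =>
            (ι ϖ (X.act v₀ a₁) * Y.act x₀ b) ⊗ₜ[k] (v₁ * (x₁ * c)))))) := by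
          refine sw_congr _ fun a₁ b' => sw_congr _ fun v₀ v₁ => ?_
          exact h' (fun q r => (ι ϖ (X.act v₀ a₁) * q) ⊗ₜ[k] (v₁ * r)) (by fun_prop) (by fun_prop) b'
      _ = _ := by
          simp (disch := fun_prop) only [hY.sw_coact_ι_mul, hY.ι_mul_act, sw_tmul_const]
          have h₁ (a₁ a₂ : A) : sw (X.coact v) (fun v₀ v₁ => sw (Y.coact x) (fun x₀ x₁ =>
              sw (δ a₁) (fun b c => (ι ϖ (X.act v₀ b) * Y.act x₀ c) ⊗ₜ[k] (v₁ * x₁ * a₂)))) =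
              sw (δ a₁) (fun b c => sw (X.coact v) (fun v₀ v₁ => sw (Y.coact x) (fun x₀ x₁ =>
                (ι ϖ (X.act v₀ b) * Y.act x₀ c) ⊗ₜ[k] (v₁ * x₁ * a₂)))) :=
            (sw_congr _ fun v₀ v₁ => sw_comm _ _ _).trans (sw_comm _ _ _)
          simp only [h₁]
          simp (disch := fun_prop) only [BraidedCalculus.sw_coassoc, mul_assoc]
          exact sw_congr _ fun a₁ b' => sw_comm _ _ _

theorem isCrossedModule : Y.IsCrossedModule where
  act_one := hY.act_one hX
  act_mul := hY.act_mul hX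
  coact_coassoc := hY.coact_coassoc hX
  coact_counit := hY.coact_counit hX
  coact_act x := Y.coact_act_of_sw x (hY.sw_mul_coact_act hX x)

end Extends

end MaxExterior

/-! ### Parity and Koszul signs -/

section GradedSigns

variable {k Λ M : Type*} [Field k] [Ring Λ] [Algebra k Λ] [AddCommMonoid M] [Module k M]
  (𝒜 : ℕ → Submodule k Λ) [GradedAlgebra 𝒜]

theorem graded_lin_ext {f g : Λ → M} (hf : Lin k f) (hg : Lin k g)
    (h : ∀ n, ∀ x ∈ 𝒜 n, f x = g x) (x : Λ) : f x = g x := by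
  induction x using DirectSum.Decomposition.inductionOn 𝒜 with
  | zero => rw [hf.map_zero, hg.map_zero]
  | homogeneous x => exact h _ x x.2
  | add x y hx hy => rw [hf.map_add, hg.map_add, hx, hy]

theorem parity_of_mem {n : ℕ} {x : Λ} (hx : x ∈ 𝒜 n) : parity 𝒜 x = (-1 : k) ^ n • x :=
  gradedMap_of_mem 𝒜 _ hx

theorem parity_mem {n : ℕ} {x : Λ} (hx : x ∈ 𝒜 n) : parity 𝒜 x ∈ 𝒜 n := by
  rw [parity_of_mem 𝒜 hx]
  exact Submodule.smul_mem _ _ hx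

theorem parity_one : parity 𝒜 1 = 1 := by
  rw [parity_of_mem 𝒜 (SetLike.GradedOne.one_mem), pow_zero, one_smul]

theorem parity_parity (x : Λ) : parity 𝒜 (parity 𝒜 x) = x := by
  refine graded_lin_ext 𝒜 (f := fun x => parity 𝒜 (parity 𝒜 x)) (g := fun x => x) (by fun_prop)
    (by fun_prop) (fun n x hx => ?_) x
  rw [parity_of_mem 𝒜 hx, map_smul, parity_of_mem 𝒜 hx, smul_smul, ← pow_add, Even.neg_one_pow
    ⟨n, rfl⟩, one_smul]

theorem parity_mul (x y : Λ) : parity 𝒜 (x * y) = parity 𝒜 x * parity 𝒜 y := by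
  refine graded_lin_ext 𝒜 (f := fun x => parity 𝒜 (x * y)) (g := fun x => parity 𝒜 x * parity 𝒜 y)
    (by fun_prop) (by fun_prop) (fun n x hx => ?_) x
  refine graded_lin_ext 𝒜 (f := fun y => parity 𝒜 (x * y)) (g := fun y => parity 𝒜 x * parity 𝒜 y)
    (by fun_prop) (by fun_prop) (fun m y hy => ?_) y
  rw [parity_of_mem 𝒜 hx, parity_of_mem 𝒜 hy, parity_of_mem 𝒜 (SetLike.GradedMul.mul_mem hx hy),
    smul_mul_smul_comm, pow_add]

/-- Raising the degree of the left factor by one multiplies the sign by `(-1)^{|y|}`, which is the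
parity of the right factor. -/
theorem koszul_mul_of_mem_one {w : Λ} (hw : w ∈ 𝒜 1) (x y : Λ) : koszul 𝒜 ((w * x) ⊗ₜ y) =
    TensorProduct.map (LinearMap.mulLeft k w) (parity 𝒜) (koszul 𝒜 (x ⊗ₜ y)) := by
  refine graded_lin_ext 𝒜 (f := fun x => koszul 𝒜 ((w * x) ⊗ₜ y)) (g := fun x =>
    TensorProduct.map (LinearMap.mulLeft k w) (parity 𝒜) (koszul 𝒜 (x ⊗ₜ y))) (by fun_prop)
    (by fun_prop) (fun n x hx => ?_) x
  refine graded_lin_ext 𝒜 (f := fun y => koszul 𝒜 ((w * x) ⊗ₜ y)) (g := fun y =>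
    TensorProduct.map (LinearMap.mulLeft k w) (parity 𝒜) (koszul 𝒜 (x ⊗ₜ y))) (by fun_prop)
    (by fun_prop) (fun m y hy => ?_) y
  rw [koszul_tmul 𝒜 (SetLike.GradedMul.mul_mem hw hx) hy, koszul_tmul 𝒜 hx hy, map_smul,
    TensorProduct.map_tmul, parity_of_mem 𝒜 hy, TensorProduct.tmul_smul, smul_smul, ← pow_add,
    LinearMap.mulLeft_apply]
  congr 2
  ring

theorem koszul_one_tmul (y : Λ) : koszul 𝒜 (1 ⊗ₜ y) = 1 ⊗ₜ y := by
  refine graded_lin_ext 𝒜 (f := fun y => koszul 𝒜 (1 ⊗ₜ y)) (g := fun y => 1 ⊗ₜ y) (by fun_prop)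
    (by fun_prop) (fun m y hy => ?_) y
  rw [koszul_tmul 𝒜 SetLike.GradedOne.one_mem hy, zero_mul, pow_zero, one_smul]

theorem tmul_mem_tensorDeg {i j n : ℕ} {x y : Λ} (hx : x ∈ 𝒜 i) (hy : y ∈ 𝒜 j) (h : i + j = n) :
    x ⊗ₜ y ∈ tensorDeg 𝒜 n :=
  Submodule.mem_iSup_of_mem (i, j) (Submodule.mem_iSup_of_mem h ⟨⟨x, hx⟩ ⊗ₜ ⟨y, hy⟩, rfl⟩)

theorem tensorDeg_induction {f : Λ ⊗[k] Λ → M} (hf : Lin k f) {n : ℕ} {N : Submodule k M}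
    (h : ∀ i j, i + j = n → ∀ x ∈ 𝒜 i, ∀ y ∈ 𝒜 j, f (x ⊗ₜ y) ∈ N) {t : Λ ⊗[k] Λ}
    (ht : t ∈ tensorDeg 𝒜 n) : f t ∈ N := by
  suffices h' : tensorDeg 𝒜 n ≤ N.comap (Lin.toMap f hf) from h' ht
  refine iSup_le fun p => iSup_le fun hp => ?_
  rintro _ ⟨t, rfl⟩
  change f _ ∈ N
  induction t with
  | zero => rw [map_zero, hf.map_zero]; exact zero_mem _
  | add s t hs ht => rw [map_add, hf.map_add]; exact add_mem hs ht
  | tmul x y => exact h _ _ hp x x.2 y y.2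

end GradedSigns

/-! ### Multiplication by primitive elements on the super-braided tensor square -/

namespace MaxExterior

variable {k A V M J : Type*} [Field k] [Ring A] [HopfAlgebra k A] [AddCommMonoid M] [Module k M]
  [AddCommGroup V] [Module k V] {ϖ : APlus k A →ₗ[k] V}

local notation "δ" => Coalgebra.comul (R := k)
local notation "ε" => Coalgebra.counit (R := k)
local notation "S" => HopfAlgebra.antipode k
local notation "P" => parity (deg ϖ)

theorem parity_ι (v : V) : P (ι ϖ v) = -ι ϖ v := by
  rw [parity_of_mem _ (ι_mem_deg v), pow_one, neg_one_smul]

theorem parity_ι_mul (v : V) (x : MaxExterior ϖ) : P (ι ϖ v * x) = -(ι ϖ v * P x) := by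
  rw [parity_mul, parity_ι, neg_mul]

section Slide

variable (Y : ActCoact k A (MaxExterior ϖ))

/-- `slide Y f (y ⊗ z) = (-1)^{|y|} y₀ ⊗ f(y₁) z`. -/
def slide : (A →ₗ[k] MaxExterior ϖ) →ₗ[k]
    Module.End k (MaxExterior ϖ ⊗[k] MaxExterior ϖ) :=
  mkBilin (fun f t => sw t (fun y z => sw (Y.coact (P y)) (fun y₀ y₁ => y₀ ⊗ₜ[k] (f y₁ * z))))
    (fun _ => by fun_prop) (fun _ => by fun_prop)

theorem slide_apply (f : A →ₗ[k] MaxExterior ϖ) (t : MaxExterior ϖ ⊗[k] MaxExterior ϖ) :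
    slide Y f t =
      sw t (fun y z => sw (Y.coact (P y)) (fun y₀ y₁ => y₀ ⊗ₜ[k] (f y₁ * z))) := rfl

/-- Left multiplication by `v ⊗ 1 + 1 ⊗ v` on the super-braided tensor square:
`y ⊗ z ↦ v y ⊗ z + (-1)^{|y|} y₀ ⊗ (v ◁ y₁) z`. -/
def leftOp : V →ₗ[k] Module.End k (MaxExterior ϖ ⊗[k] MaxExterior ϖ) :=
  mkBilin (fun v t => (LinearMap.mulLeft k (ι ϖ v)).rTensor (MaxExterior ϖ) t)
    (fun t => by simp only [rTensor_eq_sw, LinearMap.mulLeft_apply]; fun_prop)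
    (fun _ => by fun_prop) +
  slide Y ∘ₗ Y.act ∘ₗ ι ϖ

theorem leftOp_apply (v : V) (t : MaxExterior ϖ ⊗[k] MaxExterior ϖ) : leftOp Y v t =
    sw t (fun y z => (ι ϖ v * y) ⊗ₜ[k] z) +
      sw t (fun y z => sw (Y.coact (P y)) (fun y₀ y₁ => y₀ ⊗ₜ[k] (Y.act (ι ϖ v) y₁ * z))) := by
  change (LinearMap.mulLeft k (ι ϖ v)).rTensor (MaxExterior ϖ) t + slide Y (Y.act (ι ϖ v)) t = _
  rw [rTensor_eq_sw, slide_apply]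
  rfl

theorem leftOp_tmul (v : V) (y z : MaxExterior ϖ) : leftOp Y v (y ⊗ₜ z) =
    (ι ϖ v * y) ⊗ₜ[k] z + sw (Y.coact (P y)) (fun y₀ y₁ => y₀ ⊗ₜ[k] (Y.act (ι ϖ v) y₁ * z)) := by
  simp (disch := fun_prop) only [leftOp_apply, sw_tmul]

end Slide

namespace Extends

variable {X : ActCoact k A V} {Y : ActCoact k A (MaxExterior ϖ)} (hY : Extends X Y)
include hY

theorem parity_act (x : MaxExterior ϖ) (a : A) : P (Y.act x a) = Y.act (P x) a := by
  refine graded_lin_ext (deg ϖ) (f := fun x => P (Y.act x a)) (g := fun x => Y.act (P x) a)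
    (by fun_prop) (by fun_prop) (fun n x hx => ?_) x
  rw [parity_of_mem _ hx, parity_of_mem _ (hY.act_deg hx a), map_smul, LinearMap.smul_apply]

theorem sw_coact_parity (F : MaxExterior ϖ → A → M) (h₁ : ∀ y, Lin k (fun x => F x y))
    (h₂ : ∀ x, Lin k (fun y => F x y)) (x : MaxExterior ϖ) :
    sw (Y.coact (P x)) F = sw (Y.coact x) (fun x₀ x₁ => F (P x₀) x₁) := by
  refine graded_lin_ext (deg ϖ) (f := fun x => sw (Y.coact (P x)) F)
    (g := fun x => sw (Y.coact x) (fun x₀ x₁ => F (P x₀) x₁))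
    (by fun_prop) (by fun_prop) (fun n x hx => ?_) x
  obtain ⟨t, ht⟩ := hY.coact_deg hx
  rw [parity_of_mem _ hx, map_smul, ← ht, sw_smul _ _ _ h₁ h₂, sw_rTensor _ _ _ h₁ h₂,
    sw_rTensor _ _ _ (by fun_prop) (by fun_prop), ← sw_fun_smul]
  refine sw_congr _ fun x₀ x₁ => ?_
  rw [Submodule.subtype_apply, parity_of_mem _ x₀.2, (h₁ x₁).map_smul]

variable (hX : X.IsCrossedModule)
include hX

/-- The two parity signs cancel, and coassociativity of the coaction merges the two sliding maps
into the convolution product of `f` and `g`. -/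
theorem slide_slide (f g : A →ₗ[k] MaxExterior ϖ) (y z : MaxExterior ϖ) :
    slide Y f (slide Y g (y ⊗ₜ z)) = sw (Y.coact y) (fun y₀ y₁ =>
      y₀ ⊗ₜ[k] (sw (δ y₁) (fun b c => f b * g c) * z)) := by
  simp (disch := fun_prop) only [slide_apply, sw_tmul, sw_sw]
  rw [hY.sw_coact_parity (fun y₀ y₁ => sw (Y.coact (P y₀)) (fun x₀ x₁ =>
    x₀ ⊗ₜ[k] (f x₁ * (g y₁ * z)))) (by fun_prop) (by fun_prop)]
  simp only [parity_parity]
  rw [(hY.isCrossedModule hX).sw_coassoc (fun x₀ x₁ y₁ => x₀ ⊗ₜ[k] (f x₁ * (g y₁ * z)))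
    (by fun_prop) (by fun_prop) (by fun_prop)]
  simp only [sw_mul, tmul_sw, mul_assoc]

/-- This is `(v ⊗ 1 + 1 ⊗ v)(w ⊗ 1 + 1 ⊗ w)` acting on `y ⊗ z`. The bracketed part is the action of
`(id - Ψ)(v ⊗ w)`; its minus sign arises because `1 ⊗ v` passes the odd element `w`. -/
theorem leftOp_leftOp (v w : V) (y z : MaxExterior ϖ) : leftOp Y v (leftOp Y w (y ⊗ₜ z)) =
    (ι ϖ v * ι ϖ w * y) ⊗ₜ[k] z +
      (sw (Y.coact (P y)) (fun y₀ y₁ => (ι ϖ v * y₀) ⊗ₜ[k] (ι ϖ (X.act w y₁) * z)) -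
        sw (X.coact w) (fun w₀ w₁ => sw (Y.coact (P y)) (fun y₀ y₁ => (ι ϖ w₀ * y₀) ⊗ₜ[k]
          (ι ϖ (X.act (X.act v w₁) y₁) * z)))) +
      sw (Y.coact y) (fun y₀ y₁ => y₀ ⊗ₜ[k] (Y.act (ι ϖ v * ι ϖ w) y₁ * z)) := by
  have h₂ := hY.slide_slide hX (Y.act (ι ϖ v)) (Y.act (ι ϖ w)) y z
  simp only [← hY.mul_act] at h₂
  rw [← h₂, leftOp_tmul, map_add, leftOp_tmul]
  simp (disch := fun_prop) only [leftOp_apply, slide_apply, sw_sw, sw_tmul, parity_ι_mul, map_neg,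
    sw_neg, hY.sw_coact_ι_mul, hX.act_mul, hY.act_ι, mul_assoc]
  abel

/-- The two outer terms of `leftOp_leftOp` contain the relation itself and vanish; the mixed terms
cancel because relations are fixed by `Ψ`. So the relations hold between the operators that are to
define the coproduct. -/
theorem sw_leftOp_leftOp (hϖ : (augmentation k A).IsHom X ϖ) {a : A} (ha : ε a = 0)
    (h : mcV ϖ a = 0) :
    sw (δ a) (fun a₁ a₂ => leftOp Y (mcV ϖ a₁) * leftOp Y (mcV ϖ a₂)) = 0 := by
  refine TensorProduct.ext' fun y z => ?_
  rw [sw_apply_const]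
  simp only [Module.End.mul_apply, hY.leftOp_leftOp hX, sw_fun_add, sw_fun_sub]
  have h₃ := sw_mcForm_mul ha h
  simp only [mcForm_eq] at h₃
  have h₄ := sw_braid_of_mcV_eq_zero hϖ (fun v w => sw (Y.coact (P y)) (fun y₀ y₁ =>
    (ι ϖ v * y₀) ⊗ₜ[k] (ι ϖ (X.act w y₁) * z))) (by fun_prop) (by fun_prop) h
  rw [h₄, sub_self, ← sw_tmul_const, ← sw_mul, h₃, sw_comm]
  simp only [← tmul_sw, ← sw_mul, ← sw_apply_const, ← map_sw, h₃]
  simp [sw_fun_zero]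

end Extends

end MaxExterior

/-! ### The diagonal coaction on a tensor product -/

section TensorCoact

variable {k A M V W : Type*} [Field k] [Ring A] [HopfAlgebra k A] [AddCommMonoid M] [Module k M]
  [AddCommGroup V] [Module k V] [AddCommGroup W] [Module k W]

/-- The tensor product coaction `x ⊗ y ↦ x₀ ⊗ y₀ ⊗ x₁ y₁`. -/
def tensorCoact (X : ActCoact k A V) (Y : ActCoact k A W) :
    V ⊗[k] W →ₗ[k] (V ⊗[k] W) ⊗[k] A :=
  Lin.toMap (fun t => sw t (fun x y => sw (X.coact x) (fun x₀ x₁ => sw (Y.coact y) (fun y₀ y₁ =>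
    (x₀ ⊗ₜ[k] y₀) ⊗ₜ[k] (x₁ * y₁))))) (by fun_prop)

theorem tensor_coact_eq (X : ActCoact k A V) (Y : ActCoact k A W) (t : V ⊗[k] W) :
    (X.tensor Y).coact t = tensorCoact X Y t := ActCoact.tensor_coact X Y t

theorem tensorCoact_tmul (X : ActCoact k A V) (Y : ActCoact k A W) (x : V) (y : W) :
    tensorCoact X Y (x ⊗ₜ y) = sw (X.coact x) (fun x₀ x₁ => sw (Y.coact y) (fun y₀ y₁ =>
      (x₀ ⊗ₜ[k] y₀) ⊗ₜ[k] (x₁ * y₁))) := by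
  simp (disch := fun_prop) only [tensorCoact, Lin.toMap_apply, sw_tmul]

theorem sw_tensorCoact (X : ActCoact k A V) (Y : ActCoact k A W) (f : V ⊗[k] W → A → M)
    (h₁ : ∀ b, Lin k (fun t => f t b)) (h₂ : ∀ t, Lin k (f t)) (t : V ⊗[k] W) :
    sw (tensorCoact X Y t) f = sw t (fun x y => sw (X.coact x) (fun x₀ x₁ =>
      sw (Y.coact y) (fun y₀ y₁ => f (x₀ ⊗ₜ[k] y₀) (x₁ * y₁)))) := by
  simp (disch := fun_prop) only [tensorCoact, Lin.toMap_apply, sw_sw, sw_tmul]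

end TensorCoact

/-! ### The braided coproduct of `Λ_max` -/

namespace MaxExterior

variable {k A V M J : Type*} [Field k] [Ring A] [HopfAlgebra k A] [AddCommMonoid M] [Module k M]
  [AddCommGroup V] [Module k V] {ϖ : APlus k A →ₗ[k] V}

local notation "δ" => Coalgebra.comul (R := k)
local notation "ε" => Coalgebra.counit (R := k)
local notation "S" => HopfAlgebra.antipode k
local notation "P" => parity (deg ϖ)

variable {X : ActCoact k A V} {Y : ActCoact k A (MaxExterior ϖ)}

/-- The recursive description of the braided coproduct of `Λ_max`. -/
structure IsComul (Y : ActCoact k A (MaxExterior ϖ))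
    (Δ : MaxExterior ϖ →ₗ[k] MaxExterior ϖ ⊗[k] MaxExterior ϖ) : Prop where
  one : Δ 1 = 1 ⊗ₜ 1
  ι_mul : ∀ v x, Δ (ι ϖ v * x) = leftOp Y v (Δ x)

/-- The coproduct of `x` is the operator attached to `x` applied to `1 ⊗ 1`. Operators on the tensor
square form an algebra at no cost, whereas using the square itself as target would require its
associativity. -/
theorem Extends.exists_isComul (hY : Extends X Y) (hX : X.IsCrossedModule)
    (hϖ : (augmentation k A).IsHom X ϖ) : ∃ Δ, IsComul Y Δ := by
  obtain ⟨F, hF⟩ := exists_lift (ϖ := ϖ) (leftOp Y) (fun a ha h => hY.sw_leftOp_leftOp hX hϖ ha h)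
  refine ⟨(LinearMap.applyₗ (1 ⊗ₜ 1)) ∘ₗ F.toLinearMap, by simp, fun v x => ?_⟩
  simp [hF]

/-- The counit of `Λ_max`. -/
def counitHom : MaxExterior ϖ →ₐ[k] k :=
  lift ϖ 0 (fun a _ => by rw [sweedler_eq_sw]; simp [sw_fun_zero])

theorem counitHom_ι (v : V) : counitHom (ι ϖ v) = 0 := lift_ι ϖ 0 _ v

theorem counitHom_of_mem {n : ℕ} (hn : n ≠ 0) {x : MaxExterior ϖ} (hx : x ∈ deg ϖ n) :
    counitHom x = 0 := by
  obtain ⟨n, rfl⟩ := Nat.exists_eq_succ_of_ne_zero hn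
  have := mem_of_mem_deg (J := Unit) (f := fun _ x => counitHom (ϖ := ϖ) x)
    -- Vanishing in positive degree is phrased as membership in `⊥`; degree zero is unconstrained.
    (N := fun n => if n = 0 then ⊤ else ⊥) (fun _ => by fun_prop) (fun _ => by simp)
    (fun n v x _ _ _ => by simp [counitHom_ι]) hx ()
  simpa using this

theorem counitHom_parity (x : MaxExterior ϖ) : counitHom (P x) = counitHom x := by
  refine lin_ext (J := Unit) (f := fun _ x => counitHom (P x)) (g := fun _ x => counitHom x)
    (fun _ => by fun_prop) (fun _ => by fun_prop) (fun _ => by rw [parity_one])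
    (fun v x _ _ => by simp [parity_ι_mul, counitHom_ι]) () x

namespace Extends

variable (hY : Extends X Y)
include hY

theorem counitHom_act (x : MaxExterior ϖ) (a : A) :
    counitHom (Y.act x a) = ε a * counitHom x := by
  refine lin_ext (f := fun a x => counitHom (Y.act x a)) (g := fun a x => ε a * counitHom x)
    (fun _ => by fun_prop) (fun _ => by fun_prop) (fun a => ?_) (fun v x _ a => ?_) a x
  · simp [hY.one_act]
  · rw [hY.ι_mul_act, map_sw_algHom]
    simp [counitHom_ι, sw_fun_zero]

theorem sw_coact_counitHom (f : A → M) (hf : Lin k f) (x : MaxExterior ϖ) :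
    sw (Y.coact x) (fun x₀ x₁ => counitHom x₀ • f x₁) = counitHom x • f 1 := by
  refine lin_ext (J := Unit) (f := fun _ x => sw (Y.coact x) (fun x₀ x₁ => counitHom x₀ • f x₁))
    (g := fun _ x => counitHom x • f 1) (fun _ => by fun_prop) (fun _ => by fun_prop) (fun _ => ?_)
    (fun v x _ _ => ?_) () x
  · rw [hY.sw_coact_one (M := M) (fun x₀ x₁ => counitHom x₀ • f x₁) (by fun_prop) (by fun_prop)]
  · rw [hY.sw_coact_ι_mul (M := M) (fun x₀ x₁ => counitHom x₀ • f x₁) (by fun_prop) (by fun_prop)]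
    simp [counitHom_ι, sw_fun_zero]

theorem counit_isHom : Y.IsHom (ActCoact.unitObject k A) (counitHom (ϖ := ϖ)).toLinearMap := by
  refine ⟨fun x a => ?_, fun x => ?_⟩
  · change counitHom (Y.act x a) = ε a • counitHom x
    rw [hY.counitHom_act, smul_eq_mul]
  · have := hY.sw_coact_counitHom (M := k ⊗[k] A) (fun a : A => (1 : k) ⊗ₜ[k] a) (by fun_prop) x
    rw [rTensor_eq_sw]
    simp only [TensorProduct.smul_tmul', smul_eq_mul, mul_one] at this
    exact this.symm

variable (hX : X.IsCrossedModule)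
include hX

/-- Together with `leftOp_coact`, this makes `leftOp` a morphism `V ⊗ (Λ ⊗ Λ) → Λ ⊗ Λ`, so the
coproduct built from it is a morphism. The sliding term is the one that needs the crossed-module
condition, applied to its first factor. -/
theorem leftOp_act (v : V) (t : MaxExterior ϖ ⊗[k] MaxExterior ϖ) (a : A) :
    (Y.tensor Y).act (leftOp Y v t) a =
      sw (δ a) (fun a₁ a₂ => leftOp Y (X.act v a₁) ((Y.tensor Y).act t a₂)) := by
  suffices h : (Y.tensor Y).act.flip a ∘ₗ leftOp Y v = Lin.toMap (fun t => sw (δ a) (fun a₁ a₂ =>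
      leftOp Y (X.act v a₁) ((Y.tensor Y).act t a₂))) (by fun_prop) from LinearMap.congr_fun h t
  refine TensorProduct.ext' fun y z => ?_
  change (Y.tensor Y).act (leftOp Y v (y ⊗ₜ z)) a =
    sw (δ a) (fun a₁ a₂ => leftOp Y (X.act v a₁) ((Y.tensor Y).act (y ⊗ₜ z) a₂))
  simp (disch := fun_prop) only [leftOp_tmul, ActCoact.tensor_act, sw_add, sw_tmul, sw_sw,
    sw_fun_add, map_sw, hY.act_ι]
  congr 1
  · simp (disch := fun_prop) only [hY.mul_act, hY.act_ι, sw_tmul_const, sw_coassoc]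
  · simp only [hY.parity_act]
    have h₁ := (hY.isCrossedModule hX).sw_mul_coact_act (M := MaxExterior ϖ ⊗[k] MaxExterior ϖ)
    have h₂ := fun z a => h₁ (fun p q => p ⊗ₜ[k] (ι ϖ (X.act v q) * z)) (by fun_prop) (by fun_prop)
      (P y) a
    simp only [hX.act_mul] at h₂
    rw [← sw_coassoc (fun a₁ b c => sw (Y.coact (Y.act (P y) b)) (fun y₀ y₁ =>
      y₀ ⊗ₜ[k] (ι ϖ (X.act (X.act v a₁) y₁) * Y.act z c))) (by fun_prop) (by fun_prop)
      (by fun_prop)]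
    simp (disch := fun_prop) only [h₂, sw_coassoc, hY.mul_act, hY.act_ι, tmul_sw]
    refine sw_congr _ fun a₁ a₂ => ?_
    rw [sw_comm]

/-- In the sliding term the coaction of `v ◁ y₂` is preceded by the leg `y₁`; the crossed-module
condition on `V`, used between two applications of coassociativity for `y`, puts `v₁` in front. -/
theorem leftOp_coact (v : V) (t : MaxExterior ϖ ⊗[k] MaxExterior ϖ) :
    tensorCoact Y Y (leftOp Y v t) =
      sw (X.coact v) (fun v₀ v₁ => sw (tensorCoact Y Y t) (fun s b =>
        leftOp Y v₀ s ⊗ₜ[k] (v₁ * b))) := by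
  suffices h : tensorCoact Y Y ∘ₗ leftOp Y v = Lin.toMap (fun t => sw (X.coact v) (fun v₀ v₁ =>
      sw (tensorCoact Y Y t) (fun s b => leftOp Y v₀ s ⊗ₜ[k] (v₁ * b)))) (by fun_prop) from
    LinearMap.congr_fun h t
  refine TensorProduct.ext' fun y z => ?_
  change tensorCoact Y Y (leftOp Y v (y ⊗ₜ z)) = sw (X.coact v) (fun v₀ v₁ =>
      sw (tensorCoact Y Y (y ⊗ₜ z)) (fun s b => leftOp Y v₀ s ⊗ₜ[k] (v₁ * b)))
  simp (disch := fun_prop) only [leftOp_tmul, tensorCoact_tmul, map_add, map_sw, sw_tmul, sw_sw,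
    sw_fun_add, hY.act_ι, hY.sw_coact_ι_mul, TensorProduct.add_tmul, mul_assoc,
    sw_tmul_const]
  congr 1
  have hYc := hY.isCrossedModule hX
  calc _ = sw (Y.coact (P y)) (fun y₀ y' => sw (δ y') (fun y₁ y₂ => sw (X.coact (X.act v y₂))
        (fun r₀ r₁ => sw (Y.coact z) (fun z₀ z₁ =>
          (y₀ ⊗ₜ[k] (ι ϖ r₀ * z₀)) ⊗ₜ[k] (y₁ * r₁ * z₁))))) := by
        rw [← hYc.sw_coassoc (fun y₀ y₁ y₂ => sw (X.coact (X.act v y₂))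
          (fun r₀ r₁ => sw (Y.coact z) (fun z₀ z₁ =>
          (y₀ ⊗ₜ[k] (ι ϖ r₀ * z₀)) ⊗ₜ[k] (y₁ * r₁ * z₁)))) (by fun_prop) (by fun_prop)
          (by fun_prop)]
        simp only [mul_assoc]
    _ = sw (Y.coact (P y)) (fun y₀ y' => sw (δ y') (fun y₁ y₂ => sw (X.coact v)
        (fun v₀ v₁ => sw (Y.coact z) (fun z₀ z₁ =>
          (y₀ ⊗ₜ[k] (ι ϖ (X.act v₀ y₁) * z₀)) ⊗ₜ[k] (v₁ * y₂ * z₁))))) := by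
        refine sw_congr _ fun y₀ y' => ?_
        exact hX.sw_mul_coact_act (fun p r => sw (Y.coact z) (fun z₀ z₁ =>
          (y₀ ⊗ₜ[k] (ι ϖ p * z₀)) ⊗ₜ[k] (r * z₁))) (by fun_prop) (by fun_prop) v y'
    _ = sw (X.coact v) (fun v₀ v₁ => sw (Y.coact (P y)) (fun y₀ y' => sw (δ y') (fun y₁ y₂ => 
        sw (Y.coact z) (fun z₀ z₁ =>
          (y₀ ⊗ₜ[k] (ι ϖ (X.act v₀ y₁) * z₀)) ⊗ₜ[k] (v₁ * y₂ * z₁))))) := by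
        rw [← sw_comm]
        exact sw_congr _ fun _ _ => sw_comm _ _ _
    _ = _ := by
        refine sw_congr _ fun v₀ v₁ => ?_
        rw [← hYc.sw_coassoc (fun y₀ y₁ y₂ => sw (Y.coact z) (fun z₀ z₁ =>
          (y₀ ⊗ₜ[k] (ι ϖ (X.act v₀ y₁) * z₀)) ⊗ₜ[k] (v₁ * y₂ * z₁))) (by fun_prop) (by fun_prop)
          (by fun_prop)]
        rw [hY.sw_coact_parity (fun y₀ y₁ => sw (Y.coact y₀) (fun b c => sw (Y.coact z)
          (fun z₀ z₁ => (b ⊗ₜ[k] (ι ϖ (X.act v₀ c) * z₀)) ⊗ₜ[k] (v₁ * y₁ * z₁))))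
          (by fun_prop) (by fun_prop)]
        refine sw_congr _ fun y₀ y₁ => ?_
        rw [sw_comm]
        simp only [mul_assoc]

theorem parity_leftOp (v : V) (t : MaxExterior ϖ ⊗[k] MaxExterior ϖ) :
    TensorProduct.map P P (leftOp Y v t) = -leftOp Y v (TensorProduct.map P P t) := by
  suffices h : TensorProduct.map P P ∘ₗ leftOp Y v = -(leftOp Y v ∘ₗ TensorProduct.map P P) from
    LinearMap.congr_fun h t
  refine TensorProduct.ext' fun y z => ?_
  simp only [LinearMap.comp_apply, LinearMap.neg_apply, TensorProduct.map_tmul, leftOp_tmul,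
    map_add, map_sw, parity_ι_mul, hY.act_ι, TensorProduct.neg_tmul, TensorProduct.tmul_neg,
    sw_fun_neg]
  rw [hY.sw_coact_parity (fun y₀ y₁ => y₀ ⊗ₜ[k] (ι ϖ (X.act v y₁) * P z)) (by fun_prop)
    (by fun_prop) (P y), neg_add]

end Extends

namespace IsComul

variable {Δ : MaxExterior ϖ →ₗ[k] MaxExterior ϖ ⊗[k] MaxExterior ϖ} (hΔ : IsComul Y Δ)
  (hY : Extends X Y) (hX : X.IsCrossedModule)
include hΔ hY hX

theorem comul_ι (v : V) : Δ (ι ϖ v) = ι ϖ v ⊗ₜ 1 + 1 ⊗ₜ ι ϖ v := by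
  rw [← mul_one (ι ϖ v), hΔ.ι_mul, hΔ.one, leftOp_tmul, parity_one,
    hY.sw_coact_one _ (by fun_prop) (by fun_prop), hY.act_ι, mul_one, mul_one, hX.act_one]

theorem comul_deg {n : ℕ} {x : MaxExterior ϖ} (hx : x ∈ deg ϖ n) : Δ x ∈ tensorDeg (deg ϖ) n := by
  refine mem_of_mem_deg (J := Unit) (f := fun _ x => Δ x) (N := tensorDeg (deg ϖ))
    (fun _ => by fun_prop) (fun _ => ?_) (fun n v x _ h _ => ?_) hx ()
  · rw [hΔ.one]
    exact tmul_mem_tensorDeg _ one_mem_deg one_mem_deg rfl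
  · rw [hΔ.ι_mul]
    refine tensorDeg_induction (deg ϖ) (f := fun t => leftOp Y v t) (by fun_prop)
      (fun i j hij x hx y hy => ?_) (h ())
    simp only [leftOp_tmul, hY.act_ι]
    refine add_mem (tmul_mem_tensorDeg _ (ι_mul_mem_deg v hx) hy (by omega)) ?_
    exact sw_mem_of_mem_range_rTensor (hY.coact_deg (parity_mem _ hx)) (by fun_prop) (by fun_prop)
      fun p hp a => tmul_mem_tensorDeg _ hp (ι_mul_mem_deg _ hy) (by omega)

theorem counit_comul (x : MaxExterior ϖ) : TensorProduct.lid k (MaxExterior ϖ)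
    (counitHom.toLinearMap.rTensor (MaxExterior ϖ) (Δ x)) = x := by
  have h₁ (t : MaxExterior ϖ ⊗[k] MaxExterior ϖ) : TensorProduct.lid k (MaxExterior ϖ)
      (counitHom.toLinearMap.rTensor (MaxExterior ϖ) t) = sw t (fun x y => counitHom x • y) := by
    simp only [rTensor_eq_sw, map_sw_equiv, TensorProduct.lid_tmul]
    rfl
  refine lin_ext (J := Unit) (f := fun _ x => TensorProduct.lid k (MaxExterior ϖ)
    (counitHom.toLinearMap.rTensor (MaxExterior ϖ) (Δ x))) (g := fun _ x => x)
    (fun _ => by fun_prop) (fun _ => by fun_prop) (fun _ => ?_) (fun v x h _ => ?_) () x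
  · simp [hΔ.one]
  · rw [h₁] at h ⊢
    conv_rhs => rw [← h ()]
    rw [hΔ.ι_mul, leftOp_apply]
    have h₂ (y z : MaxExterior ϖ) : sw (Y.coact (P y)) (fun y₀ y₁ => counitHom y₀ •
        (ι ϖ (X.act v y₁) * z)) = counitHom y • (ι ϖ v * z) := by
      rw [hY.sw_coact_counitHom (fun a => ι ϖ (X.act v a) * z) (by fun_prop), hX.act_one,
        counitHom_parity]
    simp (disch := fun_prop) only [sw_add, sw_sw, sw_tmul, map_mul, h₂,
      counitHom_ι, zero_mul, zero_smul, sw_fun_zero, zero_add, hY.act_ι, mul_sw, mul_smul_comm]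

theorem comul_counit (x : MaxExterior ϖ) : TensorProduct.rid k (MaxExterior ϖ)
    (counitHom.toLinearMap.lTensor (MaxExterior ϖ) (Δ x)) = x := by
  have h₁ (t : MaxExterior ϖ ⊗[k] MaxExterior ϖ) : TensorProduct.rid k (MaxExterior ϖ)
      (counitHom.toLinearMap.lTensor (MaxExterior ϖ) t) = sw t (fun x y => counitHom y • x) := by
    simp only [lTensor_eq_sw, map_sw_equiv, TensorProduct.rid_tmul]
    rfl
  refine lin_ext (J := Unit) (f := fun _ x => TensorProduct.rid k (MaxExterior ϖ)
    (counitHom.toLinearMap.lTensor (MaxExterior ϖ) (Δ x))) (g := fun _ x => x)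
    (fun _ => by fun_prop) (fun _ => by fun_prop) (fun _ => ?_) (fun v x h _ => ?_) () x
  · simp [hΔ.one]
  · rw [h₁] at h ⊢
    conv_rhs => rw [← h ()]
    rw [hΔ.ι_mul, leftOp_apply]
    simp (disch := fun_prop) only [sw_add, sw_sw, sw_tmul, map_mul,
      counitHom_ι, zero_mul, zero_smul, sw_fun_zero, add_zero, hY.act_ι, mul_sw, mul_smul_comm]

theorem comul_act (x : MaxExterior ϖ) (a : A) : Δ (Y.act x a) = (Y.tensor Y).act (Δ x) a := by
  refine lin_ext (f := fun a x => Δ (Y.act x a)) (g := fun a x => (Y.tensor Y).act (Δ x) a)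
    (fun _ => by fun_prop) (fun _ => by fun_prop) (fun a => ?_) (fun v x h a => ?_) a x
  · simp (disch := fun_prop) only [hY.one_act, map_smul, hΔ.one, ActCoact.tensor_act, sw_tmul,
      TensorProduct.tmul_smul]
    exact (sw_counit_right (fun a => (ε a • 1) ⊗ₜ[k] (1 : MaxExterior ϖ)) (by fun_prop) a).symm
  · simp only [hY.ι_mul_act, map_sw, hΔ.ι_mul, h, hY.leftOp_act hX]

theorem comul_coact (x : MaxExterior ϖ) : tensorCoact Y Y (Δ x) = Δ.rTensor A (Y.coact x) := by
  refine lin_ext (J := Unit) (f := fun _ x => tensorCoact Y Y (Δ x))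
    (g := fun _ x => Δ.rTensor A (Y.coact x))
    (fun _ => by fun_prop) (fun _ => by fun_prop) (fun _ => ?_) (fun v x h _ => ?_) () x
  · simp (disch := fun_prop) only [hΔ.one, hY.coact_one, tensorCoact_tmul, sw_tmul,
      LinearMap.rTensor_tmul, mul_one]
  · simp only [hΔ.ι_mul, hY.leftOp_coact hX]
    rw [h ()]
    simp (disch := fun_prop) only [rTensor_eq_sw, sw_sw, sw_tmul, hY.sw_coact_ι_mul, hΔ.ι_mul]

theorem comul_isHom : Y.IsHom (Y.tensor Y) Δ :=
  ⟨hΔ.comul_act hY hX, fun x => (tensor_coact_eq Y Y _).trans (hΔ.comul_coact hY hX x)⟩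

theorem sw_comul_coact (F : MaxExterior ϖ → MaxExterior ϖ → A → M)
    (h₁ : ∀ b c, Lin k (fun a => F a b c)) (h₂ : ∀ a c, Lin k (fun b => F a b c))
    (h₃ : ∀ a b, Lin k (fun c => F a b c)) (x : MaxExterior ϖ) :
    sw (Y.coact x) (fun x₀ x₁ => sw (Δ x₀) (fun p q => F p q x₁)) =
      sw (Δ x) (fun p q => sw (Y.coact p) (fun p₀ p₁ => sw (Y.coact q) (fun q₀ q₁ =>
        F p₀ q₀ (p₁ * q₁)))) := by
  have h := congrArg (fun t => sw t (fun s c => sw s (fun p q => F p q c)))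
    (hΔ.comul_coact hY hX x)
  simp (disch := fun_prop) only [sw_tensorCoact, sw_tmul, rTensor_eq_sw, sw_sw] at h
  exact h.symm

theorem comul_parity (x : MaxExterior ϖ) : Δ (P x) = TensorProduct.map P P (Δ x) := by
  refine lin_ext (J := Unit) (f := fun _ x => Δ (P x))
    (g := fun _ x => TensorProduct.map P P (Δ x))
    (fun _ => by fun_prop) (fun _ => by fun_prop) (fun _ => ?_) (fun v x h _ => ?_) () x
  · rw [parity_one, hΔ.one, TensorProduct.map_tmul, parity_one]
  · rw [parity_ι_mul, map_neg, hΔ.ι_mul, hΔ.ι_mul, hY.parity_leftOp hX, h ()]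

/-- `L v` is left multiplication by `v ⊗ 1 ⊗ 1 + 1 ⊗ v ⊗ 1 + 1 ⊗ 1 ⊗ v` on the triple tensor
product. Both `Δ ⊗ id` and `id ⊗ Δ` intertwine `leftOp Y v` with it, so both iterated coproducts
satisfy the same recursion. -/
theorem coassoc (x : MaxExterior ϖ) :
    TensorProduct.assoc k _ _ _ (Δ.rTensor (MaxExterior ϖ) (Δ x)) =
      Δ.lTensor (MaxExterior ϖ) (Δ x) := by
  let L (v : V) : MaxExterior ϖ ⊗[k] (MaxExterior ϖ ⊗[k] MaxExterior ϖ) →ₗ[k]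
      MaxExterior ϖ ⊗[k] (MaxExterior ϖ ⊗[k] MaxExterior ϖ) :=
    Lin.toMap (fun t => sw t (fun y s => (ι ϖ v * y) ⊗ₜ[k] s + sw (Y.coact (P y)) (fun y₀ y₁ =>
      y₀ ⊗ₜ[k] leftOp Y (X.act v y₁) s))) (by fun_prop)
  have hL (v : V) (y : MaxExterior ϖ) (s : MaxExterior ϖ ⊗[k] MaxExterior ϖ) : L v (y ⊗ₜ s) =
      (ι ϖ v * y) ⊗ₜ[k] s + sw (Y.coact (P y)) (fun y₀ y₁ =>
      y₀ ⊗ₜ[k] leftOp Y (X.act v y₁) s) := by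
    simp (disch := fun_prop) only [L, Lin.toMap_apply, sw_tmul]
  refine lin_ext (J := Unit)
    (f := fun _ x => TensorProduct.assoc k _ _ _ (Δ.rTensor (MaxExterior ϖ) (Δ x)))
    (g := fun _ x => Δ.lTensor (MaxExterior ϖ) (Δ x))
    (fun _ => by fun_prop) (fun _ => by fun_prop) (fun _ => ?_) (fun v x h _ => ?_) () x
  · simp [hΔ.one]
  · have h₁ : Δ.lTensor (MaxExterior ϖ) ∘ₗ leftOp Y v = L v ∘ₗ Δ.lTensor (MaxExterior ϖ) := by
      refine TensorProduct.ext' fun y z => ?_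
      simp only [LinearMap.comp_apply, LinearMap.lTensor_tmul, hL, leftOp_tmul, map_add, map_sw,
        hY.act_ι, hΔ.ι_mul]
    -- Here `v` slides past `y` before `y` is split, so the coproduct must commute with the coaction
    -- and with the parity.
    have h₂ : ((TensorProduct.assoc k _ _ _).toLinearMap ∘ₗ Δ.rTensor (MaxExterior ϖ)) ∘ₗ
        leftOp Y v = L v ∘ₗ (TensorProduct.assoc k _ _ _).toLinearMap ∘ₗ
          Δ.rTensor (MaxExterior ϖ) := by
      refine TensorProduct.ext' fun y z => ?_
      simp only [LinearMap.comp_apply, LinearMap.rTensor_tmul, leftOp_tmul, map_add, map_sw,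
        LinearEquiv.coe_coe, hΔ.ι_mul, hY.act_ι]
      have h₃ (s w) : TensorProduct.assoc k (MaxExterior ϖ) (MaxExterior ϖ) (MaxExterior ϖ)
          (s ⊗ₜ w) = sw s (fun p q => p ⊗ₜ[k] (q ⊗ₜ[k] w)) := by
        conv_lhs => rw [← sw_tmul_self s]
        simp only [sw_tmul_const, map_sw_equiv, TensorProduct.assoc_tmul]
      simp only [h₃]
      rw [hΔ.sw_comul_coact hY hX (fun p q c => p ⊗ₜ[k] (q ⊗ₜ[k] (ι ϖ (X.act v c) * z)))
        (by fun_prop) (by fun_prop) (by fun_prop), hΔ.comul_parity hY hX]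
      simp (disch := fun_prop) only [leftOp_apply, sw_add, sw_sw, sw_tmul, map_sw, sw_map,
        hL, hY.act_ι, hX.act_mul, TensorProduct.tmul_add, sw_fun_add, tmul_sw,
        add_assoc]
    rw [hΔ.ι_mul]
    have h₃ := LinearMap.congr_fun h₁ (Δ x)
    have h₄ := LinearMap.congr_fun h₂ (Δ x)
    simp only [LinearMap.comp_apply, LinearEquiv.coe_coe] at h₃ h₄
    rw [h₃, h₄, h ()]

end IsComul

/-! ### Multiplicativity of the braided coproduct -/

section SuperBraidedSquare

variable (Y) in
/-- The super-braiding `x ⊗ y ↦ (-1)^{|x||y|} Ψ(x ⊗ y)`. -/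
def superBraiding : MaxExterior ϖ ⊗[k] MaxExterior ϖ →ₗ[k] MaxExterior ϖ ⊗[k] MaxExterior ϖ :=
  Y.braiding Y ∘ₗ koszul (deg ϖ)

variable (hY : Extends X Y) (hX : X.IsCrossedModule)
include hY hX

theorem superBraiding_one_tmul (y : MaxExterior ϖ) : superBraiding Y (1 ⊗ₜ y) = y ⊗ₜ 1 := by
  rw [superBraiding, LinearMap.comp_apply, koszul_one_tmul, ActCoact.braiding_tmul]
  simp only [hY.one_act, TensorProduct.tmul_smul]
  rw [(hY.isCrossedModule hX).sw_counit (fun y => y ⊗ₜ[k] (1 : MaxExterior ϖ)) (by fun_prop)]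

/-- A hexagon identity: to braid `v x` past `y`, braid `x` first and then `v`; braiding `v`, with
its sign, is the sliding operator. -/
theorem superBraiding_ι_mul_tmul (v : V) (x y : MaxExterior ϖ) :
    superBraiding Y ((ι ϖ v * x) ⊗ₜ y) = slide Y (Y.act (ι ϖ v)) (superBraiding Y (x ⊗ₜ y)) := by
  rw [superBraiding, LinearMap.comp_apply, koszul_mul_of_mem_one _ (ι_mem_deg v),
    LinearMap.comp_apply]
  suffices h : Y.braiding Y ∘ₗ TensorProduct.map (LinearMap.mulLeft k (ι ϖ v)) P =
      slide Y (Y.act (ι ϖ v)) ∘ₗ Y.braiding Y from LinearMap.congr_fun h _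
  refine TensorProduct.ext' fun y z => ?_
  simp (disch := fun_prop) only [LinearMap.comp_apply, TensorProduct.map_tmul, ActCoact.braiding_tmul,
    slide_apply, sw_sw, sw_tmul, hY.sw_coact_parity, LinearMap.mulLeft_apply, hY.mul_act, hY.act_ι, tmul_sw]
  exact ((hY.isCrossedModule hX).sw_coassoc (fun z₀ b c => P z₀ ⊗ₜ[k] (ι ϖ (X.act v b) * Y.act y c))
    (by fun_prop) (by fun_prop) (by fun_prop) z).symm

variable (Y) in
/-- The product of the super-braided tensor square. -/
def superMul : MaxExterior ϖ ⊗[k] MaxExterior ϖ →ₗ[k] MaxExterior ϖ ⊗[k] MaxExterior ϖ →ₗ[k]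
    MaxExterior ϖ ⊗[k] MaxExterior ϖ :=
  TensorProduct.curry (TensorProduct.map (LinearMap.mul' k _) (LinearMap.mul' k _) ∘ₗ
    middle (superBraiding Y))

omit hY hX in
theorem superMul_tmul (p q r z : MaxExterior ϖ) : superMul Y (p ⊗ₜ q) (r ⊗ₜ z) =
    sw (superBraiding Y (q ⊗ₜ r)) (fun r' q' => (p * r') ⊗ₜ[k] (q' * z)) := by
  change TensorProduct.map _ _ (middle _ ((p ⊗ₜ q) ⊗ₜ (r ⊗ₜ z))) = _
  rw [middle_tmul, map_sw]
  rfl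

/-- Associativity of the super-braided square when the left factor is `v ⊗ 1 + 1 ⊗ v`. It is the
only case that the induction for multiplicativity uses. -/
theorem superMul_leftOp (v : V) (s t : MaxExterior ϖ ⊗[k] MaxExterior ϖ) :
    superMul Y (leftOp Y v s) t = leftOp Y v (superMul Y s t) := by
  suffices h : superMul Y ∘ₗ leftOp Y v = (superMul Y).compr₂ (leftOp Y v) from
    LinearMap.congr_fun (LinearMap.congr_fun h s) t
  refine TensorProduct.ext' fun p q => TensorProduct.ext' fun r z => ?_
  simp only [LinearMap.comp_apply, LinearMap.compr₂_apply]
  rw [leftOp_tmul]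
  simp only [map_add, LinearMap.add_apply, map_sw, sw_apply_const, superMul_tmul]
  simp (disch := fun_prop) only [leftOp_tmul, sw_fun_add, mul_assoc, hY.act_ι, parity_mul,
    hY.sw_coact_mul, hX.act_mul]
  congr 1
  rw [sw_comm]
  refine sw_congr _ fun p₀ p₁ => ?_
  rw [superBraiding_ι_mul_tmul hY hX, slide_apply]
  simp (disch := fun_prop) only [sw_sw, sw_tmul, hY.act_ι, mul_assoc]

theorem superMul_one (t : MaxExterior ϖ ⊗[k] MaxExterior ϖ) : superMul Y (1 ⊗ₜ 1) t = t := by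
  suffices h : superMul Y (1 ⊗ₜ 1) = LinearMap.id from LinearMap.congr_fun h t
  refine TensorProduct.ext' fun y z => ?_
  rw [superMul_tmul, superBraiding_one_tmul hY hX]
  simp (disch := fun_prop) only [sw_tmul, one_mul, LinearMap.id_apply]

end SuperBraidedSquare

theorem IsComul.comul_mul {Δ : MaxExterior ϖ →ₗ[k] MaxExterior ϖ ⊗[k] MaxExterior ϖ}
    (hΔ : IsComul Y Δ) (hY : Extends X Y) (hX : X.IsCrossedModule) (x y : MaxExterior ϖ) :
    Δ (x * y) = superMul Y (Δ x) (Δ y) := by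
  refine lin_ext (f := fun y x => Δ (x * y)) (g := fun y x => superMul Y (Δ x) (Δ y))
    (fun _ => by fun_prop) (fun _ => by fun_prop) (fun y => ?_) (fun v x h y => ?_) y x
  · rw [one_mul, hΔ.one, superMul_one hY hX]
  · rw [mul_assoc, hΔ.ι_mul, hΔ.ι_mul, superMul_leftOp hY hX, h]

end MaxExterior

/-! ### The antipode of a connected graded bialgebra -/

namespace ActCoact.IsHom

variable {k A U V W Z : Type*} [Field k] [Ring A] [HopfAlgebra k A]
  [AddCommGroup U] [Module k U] [AddCommGroup V] [Module k V] [AddCommGroup W] [Module k W]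
  [AddCommGroup Z] [Module k Z] {X : ActCoact k A U} {Y : ActCoact k A V} {R : ActCoact k A W}
  {Q : ActCoact k A Z}

theorem id : X.IsHom X LinearMap.id := ⟨fun _ _ => rfl, fun _ => by simp⟩

theorem comp {g : V →ₗ[k] W} {f : U →ₗ[k] V} (hg : Y.IsHom R g) (hf : X.IsHom Y f) :
    X.IsHom R (g ∘ₗ f) :=
  ⟨fun v a => by simp [hf.map_act, hg.map_act],
    fun v => by simp [hf.map_coact, hg.map_coact, LinearMap.rTensor_comp]⟩

theorem sub {f g : U →ₗ[k] V} (hf : X.IsHom Y f) (hg : X.IsHom Y g) : X.IsHom Y (f - g) :=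
  ⟨fun v a => by simp [hf.map_act, hg.map_act],
    fun v => by simp [hf.map_coact, hg.map_coact, LinearMap.rTensor_sub]⟩

theorem add {f g : U →ₗ[k] V} (hf : X.IsHom Y f) (hg : X.IsHom Y g) : X.IsHom Y (f + g) :=
  ⟨fun v a => by simp [hf.map_act, hg.map_act],
    fun v => by simp [hf.map_coact, hg.map_coact, LinearMap.rTensor_add]⟩

theorem smul (c : k) {f : U →ₗ[k] V} (hf : X.IsHom Y f) : X.IsHom Y (c • f) :=
  ⟨fun v a => by simp [hf.map_act],
    fun v => by simp [hf.map_coact, LinearMap.rTensor_smul]⟩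

theorem zero : X.IsHom Y 0 := ⟨fun v a => by simp, fun v => by simp⟩

theorem tensorMap {f : U →ₗ[k] V} {g : W →ₗ[k] Z} (hf : X.IsHom Y f) (hg : R.IsHom Q g) :
    (X.tensor R).IsHom (Y.tensor Q) (TensorProduct.map f g) := by
  refine ⟨fun t a => ?_, fun t => ?_⟩
  · simp (disch := fun_prop) only [tensor_act, map_sw, sw_map, TensorProduct.map_tmul, hf.map_act,
      hg.map_act]
  · refine (tensor_coact_eq _ _ _).trans (Eq.trans ?_
      (congrArg ((TensorProduct.map f g).rTensor A) (tensor_coact_eq _ _ _).symm))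
    simp (disch := fun_prop) only [tensorCoact, Lin.toMap_apply, map_sw, sw_map, hf.map_coact,
      hg.map_coact, sw_rTensor, LinearMap.rTensor_tmul, TensorProduct.map_tmul]

end ActCoact.IsHom

section ConnectedAntipode

variable {k Λ : Type*} [Field k] [Ring Λ] [Algebra k Λ]

/-- The convolution product of linear maps. -/
def conv (Δ : Λ →ₗ[k] Λ ⊗[k] Λ) (f g : Λ →ₗ[k] Λ) : Λ →ₗ[k] Λ :=
  LinearMap.mul' k Λ ∘ₗ TensorProduct.map f g ∘ₗ Δ

theorem conv_apply (Δ : Λ →ₗ[k] Λ ⊗[k] Λ) (f g : Λ →ₗ[k] Λ) (x : Λ) :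
    conv Δ f g x = sw (Δ x) (fun p q => f p * g q) := by
  simp only [conv, LinearMap.comp_apply, map_eq_sw, map_sw, LinearMap.mul'_apply]

theorem conv_assoc {Δ : Λ →ₗ[k] Λ ⊗[k] Λ}
    (h : ∀ x, TensorProduct.assoc k Λ Λ Λ (Δ.rTensor Λ (Δ x)) = Δ.lTensor Λ (Δ x))
    (f g l : Λ →ₗ[k] Λ) : conv Δ (conv Δ f g) l = conv Δ f (conv Δ g l) := by
  refine LinearMap.ext fun x => ?_
  have h₁ := sw_assoc (Δ.rTensor Λ (Δ x)) (fun p q r => f p * (g q * l r)) (by fun_prop)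
    (by fun_prop) (by fun_prop)
  rw [h x] at h₁
  simp (disch := fun_prop) only [sw_rTensor, sw_lTensor] at h₁
  simpa only [conv_apply, sw_mul, mul_sw, mul_assoc] using h₁

/-- `id - η ε`. -/
def reducedId (e : Λ →ₗ[k] k) : Λ →ₗ[k] Λ := LinearMap.id - Algebra.linearMap k Λ ∘ₗ e

/-- The convolution powers of `id - η ε`. -/
def convPow (Δ : Λ →ₗ[k] Λ ⊗[k] Λ) (e : Λ →ₗ[k] k) : ℕ → Λ →ₗ[k] Λ
  | 0 => Algebra.linearMap k Λ ∘ₗ e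
  | n + 1 => conv Δ (reducedId e) (convPow Δ e n)

/-- The partial sums of the convolution inverse of `id`. -/
def convSum (Δ : Λ →ₗ[k] Λ ⊗[k] Λ) (e : Λ →ₗ[k] k) : ℕ → Λ →ₗ[k] Λ
  | 0 => 0
  | n + 1 => convSum Δ e n + (-1 : k) ^ n • convPow Δ e n

variable {Δ : Λ →ₗ[k] Λ ⊗[k] Λ} {e : Λ →ₗ[k] k}

theorem conv_counit_left (h : ∀ x, TensorProduct.lid k Λ (e.rTensor Λ (Δ x)) = x)
    (f : Λ →ₗ[k] Λ) : conv Δ (Algebra.linearMap k Λ ∘ₗ e) f = f := by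
  refine LinearMap.ext fun x => ?_
  conv_rhs => rw [← h x]
  simp only [conv_apply, rTensor_eq_sw, map_sw_equiv, map_sw, TensorProduct.lid_tmul, map_smul]
  refine sw_congr _ fun p q => ?_
  simp [Algebra.smul_def]

theorem conv_counit_right (h : ∀ x, TensorProduct.rid k Λ (e.lTensor Λ (Δ x)) = x)
    (f : Λ →ₗ[k] Λ) : conv Δ f (Algebra.linearMap k Λ ∘ₗ e) = f := by
  refine LinearMap.ext fun x => ?_
  conv_rhs => rw [← h x]
  simp only [conv_apply, lTensor_eq_sw, map_sw_equiv, map_sw, TensorProduct.rid_tmul, map_smul]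
  refine sw_congr _ fun p q => ?_
  simp [Algebra.smul_def, Algebra.commutes]

theorem conv_add_left (f g l : Λ →ₗ[k] Λ) : conv Δ (f + g) l = conv Δ f l + conv Δ g l := by
  simp only [conv, TensorProduct.map_add_left, LinearMap.add_comp, LinearMap.comp_add]

theorem conv_add_right (f g l : Λ →ₗ[k] Λ) : conv Δ f (g + l) = conv Δ f g + conv Δ f l := by
  simp only [conv, TensorProduct.map_add_right, LinearMap.add_comp, LinearMap.comp_add]

theorem conv_smul_left (c : k) (f g : Λ →ₗ[k] Λ) : conv Δ (c • f) g = c • conv Δ f g := by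
  simp only [conv, TensorProduct.map_smul_left, LinearMap.smul_comp, LinearMap.comp_smul]

theorem conv_smul_right (c : k) (f g : Λ →ₗ[k] Λ) : conv Δ f (c • g) = c • conv Δ f g := by
  simp only [conv, TensorProduct.map_smul_right, LinearMap.smul_comp, LinearMap.comp_smul]

theorem conv_zero_left (f : Λ →ₗ[k] Λ) : conv Δ 0 f = 0 := by
  simp [conv]

theorem conv_zero_right (f : Λ →ₗ[k] Λ) : conv Δ f 0 = 0 := by
  simp [conv]

theorem id_eq_reducedId_add (e : Λ →ₗ[k] k) :
    LinearMap.id = reducedId e + Algebra.linearMap k Λ ∘ₗ e := by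
  rw [reducedId, sub_add_cancel]

/-- The powers are defined by multiplying on the left; this is what lets the same series be a left
inverse as well. -/
theorem convPow_succ' (hco : ∀ x, TensorProduct.assoc k Λ Λ Λ (Δ.rTensor Λ (Δ x)) =
      Δ.lTensor Λ (Δ x)) (hl : ∀ x, TensorProduct.lid k Λ (e.rTensor Λ (Δ x)) = x)
    (hr : ∀ x, TensorProduct.rid k Λ (e.lTensor Λ (Δ x)) = x) (n : ℕ) :
    convPow Δ e (n + 1) = conv Δ (convPow Δ e n) (reducedId e) := by
  induction n with
  | zero => exact (conv_counit_right hr _).trans (conv_counit_left hl _).symm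
  | succ n ih =>
    conv_lhs => rw [convPow, ih]
    rw [← conv_assoc hco]
    rfl

/-- Telescoping of the geometric series: `id = r + η ε` with `r = id - η ε`, and `η ε` is the
convolution unit. -/
theorem conv_id_convSum (hl : ∀ x, TensorProduct.lid k Λ (e.rTensor Λ (Δ x)) = x) (n : ℕ) :
    conv Δ LinearMap.id (convSum Δ e n) =
      Algebra.linearMap k Λ ∘ₗ e - (-1 : k) ^ n • convPow Δ e n := by
  induction n with
  | zero => simp [convSum, conv_zero_right, convPow]
  | succ n ih =>
    have h₁ : conv Δ LinearMap.id (convPow Δ e n) = convPow Δ e (n + 1) + convPow Δ e n := by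
      rw [id_eq_reducedId_add e, conv_add_left, conv_counit_left hl]
      rfl
    rw [convSum, conv_add_right, ih, conv_smul_right, h₁, pow_succ]
    module

theorem conv_convSum_id (hco : ∀ x, TensorProduct.assoc k Λ Λ Λ (Δ.rTensor Λ (Δ x)) =
      Δ.lTensor Λ (Δ x)) (hl : ∀ x, TensorProduct.lid k Λ (e.rTensor Λ (Δ x)) = x)
    (hr : ∀ x, TensorProduct.rid k Λ (e.lTensor Λ (Δ x)) = x) (n : ℕ) :
    conv Δ (convSum Δ e n) LinearMap.id =
      Algebra.linearMap k Λ ∘ₗ e - (-1 : k) ^ n • convPow Δ e n := by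
  induction n with
  | zero => simp [convSum, conv_zero_left, convPow]
  | succ n ih =>
    have h₁ : conv Δ (convPow Δ e n) LinearMap.id = convPow Δ e (n + 1) + convPow Δ e n := by
      rw [id_eq_reducedId_add e, conv_add_right, conv_counit_right hr, convPow_succ' hco hl hr]
    rw [convSum, conv_add_left, ih, conv_smul_left, h₁, pow_succ]
    module

variable (𝒜 : ℕ → Submodule k Λ) [GradedAlgebra 𝒜]

theorem conv_deg (hdeg : ∀ n, ∀ x ∈ 𝒜 n, Δ x ∈ tensorDeg 𝒜 n) {f g : Λ →ₗ[k] Λ}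
    (hf : ∀ n, ∀ x ∈ 𝒜 n, f x ∈ 𝒜 n) (hg : ∀ n, ∀ x ∈ 𝒜 n, g x ∈ 𝒜 n) (n : ℕ) (x : Λ)
    (hx : x ∈ 𝒜 n) : conv Δ f g x ∈ 𝒜 n := by
  refine tensorDeg_induction 𝒜 (f := fun t => LinearMap.mul' k Λ (TensorProduct.map f g t))
    (by fun_prop) (fun i j h x hx y hy => ?_) (hdeg n x hx)
  rw [TensorProduct.map_tmul, LinearMap.mul'_apply, ← h]
  exact SetLike.GradedMul.mul_mem (hf i x hx) (hg j y hy)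

theorem counit_linearMap_deg (he : ∀ n, n ≠ 0 → ∀ x ∈ 𝒜 n, e x = 0) (n : ℕ) (x : Λ)
    (hx : x ∈ 𝒜 n) : (Algebra.linearMap k Λ ∘ₗ e) x ∈ 𝒜 n := by
  rcases eq_or_ne n 0 with rfl | hn
  · exact SetLike.algebraMap_mem_graded 𝒜 _
  · rw [LinearMap.comp_apply, he n hn x hx, map_zero]
    exact zero_mem _

theorem convPow_deg (hdeg : ∀ n, ∀ x ∈ 𝒜 n, Δ x ∈ tensorDeg 𝒜 n)
    (he : ∀ n, n ≠ 0 → ∀ x ∈ 𝒜 n, e x = 0) (m n : ℕ) (x : Λ)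
    (hx : x ∈ 𝒜 n) : convPow Δ e m x ∈ 𝒜 n := by
  induction m generalizing n x with
  | zero => exact counit_linearMap_deg 𝒜 he n x hx
  | succ m ih =>
    exact conv_deg 𝒜 hdeg (fun n x hx => sub_mem hx (counit_linearMap_deg 𝒜 he n x hx)) ih n x hx

/-- By `h₀` the map `id - η ε` kills degree zero, so each factor of the power uses up at least one
degree, and more than `n` factors cannot share degree `n`. -/
theorem convPow_eq_zero (hdeg : ∀ n, ∀ x ∈ 𝒜 n, Δ x ∈ tensorDeg 𝒜 n)
    (h₀ : ∀ x ∈ 𝒜 0, algebraMap k Λ (e x) = x)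
    {m n : ℕ} {x : Λ} (hx : x ∈ 𝒜 n) (h : n < m) : convPow Δ e m x = 0 := by
  induction m generalizing n x with
  | zero => omega
  | succ m ih =>
    refine tensorDeg_induction 𝒜 (N := ⊥) (f := fun t => LinearMap.mul' k Λ
      (TensorProduct.map (reducedId e) (convPow Δ e m) t))
      (by fun_prop) (fun i j hij x hx y hy => ?_) (hdeg n x hx)
    rw [TensorProduct.map_tmul, LinearMap.mul'_apply, Submodule.mem_bot]
    rcases eq_or_ne i 0 with rfl | hi
    · simp [reducedId, h₀ x hx]
    · rw [ih hy (by omega), mul_zero]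

theorem convSum_eq (hdeg : ∀ n, ∀ x ∈ 𝒜 n, Δ x ∈ tensorDeg 𝒜 n)
    (h₀ : ∀ x ∈ 𝒜 0, algebraMap k Λ (e x) = x)
    {m n : ℕ} {x : Λ} (hx : x ∈ 𝒜 n) (h : n < m) : convSum Δ e m x = convSum Δ e (n + 1) x := by
  induction m, h using Nat.le_induction with
  | base => rfl
  | succ m hm ih =>
    rw [convSum, LinearMap.add_apply, LinearMap.smul_apply,
      convPow_eq_zero 𝒜 hdeg h₀ hx hm, smul_zero, add_zero, ih]

/-- The convolution inverse of `id` on a connected graded bialgebra. -/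
def connectedAntipode (Δ : Λ →ₗ[k] Λ ⊗[k] Λ) (e : Λ →ₗ[k] k) : Λ →ₗ[k] Λ :=
  gradedMap 𝒜 (fun n => convSum Δ e (n + 1))

theorem connectedAntipode_of_mem (hdeg : ∀ n, ∀ x ∈ 𝒜 n, Δ x ∈ tensorDeg 𝒜 n)
    (h₀ : ∀ x ∈ 𝒜 0, algebraMap k Λ (e x) = x)
    {m n : ℕ} {x : Λ} (hx : x ∈ 𝒜 n) (h : n < m) :
    connectedAntipode 𝒜 Δ e x = convSum Δ e m x := by
  rw [connectedAntipode, gradedMap_of_mem 𝒜 _ hx, convSum_eq 𝒜 hdeg h₀ hx h]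

theorem connectedAntipode_deg (hdeg : ∀ n, ∀ x ∈ 𝒜 n, Δ x ∈ tensorDeg 𝒜 n)
    (he : ∀ n, n ≠ 0 → ∀ x ∈ 𝒜 n, e x = 0) (n : ℕ) (x : Λ) (hx : x ∈ 𝒜 n) :
    connectedAntipode 𝒜 Δ e x ∈ 𝒜 n := by
  rw [connectedAntipode, gradedMap_of_mem 𝒜 _ hx]
  generalize n + 1 = m
  induction m with
  | zero => exact zero_mem _
  | succ m ih => exact add_mem ih (Submodule.smul_mem _ _ (convPow_deg 𝒜 hdeg he m n x hx))

theorem conv_id_connectedAntipode (hdeg : ∀ n, ∀ x ∈ 𝒜 n, Δ x ∈ tensorDeg 𝒜 n)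
    (h₀ : ∀ x ∈ 𝒜 0, algebraMap k Λ (e x) = x)
    (hl : ∀ x, TensorProduct.lid k Λ (e.rTensor Λ (Δ x)) = x) (x : Λ) :
    conv Δ LinearMap.id (connectedAntipode 𝒜 Δ e) x = algebraMap k Λ (e x) := by
  refine graded_lin_ext 𝒜 (f := fun x => conv Δ LinearMap.id (connectedAntipode 𝒜 Δ e) x)
    (g := fun x => algebraMap k Λ (e x)) (by fun_prop) (by fun_prop) (fun n x hx => ?_) x
  -- Each right leg of `Δ x` has degree at most `n`, where the antipode agrees with the partial sum
  -- of the powers `0, …, n`.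
  have h₁ : conv Δ LinearMap.id (connectedAntipode 𝒜 Δ e) x =
      conv Δ LinearMap.id (convSum Δ e (n + 1)) x := by
    refine sub_eq_zero.1 (tensorDeg_induction 𝒜 (N := ⊥) (f := fun t => LinearMap.mul' k Λ
      (TensorProduct.map LinearMap.id (connectedAntipode 𝒜 Δ e) t) - LinearMap.mul' k Λ
      (TensorProduct.map LinearMap.id (convSum Δ e (n + 1)) t))
      (by fun_prop) (fun i j hij x hx y hy => ?_) (hdeg n x hx))
    simp [connectedAntipode_of_mem 𝒜 hdeg h₀ hy (show j < n + 1 by omega)]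
  rw [h₁, conv_id_convSum hl, LinearMap.sub_apply, LinearMap.smul_apply,
    convPow_eq_zero 𝒜 hdeg h₀ hx (Nat.lt_succ_self n), smul_zero, sub_zero]
  rfl

theorem conv_connectedAntipode_id (hdeg : ∀ n, ∀ x ∈ 𝒜 n, Δ x ∈ tensorDeg 𝒜 n)
    (h₀ : ∀ x ∈ 𝒜 0, algebraMap k Λ (e x) = x)
    (hco : ∀ x, TensorProduct.assoc k Λ Λ Λ (Δ.rTensor Λ (Δ x)) = Δ.lTensor Λ (Δ x))
    (hl : ∀ x, TensorProduct.lid k Λ (e.rTensor Λ (Δ x)) = x)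
    (hr : ∀ x, TensorProduct.rid k Λ (e.lTensor Λ (Δ x)) = x) (x : Λ) :
    conv Δ (connectedAntipode 𝒜 Δ e) LinearMap.id x = algebraMap k Λ (e x) := by
  refine graded_lin_ext 𝒜 (f := fun x => conv Δ (connectedAntipode 𝒜 Δ e) LinearMap.id x)
    (g := fun x => algebraMap k Λ (e x)) (by fun_prop) (by fun_prop) (fun n x hx => ?_) x
  have h₁ : conv Δ (connectedAntipode 𝒜 Δ e) LinearMap.id x =
      conv Δ (convSum Δ e (n + 1)) LinearMap.id x := by
    refine sub_eq_zero.1 (tensorDeg_induction 𝒜 (N := ⊥) (f := fun t => LinearMap.mul' k Λ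
      (TensorProduct.map (connectedAntipode 𝒜 Δ e) LinearMap.id t) - LinearMap.mul' k Λ
      (TensorProduct.map (convSum Δ e (n + 1)) LinearMap.id t))
      (by fun_prop) (fun i j hij x hx y hy => ?_) (hdeg n x hx))
    simp [connectedAntipode_of_mem 𝒜 hdeg h₀ hx (show i < n + 1 by omega)]
  rw [h₁, conv_convSum_id hco hl hr, LinearMap.sub_apply, LinearMap.smul_apply,
    convPow_eq_zero 𝒜 hdeg h₀ hx (Nat.lt_succ_self n), smul_zero, sub_zero]
  rfl

variable {A : Type*} [Ring A] [HopfAlgebra k A]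

/-- Convolution powers of morphisms are morphisms, and in each degree the antipode is a finite
linear combination of them; action and coaction preserve degree, so one combination serves on both
sides. -/
theorem connectedAntipode_isHom {Y : ActCoact k A Λ}
    (hdeg : ∀ n, ∀ x ∈ 𝒜 n, Δ x ∈ tensorDeg 𝒜 n)
    (h₀ : ∀ x ∈ 𝒜 0, algebraMap k Λ (e x) = x)
    (hact : ∀ n, ∀ x ∈ 𝒜 n, ∀ a, Y.act x a ∈ 𝒜 n)
    (hcoact : ∀ n, ∀ x ∈ 𝒜 n, Y.coact x ∈ LinearMap.range ((𝒜 n).subtype.rTensor A))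
    (hmul : (Y.tensor Y).IsHom Y (LinearMap.mul' k Λ))
    (hone : (ActCoact.unitObject k A).IsHom Y (Algebra.linearMap k Λ))
    (hΔ : Y.IsHom (Y.tensor Y) Δ) (hc : Y.IsHom (ActCoact.unitObject k A) e) :
    Y.IsHom Y (connectedAntipode 𝒜 Δ e) := by
  have h₁ (n : ℕ) : Y.IsHom Y (convPow Δ e n) := by
    induction n with
    | zero => exact hone.comp hc
    | succ n ih => exact hmul.comp (((ActCoact.IsHom.id.sub (hone.comp hc)).tensorMap ih).comp hΔ)
  have h₂ (n : ℕ) : Y.IsHom Y (convSum Δ e n) := by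
    induction n with
    | zero => exact .zero
    | succ n ih => exact ih.add ((h₁ n).smul _)
  refine ⟨fun x a => ?_, fun x => ?_⟩
  · refine graded_lin_ext 𝒜 (f := fun x => connectedAntipode 𝒜 Δ e (Y.act x a))
      (g := fun x => Y.act (connectedAntipode 𝒜 Δ e x) a) (by fun_prop) (by fun_prop)
      (fun n x hx => ?_) x
    rw [connectedAntipode_of_mem 𝒜 hdeg h₀ (hact n x hx a) (Nat.lt_succ_self n),
      connectedAntipode_of_mem 𝒜 hdeg h₀ hx (Nat.lt_succ_self n), (h₂ _).map_act]
  · refine graded_lin_ext 𝒜 (f := fun x => Y.coact (connectedAntipode 𝒜 Δ e x))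
      (g := fun x => (connectedAntipode 𝒜 Δ e).rTensor A (Y.coact x)) (by fun_prop) (by fun_prop)
      (fun n x hx => ?_) x
    rw [connectedAntipode_of_mem 𝒜 hdeg h₀ hx (Nat.lt_succ_self n), (h₂ _).map_coact]
    obtain ⟨t, ht⟩ := hcoact n x hx
    rw [← ht, ← LinearMap.comp_apply, ← LinearMap.comp_apply, ← LinearMap.rTensor_comp,
      ← LinearMap.rTensor_comp]
    congr 2
    ext y
    exact (connectedAntipode_of_mem 𝒜 hdeg h₀ y.2 (Nat.lt_succ_self n)).symm

end ConnectedAntipode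

/-! ### The super-braided Hopf algebra `Λ_max` -/

namespace MaxExterior

variable {k A V : Type*} [Field k] [Ring A] [HopfAlgebra k A]
  [AddCommGroup V] [Module k V] {ϖ : APlus k A →ₗ[k] V}
  {X : ActCoact k A V} {Y : ActCoact k A (MaxExterior ϖ)}
  {Δ : MaxExterior ϖ →ₗ[k] MaxExterior ϖ ⊗[k] MaxExterior ϖ}

theorem algebraMap_counitHom {x : MaxExterior ϖ} (hx : x ∈ deg ϖ 0) :
    algebraMap k _ (counitHom x) = x := by
  rw [deg, pow_zero] at hx
  obtain ⟨c, rfl⟩ := Submodule.mem_one.1 hx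
  rw [AlgHom.commutes]
  rfl

/-- The super-braided Hopf algebra structure of `Λ_max`. -/
def hopf (hΔ : IsComul Y Δ) (hY : Extends X Y) (hX : X.IsCrossedModule) :
    SuperBraidedHopf k A (deg ϖ) where
  toActCoact := Y
  comul := Δ
  counit := counitHom.toLinearMap
  antipode := connectedAntipode (deg ϖ) Δ counitHom.toLinearMap
  isCrossedModule := hY.isCrossedModule hX
  mul_hom := hY.mul_isHom
  one_hom := hY.one_isHom
  comul_hom := hΔ.comul_isHom hY hX
  counit_hom := hY.counit_isHom
  antipode_hom := connectedAntipode_isHom _ (fun _ _ => hΔ.comul_deg hY hX)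
    (fun _ => algebraMap_counitHom) (fun _ _ h _ => hY.act_deg h _)
    (fun _ _ => hY.coact_deg) hY.mul_isHom hY.one_isHom (hΔ.comul_isHom hY hX) hY.counit_isHom
  act_deg _ _ h _ := hY.act_deg h _
  coact_deg _ _ := hY.coact_deg
  comul_deg _ _ := hΔ.comul_deg hY hX
  counit_deg _ h _ := counitHom_of_mem h
  antipode_deg := connectedAntipode_deg _ (fun _ _ => hΔ.comul_deg hY hX)
    (fun _ h _ => counitHom_of_mem h)
  coassoc := hΔ.coassoc hY hX
  counit_comul := hΔ.counit_comul hY hX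
  comul_counit := hΔ.comul_counit hY hX
  comul_one := hΔ.one
  counit_one := map_one counitHom
  counit_mul := map_mul counitHom
  comul_mul := hΔ.comul_mul hY hX
  antipode_left := conv_connectedAntipode_id _ (fun _ _ => hΔ.comul_deg hY hX)
    (fun _ => algebraMap_counitHom) (hΔ.coassoc hY hX)
    (hΔ.counit_comul hY hX) (hΔ.comul_counit hY hX)
  antipode_right := conv_id_connectedAntipode _ (fun _ _ => hΔ.comul_deg hY hX)
    (fun _ => algebraMap_counitHom) (hΔ.counit_comul hY hX)

theorem ι_isHom_hopf (hΔ : IsComul Y Δ) (hY : Extends X Y) (hX : X.IsCrossedModule) :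
    X.IsHom (hopf hΔ hY hX).toActCoact (ι ϖ) := hY.ι_isHom

end MaxExterior

/-! ### The exterior derivative of `Λ_max` -/

namespace MaxExterior

variable {k A V M : Type*} [Field k] [Ring A] [HopfAlgebra k A] [AddCommMonoid M] [Module k M]
  [AddCommGroup V] [Module k V] {ϖ : APlus k A →ₗ[k] V}

local notation "δ" => Coalgebra.comul (R := k)
local notation "ε" => Coalgebra.counit (R := k)
local notation "S" => HopfAlgebra.antipode k
local notation "P" => parity (deg ϖ)

/-- The recursive description of the exterior derivative: `q` is the square of the Maurer-Cartan
form and `d (v x) = -q(v) x - v d x`. -/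
structure IsDeriv (q : V →ₗ[k] MaxExterior ϖ) (d : MaxExterior ϖ →ₗ[k] MaxExterior ϖ) : Prop where
  surj : Function.Surjective ϖ
  sq : ∀ a : A, sw (δ a) (fun a₁ a₂ => mcForm ϖ a₁ * mcForm ϖ a₂) = q (mcV ϖ a)
  one : d 1 = 0
  ι_mul : ∀ v x, d (ι ϖ v * x) = -(q v * x) - ι ϖ v * d x

/-- The pair `(x, d x)` is turned into `(v x, d (v x))` by an operator `T v` on `Λ × Λ`. The algebra
map extending `T` is applied to `(1, 0)`, since `d 1 = 0`, and `d x` is read off as the second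
coordinate. -/
theorem exists_isDeriv (hsurj : Function.Surjective ϖ) :
    ∃ (q : V →ₗ[k] MaxExterior ϖ) (d : MaxExterior ϖ →ₗ[k] MaxExterior ϖ), IsDeriv q d := by
  obtain ⟨q, hq⟩ := exists_mcForm_sq hsurj
  let T : V →ₗ[k] Module.End k (MaxExterior ϖ × MaxExterior ϖ) :=
    mkBilin (fun v p => (ι ϖ v * p.1, -(q v * p.1) - ι ϖ v * p.2))
      (fun p => ⟨fun v w => by simp [add_mul]; abel, fun c v => by simp [smul_sub]⟩)
      (fun v => ⟨fun v w => by simp [mul_add]; abel, fun c v => by simp [smul_sub]⟩)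
  have hT (v : V) (p) : T v p = (ι ϖ v * p.1, -(q v * p.1) - ι ϖ v * p.2) := rfl
  obtain ⟨F, hF⟩ := exists_lift (ϖ := ϖ) T (fun a ha h => by
    refine LinearMap.ext fun p => ?_
    have h₁ := sw_mcForm_mul ha h
    -- Both sides are the cube of the Maurer-Cartan form, by coassociativity; their difference is
    -- the off-diagonal entry of the relation.
    have h₂ : sw (δ a) (fun a₁ a₂ => q (mcV ϖ a₁) * mcForm ϖ a₂) =
        sw (δ a) (fun a₁ a₂ => mcForm ϖ a₁ * q (mcV ϖ a₂)) := by
      simp only [← hq, sw_mul, mul_sw]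
      rw [sw_coassoc (fun b c a₂ => mcForm ϖ b * mcForm ϖ c * mcForm ϖ a₂) (by fun_prop)
        (by fun_prop) (by fun_prop)]
      simp only [mul_assoc]
    simp only [sw_apply_const, Module.End.mul_apply, hT, ← mcForm_eq]
    have h₃ (f g : A → A → MaxExterior ϖ) (t : A ⊗[k] A) :
        sw t (fun a b => (f a b, g a b)) = (sw t f, sw t g) := by
      rw [Prod.ext_iff]
      exact ⟨map_sw (LinearMap.fst k _ _) _ _, map_sw (LinearMap.snd k _ _) _ _⟩
    rw [h₃]
    simp only [mul_sub, mul_neg, ← mul_assoc, sw_fun_sub, sw_fun_neg, ← sw_mul, h₁, h₂]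
    simp)
  refine ⟨q, LinearMap.snd k _ _ ∘ₗ LinearMap.applyₗ (1, 0) ∘ₗ F.toLinearMap, hsurj, hq, by simp,
    fun v x => ?_⟩
  have h₁ (x : MaxExterior ϖ) : (F x (1, 0)).1 = x := by
    refine lin_ext (J := Unit) (f := fun _ x => (LinearMap.fst k _ _ ∘ₗ LinearMap.applyₗ
      ((1 : MaxExterior ϖ), (0 : MaxExterior ϖ)) ∘ₗ F.toLinearMap) x) (g := fun _ x => x)
      (fun _ => by fun_prop) (fun _ => by fun_prop) (fun _ => by simp) (fun v x h _ => ?_) () x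
    have h := h ()
    simp only [LinearMap.comp_apply, AlgHom.toLinearMap_apply, LinearMap.applyₗ_apply_apply,
      LinearMap.fst_apply] at h ⊢
    rw [map_mul, Module.End.mul_apply, hF, hT, h]
  simp only [LinearMap.comp_apply, AlgHom.toLinearMap_apply, LinearMap.applyₗ_apply_apply,
    LinearMap.snd_apply, map_mul, Module.End.mul_apply, hF, hT, h₁]

namespace IsDeriv

variable {q : V →ₗ[k] MaxExterior ϖ} {d : MaxExterior ϖ →ₗ[k] MaxExterior ϖ} (hd : IsDeriv q d)
include hd

theorem d_ι (v : V) : d (ι ϖ v) = -q v := by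
  have := hd.ι_mul v 1
  rwa [mul_one, mul_one, hd.one, mul_zero, sub_zero] at this

theorem q_mem_deg (v : V) : q v ∈ deg ϖ 2 := by
  obtain ⟨a, -, rfl⟩ := exists_eq_mcV hd.surj v
  rw [← hd.sq]
  exact sw_mem _ fun a b => SetLike.GradedMul.mul_mem (mcForm_mem_deg a) (mcForm_mem_deg b)

theorem map_deg {n : ℕ} {x : MaxExterior ϖ} (hx : x ∈ deg ϖ n) : d x ∈ deg ϖ (n + 1) := by
  refine mem_of_mem_deg (J := Unit) (f := fun _ x => d x) (N := fun n => deg ϖ (n + 1))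
    (fun _ => by fun_prop) (fun _ => ?_) (fun n v x hx h _ => ?_) hx ()
  · rw [hd.one]
    exact zero_mem _
  · rw [hd.ι_mul]
    refine sub_mem (neg_mem ?_) (ι_mul_mem_deg v (h ()))
    have := SetLike.GradedMul.mul_mem (hd.q_mem_deg v) hx
    rwa [show 2 + n = n + 1 + 1 by omega] at this

theorem d_mul (x y : MaxExterior ϖ) : d (x * y) = d x * y + P x * d y := by
  refine lin_ext (J := Unit) (f := fun _ x => d (x * y)) (g := fun _ x => d x * y + P x * d y)
    (fun _ => by fun_prop) (fun _ => by fun_prop) (fun _ => ?_) (fun v x h _ => ?_) () x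
  · rw [one_mul, hd.one, parity_one, zero_mul, one_mul, zero_add]
  · have h := h ()
    rw [mul_assoc, hd.ι_mul, h, hd.ι_mul, parity_ι_mul]
    simp only [mul_add, sub_mul, neg_mul, mul_assoc]
    abel

/-- With `v = mcV a` this is `-q(mcV a₁) mcV a₂ + mcV a₁ q(mcV a₂)`, and both products are the cube
of the Maurer-Cartan form. -/
theorem d_q (v : V) : d (q v) = 0 := by
  obtain ⟨a, -, rfl⟩ := exists_eq_mcV hd.surj v
  simp only [← hd.sq, map_sw, mcForm_eq, hd.ι_mul, hd.d_ι, mul_neg, sub_neg_eq_add]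
  simp only [← mcForm_eq, sw_mul, mul_sw, sw_fun_add, sw_fun_neg]
  rw [sw_coassoc (fun b c a₂ => mcForm ϖ b * mcForm ϖ c * mcForm ϖ a₂) (by fun_prop)
        (by fun_prop) (by fun_prop)]
  simp only [mul_assoc, neg_add_cancel]

theorem sq_zero (x : MaxExterior ϖ) : d (d x) = 0 := by
  refine lin_ext (J := Unit) (f := fun _ x => d (d x)) (g := fun _ x => 0)
    (fun _ => by fun_prop) (fun _ => by fun_prop) (fun _ => ?_) (fun v x h _ => ?_) () x
  · rw [hd.one, map_zero]
  · rw [hd.ι_mul, map_sub, map_neg, hd.d_mul, hd.d_q, hd.ι_mul, h (),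
      parity_of_mem _ (hd.q_mem_deg v)]
    simp

theorem isDGA : IsDGA (deg ϖ) d :=
  ⟨fun _ _ => hd.map_deg, fun n x hx y => by
    rw [hd.d_mul, parity_of_mem _ hx, smul_mul_assoc], hd.sq_zero⟩

theorem maurerCartan : MaurerCartan ϖ d := fun a => by
  have := hd.sq a
  rw [sweedler_eq_sw, hd.d_ι, ← mcV_coe, ← hd.sq]
  exact neg_add_cancel _

theorem eq_of_maurerCartan {d' : MaxExterior ϖ →ₗ[k] MaxExterior ϖ}
    (h₁ : ∀ n, ∀ η ∈ deg ϖ n, ∀ ω, d' (η * ω) = d' η * ω + (-1 : k) ^ n • (η * d' ω))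
    (h₂ : MaurerCartan ϖ d') : d' = d := by
  refine LinearMap.ext fun x => ?_
  refine lin_ext (J := Unit) (f := fun _ x => d' x) (g := fun _ x => d x)
    (fun _ => by fun_prop) (fun _ => by fun_prop) (fun _ => ?_) (fun v x h _ => ?_) () x
  -- The Leibniz rule on `1 * 1` forces `d' 1 = 0`; no assumption on the degree of `d'` is needed.
  · have := h₁ 0 1 one_mem_deg 1
    rw [hd.one]
    simpa using this
  · obtain ⟨a, rfl⟩ := hd.surj v
    have h₃ := eq_neg_of_add_eq_zero_left ((h₂ a).trans (hd.maurerCartan a).symm |>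
      add_right_cancel |> fun h => h.trans (hd.d_ι _) |> fun h => by rw [h, neg_add_cancel] :
        d' (ι ϖ (ϖ a)) + q (ϖ a) = 0)
    rw [h₁ 1 _ (ι_mem_deg _), h₃, h (), hd.ι_mul, pow_one, neg_one_smul, neg_mul, sub_eq_add_neg]

variable {X : ActCoact k A V} {Y : ActCoact k A (MaxExterior ϖ)} (hY : Extends X Y)
  (hϖ : (augmentation k A).IsHom X ϖ)
include hY hϖ

/-- `q` is colinear because the adjoint coaction commutes with the coproduct of `A`. -/
theorem sw_coact_q (F : MaxExterior ϖ → A → M) (h₁ : ∀ y, Lin k (fun x => F x y))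
    (h₂ : ∀ x, Lin k (fun y => F x y)) (v : V) :
    sw (Y.coact (q v)) F = sw (X.coact v) (fun v₀ v₁ => F (q v₀) v₁) := by
  obtain ⟨a, -, rfl⟩ := exists_eq_mcV hd.surj v
  have h₃ := sw_coact_coact_mcV hϖ (fun v w a => F (ι ϖ v * ι ϖ w) a) (by fun_prop)
    (by fun_prop) (by fun_prop) a
  rw [← hd.sq]
  simp (disch := fun_prop) only [map_sw, mcForm_eq, sw_sw, hY.sw_coact_mul, hY.sw_coact_ι]
  rw [h₃, coact_mcV hϖ]
  simp (disch := fun_prop) only [sw_sw, sw_tmul, ← hd.sq, mcForm_eq]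
  refine sw_congr _ fun a₁ a₂ => sw_congr _ fun b c => ?_
  rw [Lin.map_sw (h₁ _)]

theorem sw_coact_d (F : MaxExterior ϖ → A → M) (h₁ : ∀ y, Lin k (fun x => F x y))
    (h₂ : ∀ x, Lin k (fun y => F x y)) (x : MaxExterior ϖ) :
    sw (Y.coact (d x)) F = sw (Y.coact x) (fun x₀ x₁ => F (d x₀) x₁) := by
  suffices h : Y.coact (d x) = d.rTensor A (Y.coact x) by rw [h, sw_rTensor _ _ _ h₁ h₂]
  refine lin_ext (J := Unit) (f := fun _ x => Y.coact (d x))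
    (g := fun _ x => d.rTensor A (Y.coact x))
    (fun _ => by fun_prop) (fun _ => by fun_prop) (fun _ => ?_) (fun v x h _ => ?_) () x
  · simp [hd.one, hY.coact_one]
  · rw [hd.ι_mul, map_sub, map_neg, hY.coact_mul, hY.coact_mul, h ()]
    simp (disch := fun_prop) only [hd.sw_coact_q hY hϖ, rTensor_eq_sw, hY.sw_coact_ι,
      hY.sw_coact_ι_mul, hd.ι_mul, sw_sw, sw_tmul, TensorProduct.sub_tmul, TensorProduct.neg_tmul,
      sw_fun_sub, sw_fun_neg]

theorem coact_d (x : MaxExterior ϖ) : Y.coact (d x) = d.rTensor A (Y.coact x) := by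
  rw [rTensor_eq_sw, ← hd.sw_coact_d hY hϖ (fun x y => x ⊗ₜ[k] y) (by fun_prop) (by fun_prop),
    sw_tmul_self]

/-- The failure of the square of the Maurer-Cartan form to commute with the action. -/
theorem q_act (v : V) (a : A) : q (X.act v a) = Y.act (q v) a +
    (sw (δ a) (fun a₁ a₂ => mcForm ϖ a₁ * ι ϖ (X.act v a₂)) +
      sw (δ a) (fun a₁ a₂ => ι ϖ (X.act v a₁) * mcForm ϖ a₂)) := by
  obtain ⟨b, -, rfl⟩ := exists_eq_mcV hd.surj v
  -- With `v = mcV b`, the square attached to `b * a` gives `q (v ◁ a)` and the square attached to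
  -- `a`; the subtracted terms, rewritten by `act_mcV`, are the two products with the Maurer-Cartan
  -- form.
  have h₁ := sw_act_act_mcV hϖ (fun v w => ι ϖ v * ι ϖ w) (by fun_prop) (by fun_prop) b a
  have h₂ : Y.act (q (mcV ϖ b)) a = sw (δ b) (fun b₁ b₂ => sw (δ a) (fun a₁ a₂ =>
      ι ϖ (X.act (mcV ϖ b₁) a₁) * ι ϖ (X.act (mcV ϖ b₂) a₂))) := by
    rw [← hd.sq, map_sw, sw_apply_const]
    simp only [hY.mul_act, mcForm_eq, hY.act_ι]
  rw [h₂, h₁]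
  simp only [act_mcV hϖ, map_sub, map_smul, ← hd.sq, mcForm_eq, mul_sub, sub_mul, sw_fun_sub,
    sw_fun_add, mul_smul_comm, smul_mul_assoc, sw_fun_smul]
  abel

/-- In the inductive step the terms `(v ◁ a₁)(mcForm a₂)(x ◁ a₃)` from `q_act` and from the
induction hypothesis cancel, which leaves the form only at the two ends. -/
theorem act_d (a : A) (x : MaxExterior ϖ) : Y.act (d x) a = d (Y.act x a) +
    (sw (δ a) (fun a₁ a₂ => mcForm ϖ a₁ * Y.act x a₂) -
      sw (δ a) (fun a₁ a₂ => Y.act (P x) a₁ * mcForm ϖ a₂)) := by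
  refine lin_ext (f := fun a x => Y.act (d x) a) (g := fun a x => d (Y.act x a) +
    (sw (δ a) (fun a₁ a₂ => mcForm ϖ a₁ * Y.act x a₂) -
      sw (δ a) (fun a₁ a₂ => Y.act (P x) a₁ * mcForm ϖ a₂)))
    (fun _ => by fun_prop) (fun _ => by fun_prop) (fun a => ?_) (fun v x h a => ?_) a x
  · simp only [hd.one, map_zero, LinearMap.zero_apply, hY.one_act, map_smul, smul_zero,
      mul_smul_comm, smul_mul_assoc, parity_one, mul_one, one_mul]
    rw [sw_counit_right (fun a => mcForm ϖ a) (by fun_prop),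
      sw_counit_left (fun a => mcForm ϖ a) (by fun_prop), sub_self, add_zero]
  · rw [hd.ι_mul, map_sub, map_neg, LinearMap.sub_apply, LinearMap.neg_apply, hY.mul_act,
      hY.ι_mul_act, hY.ι_mul_act]
    simp only [map_sw, hd.ι_mul, h, hd.q_act hY hϖ, parity_ι_mul, map_neg, LinearMap.neg_apply,
      hY.ι_mul_act, neg_mul]
    simp only [mul_add, mul_sub, add_mul, neg_add, sw_fun_sub, sw_fun_add, sw_fun_neg,
      sw_mul, mul_sw]
    rw [sw_coassoc (fun b c a₂ => mcForm ϖ b * ι ϖ (X.act v c) * Y.act x a₂) (by fun_prop)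
        (by fun_prop) (by fun_prop),
      sw_coassoc (fun b c a₂ => ι ϖ (X.act v b) * mcForm ϖ c * Y.act x a₂) (by fun_prop)
        (by fun_prop) (by fun_prop),
      sw_coassoc (fun b c a₂ => ι ϖ (X.act v b) * Y.act (P x) c * mcForm ϖ a₂) (by fun_prop)
        (by fun_prop) (by fun_prop)]
    simp only [mul_assoc]
    abel

end IsDeriv

end MaxExterior

/-! ### Compatibility of the exterior derivative with the action and the coproduct -/

namespace MaxExterior

variable {k A V M : Type*} [Field k] [Ring A] [HopfAlgebra k A] [AddCommMonoid M] [Module k M]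
  [AddCommGroup V] [Module k V] {ϖ : APlus k A →ₗ[k] V}

local notation "δ" => Coalgebra.comul (R := k)
local notation "ε" => Coalgebra.counit (R := k)
local notation "S" => HopfAlgebra.antipode k
local notation "P" => parity (deg ϖ)

namespace IsDeriv

variable {q : V →ₗ[k] MaxExterior ϖ} {d : MaxExterior ϖ →ₗ[k] MaxExterior ϖ} (hd : IsDeriv q d)
  {X : ActCoact k A V} {Y : ActCoact k A (MaxExterior ϖ)} (hY : Extends X Y)
  (hϖ : (augmentation k A).IsHom X ϖ)
include hd

theorem d_parity (x : MaxExterior ϖ) : d (P x) = -P (d x) := by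
  refine graded_lin_ext (deg ϖ) (f := fun x => d (P x)) (g := fun x => -P (d x))
    (by fun_prop) (by fun_prop) (fun n x hx => ?_) x
  rw [parity_of_mem _ hx, parity_of_mem _ (hd.map_deg hx), map_smul, pow_succ]
  module

include hY hϖ

theorem actionCompatible {H : SuperBraidedHopf k A (deg ϖ)} (hH : H.toActCoact = Y) :
    ActionCompatible H d := by
  intro n η hη a
  subst hH
  simp only [sweedler_eq_sw, LinearMap.compl₁₂_apply, LinearMap.mul_apply']
  rw [hd.act_d hY hϖ, add_sub_cancel_left, parity_of_mem _ hη]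
  simp only [map_smul, LinearMap.smul_apply, smul_mul_assoc, sw_fun_smul]

variable (Y d) in
/-- `d ⊗ id + (-1)^{| |} ⊗ d` together with the correction `slide θ`. -/
def tensorDeriv : Module.End k (MaxExterior ϖ ⊗[k] MaxExterior ϖ) :=
  d.rTensor (MaxExterior ϖ) + TensorProduct.map P d + slide Y (mcForm ϖ)

omit hd hY hϖ in
theorem tensorDeriv_tmul (y z : MaxExterior ϖ) : tensorDeriv d Y (y ⊗ₜ z) =
    d y ⊗ₜ z + P y ⊗ₜ d z + sw (Y.coact (P y)) (fun y₀ y₁ => y₀ ⊗ₜ[k] (mcForm ϖ y₁ * z)) := by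
  simp (disch := fun_prop) only [tensorDeriv, LinearMap.add_apply, slide_apply, sw_tmul,
    LinearMap.rTensor_tmul, TensorProduct.map_tmul]

variable (hX : X.IsCrossedModule)
include hX

/-- The Maurer-Cartan equation for operators: the anticommutator of `tensorDeriv` with
multiplication by the primitive element `mcV a` is minus the sum of products of two such
multiplications. It is the inductive step for `Δ d`. -/
theorem tensorDeriv_leftOp (a : A) (y z : MaxExterior ϖ) :
    tensorDeriv d Y (leftOp Y (mcV ϖ a) (y ⊗ₜ z)) + leftOp Y (mcV ϖ a) (tensorDeriv d Y (y ⊗ₜ z)) +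
      sw (δ a) (fun a₁ a₂ => leftOp Y (mcV ϖ a₁) (leftOp Y (mcV ϖ a₂) (y ⊗ₜ z))) = 0 := by
  have h₁ := sw_braid_mcV hϖ (fun v w => sw (Y.coact (P y)) (fun y₀ y₁ =>
    (ι ϖ v * y₀) ⊗ₜ[k] (ι ϖ (X.act w y₁) * z))) (by fun_prop) (by fun_prop) a
  have hm (b c : A) : ι ϖ (X.act (mcV ϖ b) c) = mcForm ϖ (b * c) - ε b • mcForm ϖ c := by
    rw [act_mcV hϖ, map_sub, map_smul]
    rfl
  -- The correction term of the braiding splits in two: with `mcForm (r * y₁)` it matches sliding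
  -- the form past `v y`, and with `mcForm y₁` it matches multiplying by `v` after sliding past `y`.
  -- This is why `tensorDeriv` contains `slide Y (mcForm ϖ)`.
  have h₂ : sw (X.coact (mcV ϖ a)) (fun p r => sw (Y.coact (P y)) (fun y₀ y₁ =>
      (ι ϖ p * y₀) ⊗ₜ[k] (ι ϖ (X.act (mcV ϖ r) y₁) * z))) =
      sw (X.coact (mcV ϖ a)) (fun p r => sw (Y.coact (P y)) (fun y₀ y₁ =>
        (ι ϖ p * y₀) ⊗ₜ[k] (mcForm ϖ (r * y₁) * z))) -
      sw (Y.coact (P y)) (fun y₀ y₁ => (ι ϖ (mcV ϖ a) * y₀) ⊗ₜ[k] (mcForm ϖ y₁ * z)) := by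
    have h₃ := hX.sw_counit (fun p => sw (Y.coact (P y)) (fun y₀ y₁ =>
      (ι ϖ p * y₀) ⊗ₜ[k] (mcForm ϖ y₁ * z))) (by fun_prop) (mcV ϖ a)
    rw [← h₃, ← sw_fun_sub]
    simp only [hm, sub_mul, TensorProduct.tmul_sub, sw_fun_sub, smul_mul_assoc,
      TensorProduct.tmul_smul, sw_fun_smul]
  have h₄ := (hY.isCrossedModule hX).sw_coassoc (fun y₀ b c => y₀ ⊗ₜ[k] 
    (mcForm ϖ b * (ι ϖ (X.act (mcV ϖ a) c) * z))) (by fun_prop) (by fun_prop) (by fun_prop) y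
  have h₅ := (hY.isCrossedModule hX).sw_coassoc (fun y₀ b c => y₀ ⊗ₜ[k] 
    (ι ϖ (X.act (mcV ϖ a) b) * (mcForm ϖ c * z))) (by fun_prop) (by fun_prop) (by fun_prop) y
  have hq : q (mcV ϖ a) = sw (δ a) (fun a₁ a₂ => ι ϖ (mcV ϖ a₁) * ι ϖ (mcV ϖ a₂)) :=
    (hd.sq a).symm
  simp only [hY.leftOp_leftOp hX, sw_fun_add, sw_fun_sub]
  rw [h₁, h₂, tensorDeriv_tmul, leftOp_tmul, map_add, map_add, map_add, tensorDeriv_tmul]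
  simp (disch := fun_prop) only [map_sw, tensorDeriv_tmul, leftOp_tmul, hd.ι_mul, parity_ι_mul,
    map_neg, sw_neg, hY.sw_coact_ι_mul, hY.act_ι, hY.sw_coact_parity, parity_parity,
    hd.sw_coact_d hY hϖ, hd.d_parity]
  have h₆ : sw (δ a) (fun a₁ a₂ => sw (Y.coact y) (fun y₀ y₁ => y₀ ⊗ₜ[k]
      (Y.act (ι ϖ (mcV ϖ a₁) * ι ϖ (mcV ϖ a₂)) y₁ * z))) =
      sw (Y.coact y) (fun y₀ y₁ => y₀ ⊗ₜ[k] (Y.act (q (mcV ϖ a)) y₁ * z)) := by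
    rw [hq, sw_comm]
    simp only [map_sw, sw_apply_const, sw_mul, tmul_sw]
  have h₇ : sw (δ a) (fun a₁ a₂ => (ι ϖ (mcV ϖ a₁) * (ι ϖ (mcV ϖ a₂) * y)) ⊗ₜ[k] z) =
      (q (mcV ϖ a) * y) ⊗ₜ[k] z := by
    rw [hq, sw_mul, sw_tmul_const]
    simp only [mul_assoc]
  simp only [h₆, h₇, hd.q_act hY hϖ, TensorProduct.sub_tmul, TensorProduct.neg_tmul,
    TensorProduct.tmul_sub, TensorProduct.tmul_neg, TensorProduct.tmul_add, add_mul, neg_add,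
    sw_fun_add, sw_fun_sub, sw_fun_neg, h₄, h₅, sw_mul, tmul_sw, mul_assoc]
  abel

end IsDeriv

/-- The coproduct intertwines the exterior derivative with `tensorDeriv`. -/
theorem IsDeriv.comul_d {q : V →ₗ[k] MaxExterior ϖ} {d : MaxExterior ϖ →ₗ[k] MaxExterior ϖ}
    (hd : IsDeriv q d) {X : ActCoact k A V} {Y : ActCoact k A (MaxExterior ϖ)} (hY : Extends X Y)
    (hϖ : (augmentation k A).IsHom X ϖ) (hX : X.IsCrossedModule)
    {Δ : MaxExterior ϖ →ₗ[k] MaxExterior ϖ ⊗[k] MaxExterior ϖ} (hΔ : IsComul Y Δ)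
    (x : MaxExterior ϖ) : Δ (d x) = tensorDeriv d Y (Δ x) := by
  refine lin_ext (J := Unit) (f := fun _ x => Δ (d x)) (g := fun _ x => tensorDeriv d Y (Δ x))
    (fun _ => by fun_prop) (fun _ => by fun_prop) (fun _ => ?_) (fun v x h _ => ?_) () x
  · rw [hd.one, hΔ.one, tensorDeriv_tmul, parity_one, hd.one,
      hY.sw_coact_one _ (by fun_prop) (by fun_prop), mcForm_eq, mcV_one]
    simp
  · obtain ⟨a, -, rfl⟩ := exists_eq_mcV hd.surj v
    have h₁ (t : MaxExterior ϖ ⊗[k] MaxExterior ϖ) :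
        tensorDeriv d Y (leftOp Y (mcV ϖ a) t) + leftOp Y (mcV ϖ a) (tensorDeriv d Y t) +
          sw (δ a) (fun a₁ a₂ => leftOp Y (mcV ϖ a₁) (leftOp Y (mcV ϖ a₂) t)) = 0 := by
      induction t with
      | zero => simp [sw_fun_zero]
      | add s t hs ht =>
        simp only [map_add, sw_fun_add]
        refine Eq.trans ?_ ((congrArg₂ (· + ·) hs ht).trans (add_zero _))
        abel
      | tmul y z => exact hd.tensorDeriv_leftOp hY hϖ hX a y z
    have h₂ : Δ (q (mcV ϖ a) * x) =
        sw (δ a) (fun a₁ a₂ => leftOp Y (mcV ϖ a₁) (leftOp Y (mcV ϖ a₂) (Δ x))) := by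
      rw [← hd.sq, sw_mul, map_sw]
      simp only [mcForm_eq, mul_assoc, hΔ.ι_mul]
    rw [hd.ι_mul, map_sub, map_neg, hΔ.ι_mul, hΔ.ι_mul, h (), h₂]
    rw [eq_neg_of_add_eq_zero_left ((add_assoc _ _ _).symm.trans (h₁ (Δ x)))]
    abel

theorem IsDeriv.coproductCompatible {q : V →ₗ[k] MaxExterior ϖ}
    {d : MaxExterior ϖ →ₗ[k] MaxExterior ϖ}
    (hd : IsDeriv q d) {X : ActCoact k A V} {Y : ActCoact k A (MaxExterior ϖ)} (hY : Extends X Y)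
    (hϖ : (augmentation k A).IsHom X ϖ) (hX : X.IsCrossedModule)
    {Δ : MaxExterior ϖ →ₗ[k] MaxExterior ϖ ⊗[k] MaxExterior ϖ} (hΔ : IsComul Y Δ) :
    CoproductCompatible (hopf hΔ hY hX) d := by
  intro x
  change Δ (d x) - (d.rTensor (MaxExterior ϖ) (Δ x) + TensorProduct.map P d (Δ x)) =
    (TensorProduct.lift (LinearMap.mul k (MaxExterior ϖ) ∘ₗ mcForm ϖ)).lTensor (MaxExterior ϖ)
      (TensorProduct.assoc k (MaxExterior ϖ) A (MaxExterior ϖ)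
        ((Y.coact ∘ₗ P).rTensor (MaxExterior ϖ) (Δ x)))
  rw [hd.comul_d hY hϖ hX hΔ, tensorDeriv, LinearMap.add_apply, LinearMap.add_apply,
    add_sub_cancel_left, slide_apply]
  simp only [rTensor_eq_sw, map_sw_equiv, map_sw]
  refine sw_congr _ fun y z => ?_
  rw [LinearMap.comp_apply]
  conv_rhs => rw [← sw_tmul_self (Y.coact (P y))]
  simp only [sw_tmul_const, map_sw_equiv, map_sw, TensorProduct.assoc_tmul,
    LinearMap.lTensor_tmul, TensorProduct.lift.tmul, LinearMap.comp_apply, LinearMap.mul_apply']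

end MaxExterior

/-! ### The product of the super tensor square -/

section SuperProd

variable {k Λ : Type*} [Field k] [Ring Λ] [Algebra k Λ] (𝒜 : ℕ → Submodule k Λ) [GradedAlgebra 𝒜]

/-- The product `(x ⊗ y)(z ⊗ w) = (-1)^{|y||z|} x z ⊗ y w` of the super tensor square. -/
def superProd : Λ ⊗[k] Λ →ₗ[k] Λ ⊗[k] Λ →ₗ[k] Λ ⊗[k] Λ :=
  TensorProduct.curry (TensorProduct.map (LinearMap.mul' k Λ) (LinearMap.mul' k Λ) ∘ₗ
    middle ((TensorProduct.comm k Λ Λ).toLinearMap ∘ₗ koszul 𝒜))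

theorem superProd_of_mem (x w : Λ) {y z : Λ} {m n : ℕ} (hy : y ∈ 𝒜 m) (hz : z ∈ 𝒜 n) :
    superProd 𝒜 (x ⊗ₜ y) (z ⊗ₜ w) = (-1 : k) ^ (m * n) • ((x * z) ⊗ₜ[k] (y * w)) := by
  change TensorProduct.map _ _ (middle _ ((x ⊗ₜ y) ⊗ₜ (z ⊗ₜ w))) = _
  rw [middle_tmul, LinearMap.comp_apply, koszul_tmul 𝒜 hy hz, map_smul,
    sw_smul _ _ _ (by fun_prop) (by fun_prop), map_smul]
  congr 1
  rw [LinearEquiv.coe_coe, TensorProduct.comm_tmul, sw_tmul _ _ _ (by fun_prop) (by fun_prop),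
    TensorProduct.map_tmul]
  rfl

theorem superProd_of_mem_zero (x w z : Λ) {y : Λ} (hy : y ∈ 𝒜 0) :
    superProd 𝒜 (x ⊗ₜ y) (z ⊗ₜ w) = (x * z) ⊗ₜ[k] (y * w) := by
  refine graded_lin_ext 𝒜 (f := fun z => superProd 𝒜 (x ⊗ₜ y) (z ⊗ₜ w))
    (g := fun z => (x * z) ⊗ₜ[k] (y * w)) (by fun_prop) (by fun_prop) (fun n z hz => ?_) z
  rw [superProd_of_mem 𝒜 x w hy hz, zero_mul, pow_zero, one_smul]

theorem superProd_tmul_one (x y z w : Λ) (hz : z ∈ 𝒜 0) :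
    superProd 𝒜 (x ⊗ₜ y) (z ⊗ₜ w) = (x * z) ⊗ₜ[k] (y * w) := by
  refine graded_lin_ext 𝒜 (f := fun y => superProd 𝒜 (x ⊗ₜ y) (z ⊗ₜ w))
    (g := fun y => (x * z) ⊗ₜ[k] (y * w)) (by fun_prop) (by fun_prop) (fun n y hy => ?_) y
  rw [superProd_of_mem 𝒜 x w hy hz, mul_zero, pow_zero, one_smul]

theorem superProd_of_mem_one (x w z : Λ) {y : Λ} (hy : y ∈ 𝒜 1) :
    superProd 𝒜 (x ⊗ₜ y) (z ⊗ₜ w) = (x * parity 𝒜 z) ⊗ₜ[k] (y * w) := by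
  refine graded_lin_ext 𝒜 (f := fun z => superProd 𝒜 (x ⊗ₜ y) (z ⊗ₜ w))
    (g := fun z => (x * parity 𝒜 z) ⊗ₜ[k] (y * w)) (by fun_prop) (by fun_prop)
    (fun n z hz => ?_) z
  rw [superProd_of_mem 𝒜 x w hy hz, one_mul, parity_of_mem 𝒜 hz, mul_smul_comm,
    TensorProduct.smul_tmul']

theorem superProd_assoc (s t r : Λ ⊗[k] Λ) :
    superProd 𝒜 (superProd 𝒜 s t) r = superProd 𝒜 s (superProd 𝒜 t r) := by
  induction s with
  | zero => simp
  | add s s' hs hs' => simp only [map_add, LinearMap.add_apply, hs, hs']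
  | tmul x y =>
  induction t with
  | zero => simp
  | add s s' hs hs' => simp only [map_add, LinearMap.add_apply, hs, hs']
  | tmul z w =>
  induction r with
  | zero => simp
  | add s s' hs hs' => simp only [map_add, hs, hs']
  | tmul u v =>
  refine graded_lin_ext 𝒜 (f := fun y => superProd 𝒜 (superProd 𝒜 (x ⊗ₜ y) (z ⊗ₜ w)) (u ⊗ₜ v))
    (g := fun y => superProd 𝒜 (x ⊗ₜ y) (superProd 𝒜 (z ⊗ₜ w) (u ⊗ₜ v)))
    (by fun_prop) (by fun_prop) (fun i y hy => ?_) y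
  refine graded_lin_ext 𝒜 (f := fun z => superProd 𝒜 (superProd 𝒜 (x ⊗ₜ y) (z ⊗ₜ w)) (u ⊗ₜ v))
    (g := fun z => superProd 𝒜 (x ⊗ₜ y) (superProd 𝒜 (z ⊗ₜ w) (u ⊗ₜ v)))
    (by fun_prop) (by fun_prop) (fun j z hz => ?_) z
  refine graded_lin_ext 𝒜 (f := fun w => superProd 𝒜 (superProd 𝒜 (x ⊗ₜ y) (z ⊗ₜ w)) (u ⊗ₜ v))
    (g := fun w => superProd 𝒜 (x ⊗ₜ y) (superProd 𝒜 (z ⊗ₜ w) (u ⊗ₜ v)))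
    (by fun_prop) (by fun_prop) (fun l w hw => ?_) w
  refine graded_lin_ext 𝒜 (f := fun u => superProd 𝒜 (superProd 𝒜 (x ⊗ₜ y) (z ⊗ₜ w)) (u ⊗ₜ v))
    (g := fun u => superProd 𝒜 (x ⊗ₜ y) (superProd 𝒜 (z ⊗ₜ w) (u ⊗ₜ v)))
    (by fun_prop) (by fun_prop) (fun m u hu => ?_) u
  rw [superProd_of_mem 𝒜 x w hy hz, superProd_of_mem 𝒜 z v hw hu, map_smul, map_smul,
    LinearMap.smul_apply, superProd_of_mem 𝒜 _ v (SetLike.GradedMul.mul_mem hy hw) hu,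
    superProd_of_mem 𝒜 x _ hy (SetLike.GradedMul.mul_mem hz hu), smul_smul, smul_smul, ← pow_add,
    ← pow_add, mul_assoc, mul_assoc]
  -- With degrees `i, j, l, m` of `y, z, w, u`, both exponents are `i j + i m + l m`.
  congr 2
  ring

end SuperProd

/-! ### Rules for super-braided Hopf algebras -/

namespace SuperBraidedHopf

variable {k A Λ M : Type*} [Field k] [Ring A] [HopfAlgebra k A] [Ring Λ] [Algebra k Λ]
  [AddCommMonoid M] [Module k M]
  {𝒜 : ℕ → Submodule k Λ} [GradedAlgebra 𝒜] (H : SuperBraidedHopf k A 𝒜)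

local notation "δ" => Coalgebra.comul (R := k)
local notation "ε" => Coalgebra.counit (R := k)
local notation "S" => HopfAlgebra.antipode k

theorem coact_one : H.coact 1 = 1 ⊗ₜ 1 := by
  have := H.one_hom.map_coact 1
  simpa [ActCoact.unitObject] using this

theorem coact_mul (x y : Λ) : H.coact (x * y) = sw (H.coact x) (fun x₀ x₁ =>
    sw (H.coact y) (fun y₀ y₁ => (x₀ * y₀) ⊗ₜ[k] (x₁ * y₁))) := by
  have := H.mul_hom.map_coact (x ⊗ₜ y)
  rw [LinearMap.mul'_apply] at this
  refine this.trans ((congrArg ((LinearMap.mul' k Λ).rTensor A)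
    ((tensor_coact_eq _ _ _).trans (tensorCoact_tmul _ _ _ _))).trans ?_)
  simp only [map_sw, LinearMap.rTensor_tmul, LinearMap.mul'_apply]

theorem sw_coact_mul (F : Λ → A → M) (h₁ : ∀ y, Lin k (fun x => F x y))
    (h₂ : ∀ x, Lin k (fun y => F x y)) (x y : Λ) :
    sw (H.coact (x * y)) F = sw (H.coact x) (fun x₀ x₁ => sw (H.coact y) (fun y₀ y₁ =>
      F (x₀ * y₀) (x₁ * y₁))) := by
  rw [coact_mul]
  simp (disch := fun_prop) only [sw_sw, sw_tmul]

theorem sw_comul_coact (F : Λ → Λ → A → M) (h₁ : ∀ b c, Lin k (fun a => F a b c))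
    (h₂ : ∀ a c, Lin k (fun b => F a b c)) (h₃ : ∀ a b, Lin k (fun c => F a b c)) (x : Λ) :
    sw (H.coact x) (fun x₀ x₁ => sw (H.comul x₀) (fun p q => F p q x₁)) =
      sw (H.comul x) (fun p q => sw (H.coact p) (fun p₀ p₁ => sw (H.coact q) (fun q₀ q₁ =>
        F p₀ q₀ (p₁ * q₁)))) := by
  have h := congrArg (fun t => sw t (fun s c => sw s (fun p q => F p q c)))
    ((tensor_coact_eq _ _ _).symm.trans (H.comul_hom.map_coact x))
  simp (disch := fun_prop) only [sw_tensorCoact, sw_tmul, rTensor_eq_sw, sw_sw] at h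
  exact h.symm

theorem comul_act (x : Λ) (a : A) : H.comul (H.act x a) =
    sw (δ a) (fun a₁ a₂ => sw (H.comul x) (fun p q => H.act p a₁ ⊗ₜ[k] H.act q a₂)) :=
  (H.comul_hom.map_act x a).trans (ActCoact.tensor_act _ _ _ _)

theorem sw_coact_antipode (F : Λ → A → M) (h₁ : ∀ y, Lin k (fun x => F x y))
    (h₂ : ∀ x, Lin k (fun y => F x y)) (x : Λ) :
    sw (H.coact (H.antipode x)) F = sw (H.coact x) (fun x₀ x₁ => F (H.antipode x₀) x₁) := by
  rw [H.antipode_hom.map_coact, sw_rTensor _ _ _ h₁ h₂]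

theorem sw_coassoc (F : Λ → Λ → Λ → M) (h₁ : ∀ b c, Lin k (fun a => F a b c))
    (h₂ : ∀ a c, Lin k (fun b => F a b c)) (h₃ : ∀ a b, Lin k (fun c => F a b c)) (x : Λ) :
    sw (H.comul x) (fun p r => sw (H.comul p) (fun p q => F p q r)) =
      sw (H.comul x) (fun p q => sw (H.comul q) (fun q r => F p q r)) := by
  have h := sw_assoc (H.comul.rTensor Λ (H.comul x)) F h₁ h₂ h₃
  rw [H.coassoc] at h
  simpa (disch := fun_prop) only [sw_rTensor, sw_lTensor] using h

theorem sw_counit_left (f : Λ → M) (hf : Lin k f) (x : Λ) :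
    sw (H.comul x) (fun p q => H.counit p • f q) = f x := by
  conv_rhs => rw [← H.counit_comul x]
  simp only [rTensor_eq_sw, map_sw_equiv, TensorProduct.lid_tmul, hf.map_sw, hf.map_smul]

theorem sw_counit_right (f : Λ → M) (hf : Lin k f) (x : Λ) :
    sw (H.comul x) (fun p q => H.counit q • f p) = f x := by
  conv_rhs => rw [← H.comul_counit x]
  simp only [lTensor_eq_sw, map_sw_equiv, TensorProduct.rid_tmul, hf.map_sw, hf.map_smul]

theorem sw_antipode_left (x : Λ) :
    sw (H.comul x) (fun p q => H.antipode p * q) = H.counit x • 1 := by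
  rw [← Algebra.algebraMap_eq_smul_one, ← H.antipode_left, rTensor_eq_sw, map_sw]
  rfl

theorem sw_antipode_right (x : Λ) :
    sw (H.comul x) (fun p q => p * H.antipode q) = H.counit x • 1 := by
  rw [← Algebra.algebraMap_eq_smul_one, ← H.antipode_right, lTensor_eq_sw, map_sw]
  rfl

theorem coact_comul_counit (x : Λ) : sw (H.coact x) (fun x₀ x₁ => H.counit x₀ • x₁) =
    H.counit x • 1 := by
  have h := congrArg (TensorProduct.lid k A) (H.counit_hom.map_coact x)
  rw [rTensor_eq_sw, map_sw_equiv] at h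
  simp only [TensorProduct.lid_tmul] at h
  rw [← h]
  simp [ActCoact.unitObject]

theorem counit_act (x : Λ) (a : A) : H.counit (H.act x a) = ε a * H.counit x :=
  H.counit_hom.map_act x a

end SuperBraidedHopf

/-! ### The super-bosonisation is a super-Hopf algebra -/

namespace Bosonisation

variable {k A Λ M : Type*} [Field k] [Ring A] [HopfAlgebra k A] [Ring Λ] [Algebra k Λ]
  [AddCommMonoid M] [Module k M]
  {𝒜 : ℕ → Submodule k Λ} [GradedAlgebra 𝒜] (H : SuperBraidedHopf k A 𝒜)

local notation "δ" => Coalgebra.comul (R := k)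
local notation "ε" => Coalgebra.counit (R := k)
local notation "S" => HopfAlgebra.antipode k

theorem sw_comul_mul (F : A → A → M) (h₁ : ∀ y, Lin k (fun x => F x y)) (h₂ : ∀ x, Lin k (F x))
    (a b : A) : sw (δ (a * b)) F =
      sw (δ a) (fun a₁ a₂ => sw (δ b) (fun b₁ b₂ => F (a₁ * b₁) (a₂ * b₂))) := by
  simp (disch := fun_prop) only [comul_mul_eq_sw, sw_sw, sw_tmul]

/-- The inclusion `η ↦ 1 ⊗ η`. -/
def inclΛ : Λ →ₐ[k] Bosonisation H :=
  AlgHom.ofLinearMap ((ofTensor H).toLinearMap ∘ₗ TensorProduct.mk k A Λ 1) rfl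
    (fun η ω => by
      have h := ofTensor_mul H (1 ⊗ₜ η) (1 ⊗ₜ ω)
      rw [mulMap_mk, twist_one_right, TensorProduct.map_tmul, LinearMap.mulLeft_apply,
        LinearMap.mulRight_apply, mul_one] at h
      exact h.symm)

theorem ofTensor_tmul (a : A) (η : Λ) : ofTensor H (a ⊗ₜ η) = inclA H a * inclΛ H η := by
  have h := ofTensor_mul H (a ⊗ₜ 1) (1 ⊗ₜ η)
  rw [mulMap_mk, twist_one_right, TensorProduct.map_tmul, LinearMap.mulLeft_apply,
    LinearMap.mulRight_apply, mul_one, one_mul] at h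
  exact h.symm

theorem inclA_mem_deg (a : A) : inclA H a ∈ deg H 0 := tmul_mem_deg H a SetLike.GradedOne.one_mem

theorem inclΛ_mem_deg {n : ℕ} {η : Λ} (h : η ∈ 𝒜 n) : inclΛ H η ∈ deg H n := tmul_mem_deg H 1 h

theorem inclA_mul_inclΛ_mem_deg (a : A) {n : ℕ} {η : Λ} (h : η ∈ 𝒜 n) :
    inclA H a * inclΛ H η ∈ deg H n := by
  rw [← ofTensor_tmul]
  exact tmul_mem_deg H a h

theorem inclΛ_mul_inclA (η : Λ) (b : A) : inclΛ H η * inclA H b =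
    sw (δ b) (fun b₁ b₂ => inclA H b₁ * inclΛ H (H.act η b₂)) := by
  have h := ofTensor_mul H (1 ⊗ₜ η) (b ⊗ₜ 1)
  rw [mulMap_mk] at h
  refine h.trans ?_
  simp only [SuperBraidedHopf.twist, LinearMap.mk₂_apply, lTensor_eq_sw, map_sw, map_sw_equiv,
    TensorProduct.map_tmul, ofTensor_tmul, LinearMap.mulLeft_apply, LinearMap.mulRight_apply,
    mul_one, one_mul]

/-- `(a ⊗ η)(b ⊗ ω) = a b₁ ⊗ (η ◁ b₂) ω`. -/
theorem inclA_mul_inclΛ_mul (a b : A) (η ω : Λ) :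
    inclA H a * inclΛ H η * (inclA H b * inclΛ H ω) =
      sw (δ b) (fun b₁ b₂ => inclA H (a * b₁) * inclΛ H (H.act η b₂ * ω)) := by
  simp only [map_mul, mul_assoc]
  rw [← mul_assoc (inclΛ H η), inclΛ_mul_inclA, sw_mul, mul_sw]
  simp only [mul_assoc]

variable {H}

theorem lin_ext {f g : Bosonisation H → M} (hf : Lin k f) (hg : Lin k g)
    (h : ∀ a η, f (inclA H a * inclΛ H η) = g (inclA H a * inclΛ H η)) (x : Bosonisation H) :
    f x = g x := by
  suffices h : Lin.toMap f hf ∘ₗ (ofTensor H).toLinearMap =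
      Lin.toMap g hg ∘ₗ (ofTensor H).toLinearMap from LinearMap.congr_fun h ((ofTensor H).symm x)
  refine TensorProduct.ext' fun a η => ?_
  simp only [LinearMap.comp_apply, LinearEquiv.coe_coe, ofTensor_tmul, Lin.toMap_apply, h]

theorem parity_inclA_mul (a : A) (η : Λ) : parity (deg H) (inclA H a * inclΛ H η) =
    inclA H a * inclΛ H (parity 𝒜 η) := by
  refine graded_lin_ext 𝒜 (f := fun η => parity (deg H) (inclA H a * inclΛ H η))
    (g := fun η => inclA H a * inclΛ H (parity 𝒜 η)) (by fun_prop) (by fun_prop)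
    (fun n x hx => ?_) η
  rw [parity_of_mem _ (inclA_mul_inclΛ_mem_deg H a hx), parity_of_mem _ hx, map_smul,
    mul_smul_comm]

variable (H) in
/-- The restriction `p ⊗ q ↦ p₀ ⊗ p₁ q` of the coproduct (auxiliary). -/
def comulΛ : Λ ⊗[k] Λ →ₗ[k] Bosonisation H ⊗[k] Bosonisation H :=
  Lin.toMap (fun t => sw t (fun p q => sw (H.coact p) (fun p₀ p₁ =>
    inclΛ H p₀ ⊗ₜ[k] (inclA H p₁ * inclΛ H q)))) (by fun_prop)

theorem comulΛ_tmul (p q : Λ) : comulΛ H (p ⊗ₜ q) = sw (H.coact p) (fun p₀ p₁ =>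
    inclΛ H p₀ ⊗ₜ[k] (inclA H p₁ * inclΛ H q)) := by
  simp (disch := fun_prop) only [comulΛ, Lin.toMap_apply, sw_tmul]

theorem comul_apply (a : A) (η : Λ) : comul H (inclA H a * inclΛ H η) =
    sw (δ a) (fun a₁ a₂ => sw (H.comul η) (fun p q => sw (H.coact p) (fun p₀ p₁ =>
      (inclA H a₁ * inclΛ H p₀) ⊗ₜ[k] (inclA H (a₂ * p₁) * inclΛ H q)))) := by
  rw [← ofTensor_tmul, comul]
  simp only [LinearMap.comp_apply, LinearEquiv.coe_coe, LinearEquiv.symm_apply_apply,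
    TensorProduct.map_tmul]
  conv_lhs => rw [← sw_tmul_self (δ a)]
  simp only [rTensor_eq_sw, map_sw_equiv, map_sw, sw_tmul_const, tmul_sw]
  rw [sw_comm]
  refine sw_congr _ fun a₁ a₂ => sw_congr _ fun p q => ?_
  conv_lhs => rw [← sw_tmul_self (H.coact p)]
  simp only [map_sw_equiv, map_sw, sw_tmul_const, tmul_sw]
  refine sw_congr _ fun p₀ p₁ => ?_
  simp [ofTensor_tmul]

theorem comul_inclA_mul_inclΛ (a : A) (η : Λ) : comul H (inclA H a * inclΛ H η) =
    sw (δ a) (fun a₁ a₂ => superProd (deg H) (inclA H a₁ ⊗ₜ inclA H a₂)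
      (comulΛ H (H.comul η))) := by
  simp only [comul_apply, comulΛ, Lin.toMap_apply, map_sw,
    superProd_of_mem_zero _ _ _ _ (inclA_mem_deg H _), map_mul, mul_assoc]

theorem comul_inclΛ (η : Λ) : comul H (inclΛ H η) = comulΛ H (H.comul η) := by
  have h := comul_apply (H := H) 1 η
  rw [map_one, one_mul, comul_one_eq, sw_tmul _ _ _ (by fun_prop) (by fun_prop)] at h
  rw [h]
  simp only [comulΛ, Lin.toMap_apply, map_one, one_mul]

theorem comul_inclA (a : A) : comul H (inclA H a) =
    sw (δ a) (fun a₁ a₂ => inclA H a₁ ⊗ₜ inclA H a₂) := by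
  have h := comul_apply (H := H) a 1
  rw [H.comul_one] at h
  simp (disch := fun_prop) only [map_one, mul_one, sw_tmul, H.coact_one] at h
  exact h

theorem comul_inclA_mul (a : A) (x : Bosonisation H) : comul H (inclA H a * x) =
    superProd (deg H) (comul H (inclA H a)) (comul H x) := by
  refine lin_ext (f := fun x => comul H (inclA H a * x)) (g := fun x =>
    superProd (deg H) (comul H (inclA H a)) (comul H x)) (by fun_prop) (by fun_prop)
    (fun b η => ?_) x
  rw [← mul_assoc, ← map_mul, comul_inclA_mul_inclΛ, comul_inclA_mul_inclΛ, comul_inclA]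
  simp (disch := fun_prop) only [map_sw, sw_apply_const, comul_mul_eq_sw, sw_sw, sw_tmul,
    ← superProd_assoc, superProd_of_mem_zero _ _ _ _ (inclA_mem_deg H _), map_mul]
  rw [sw_comm]

/-- Coproduct of the cross relation: `Δ(η ◁ b)` is split by linearity of the braided coproduct, and
its coacted leg by the crossed-module condition. There are no signs because `b` has degree zero. -/
theorem comul_inclΛ_mul_inclA (η : Λ) (b : A) : comul H (inclΛ H η * inclA H b) =
    superProd (deg H) (comul H (inclΛ H η)) (comul H (inclA H b)) := by
  rw [inclΛ_mul_inclA, map_sw]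
  simp only [comul_apply, H.comul_act]
  rw [comul_inclΛ, comul_inclA, comulΛ, Lin.toMap_apply]
  simp (disch := fun_prop) only [map_sw, sw_apply_const, sw_sw, sw_tmul,
    superProd_tmul_one _ _ _ _ _ (inclA_mem_deg H _)]
  simp only [sw_comm (δ _) (H.comul η)]
  refine sw_congr _ fun p q => ?_
  rw [sw_coassoc (fun a₁ a₂ y => sw (δ y) (fun b₃ b₄ => sw (H.coact (H.act p b₃)) (fun p₀ p₁ =>
    (inclA H a₁ * inclΛ H p₀) ⊗ₜ[k] (inclA H (a₂ * p₁) * inclΛ H (H.act q b₄)))))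
    (by fun_prop) (by fun_prop) (by fun_prop)]
  simp only [inclΛ_mul_inclA, mul_assoc, mul_sw]
  simp only [sw_tmul_const, tmul_sw]
  simp only [sw_comm (H.coact p)]
  -- The crossed-module condition enters here: the leg `a₂` in front of the coaction of `p ◁ b₃`
  -- moves behind the coaction of `p`.
  have h₁ : ∀ y a₁, sw (δ y) (fun a₂ y => sw (δ y) (fun b₃ b₄ => sw (H.coact (H.act p b₃))
      (fun p₀ p₁ => (inclA H a₁ * inclΛ H p₀) ⊗ₜ[k] (inclA H (a₂ * p₁) * inclΛ H (H.act q b₄))))) =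
      sw (δ y) (fun c₁ y => sw (δ y) (fun c₂ b₄ => sw (H.coact p) (fun p₀ p₁ =>
        (inclA H a₁ * inclΛ H (H.act p₀ c₁)) ⊗ₜ[k]
          (inclA H (p₁ * c₂) * inclΛ H (H.act q b₄))))) := by
    intro y a₁
    rw [← sw_coassoc (fun a₂ b₃ b₄ => sw (H.coact (H.act p b₃))
      (fun p₀ p₁ => (inclA H a₁ * inclΛ H p₀) ⊗ₜ[k] (inclA H (a₂ * p₁) * inclΛ H (H.act q b₄))))
      (by fun_prop) (by fun_prop) (by fun_prop), ← sw_coassoc (fun c₁ c₂ b₄ => sw (H.coact p)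
      (fun p₀ p₁ => (inclA H a₁ * inclΛ H (H.act p₀ c₁)) ⊗ₜ[k]
        (inclA H (p₁ * c₂) * inclΛ H (H.act q b₄))))
      (by fun_prop) (by fun_prop) (by fun_prop)]
    refine sw_congr _ fun y b₄ => ?_
    exact H.isCrossedModule.sw_mul_coact_act (fun p₀ p₁ => (inclA H a₁ * inclΛ H p₀) ⊗ₜ[k]
      (inclA H p₁ * inclΛ H (H.act q b₄))) (by fun_prop) (by fun_prop) p y
  simp only [h₁]
  rw [← sw_coassoc (fun a₁ c₁ y => sw (δ y) (fun c₂ b₄ => sw (H.coact p) (fun p₀ p₁ =>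
        (inclA H a₁ * inclΛ H (H.act p₀ c₁)) ⊗ₜ[k]
          (inclA H (p₁ * c₂) * inclΛ H (H.act q b₄)))))
    (by fun_prop) (by fun_prop) (by fun_prop)]
  simp only [map_mul, mul_assoc]
  exact sw_congr _ fun _ _ => sw_comm _ _ _


/-- In the super square of the bosonisation the element `y` must pass the factor `z₁ ∈ A` created by
the coaction of `z`. The cross relation turns this into `y ◁ z₁`, so the ordinary flip with sign
becomes the super-braiding of `Λ`. -/
theorem comul_inclΛ_mul_inclΛ (η ω : Λ) : comul H (inclΛ H η * inclΛ H ω) =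
    superProd (deg H) (comul H (inclΛ H η)) (comul H (inclΛ H ω)) := by
  have h (x y z w : Λ) : superProd (deg H) (comulΛ H (x ⊗ₜ y)) (comulΛ H (z ⊗ₜ w)) =
      comulΛ H (TensorProduct.map (LinearMap.mul' k Λ) (LinearMap.mul' k Λ)
        (middle (H.braiding H.toActCoact ∘ₗ koszul 𝒜) ((x ⊗ₜ y) ⊗ₜ (z ⊗ₜ w)))) := by
    rw [middle_tmul, map_sw]
    simp only [TensorProduct.map_tmul, LinearMap.mul'_apply, LinearMap.comp_apply]
    refine graded_lin_ext 𝒜 (f := fun y => superProd (deg H) (comulΛ H (x ⊗ₜ y))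
      (comulΛ H (z ⊗ₜ w))) (g := fun y => comulΛ H (sw (H.braiding H.toActCoact
        (koszul 𝒜 (y ⊗ₜ z))) (fun p q => (x * p) ⊗ₜ[k] (q * w))))
      (by fun_prop) (by fun_prop) (fun m y hy => ?_) y
    refine graded_lin_ext 𝒜 (f := fun z => superProd (deg H) (comulΛ H (x ⊗ₜ y))
      (comulΛ H (z ⊗ₜ w))) (g := fun z => comulΛ H (sw (H.braiding H.toActCoact
        (koszul 𝒜 (y ⊗ₜ z))) (fun p q => (x * p) ⊗ₜ[k] (q * w))))
      (by fun_prop) (by fun_prop) (fun n z hz => ?_) z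
    have h₁ (x₀ : Λ) (x₁ : A) : sw (H.coact z) (fun z₀ z₁ => superProd (deg H)
        (inclΛ H x₀ ⊗ₜ (inclA H x₁ * inclΛ H y)) (inclΛ H z₀ ⊗ₜ (inclA H z₁ * inclΛ H w))) =
        (-1 : k) ^ (m * n) • sw (H.coact z) (fun z₀ z₁ => (inclΛ H x₀ * inclΛ H z₀) ⊗ₜ[k]
          (inclA H x₁ * inclΛ H y * (inclA H z₁ * inclΛ H w))) := by
      obtain ⟨t, ht⟩ := H.coact_deg n z hz
      rw [← ht, sw_rTensor _ _ _ (by fun_prop) (by fun_prop),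
        sw_rTensor _ _ _ (by fun_prop) (by fun_prop), ← sw_fun_smul]
      exact sw_congr _ fun z₀ z₁ => superProd_of_mem _ _ _ (inclA_mul_inclΛ_mem_deg H x₁ hy)
        (inclΛ_mem_deg H z₀.2)
    have h₂ : superProd (deg H) (comulΛ H (x ⊗ₜ y)) (comulΛ H (z ⊗ₜ w)) =
        sw (H.coact x) (fun x₀ x₁ => sw (H.coact z) (fun z₀ z₁ => superProd (deg H)
          (inclΛ H x₀ ⊗ₜ (inclA H x₁ * inclΛ H y)) (inclΛ H z₀ ⊗ₜ (inclA H z₁ * inclΛ H w)))) := by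
      rw [comulΛ_tmul x y, map_sw, sw_apply_const, comulΛ_tmul]
      simp only [map_sw]
    rw [h₂, koszul_tmul 𝒜 hy hz]
    simp (disch := fun_prop) only [map_sw, h₁, sw_smul, map_smul, sw_fun_smul,
      ActCoact.braiding_tmul, sw_sw, sw_tmul, comulΛ_tmul, H.sw_coact_mul]
    congr 1
    conv_rhs => rw [sw_comm]
    refine sw_congr _ fun x₀ x₁ => ?_
    rw [H.isCrossedModule.sw_coassoc (fun z₀ b c => inclΛ H (x₀ * z₀) ⊗ₜ[k]
      (inclA H (x₁ * b) * inclΛ H (H.act y c * w))) (by fun_prop) (by fun_prop) (by fun_prop)]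
    refine sw_congr _ fun z₀ z₁ => ?_
    rw [← tmul_sw]
    simp only [map_mul, mul_assoc]
    rw [← mul_assoc (inclΛ H y), inclΛ_mul_inclA, sw_mul, mul_sw]
    simp only [mul_assoc]
  rw [← map_mul, comul_inclΛ, H.comul_mul, comul_inclΛ, comul_inclΛ]
  generalize H.comul η = s
  generalize H.comul ω = t
  induction s with
  | zero => simp
  | add s s' hs hs' => simp only [TensorProduct.add_tmul, map_add, LinearMap.add_apply, hs, hs']
  | tmul x y =>
  induction t with
  | zero => simp
  | add s s' hs hs' => simp only [TensorProduct.tmul_add, map_add, hs, hs']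
  | tmul z w => rw [h]

/-- Writing elements as `a η`, associativity of the super square reduces the claim to a left factor
in `A` and to the products `Λ A` and `Λ Λ`. -/
theorem comul_mul (x y : Bosonisation H) :
    comul H (x * y) = superProd (deg H) (comul H x) (comul H y) := by
  have h₁ (η : Λ) (y : Bosonisation H) : comul H (inclΛ H η * y) =
      superProd (deg H) (comul H (inclΛ H η)) (comul H y) := by
    refine lin_ext (f := fun y => comul H (inclΛ H η * y)) (g := fun y =>
      superProd (deg H) (comul H (inclΛ H η)) (comul H y)) (by fun_prop) (by fun_prop)
      (fun b ω => ?_) y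
    rw [comul_inclA_mul b, ← superProd_assoc, ← comul_inclΛ_mul_inclA, ← mul_assoc,
      inclΛ_mul_inclA, sw_mul, map_sw, map_sw, map_sw, sw_apply_const]
    refine sw_congr _ fun b₁ b₂ => ?_
    rw [mul_assoc, comul_inclA_mul, comul_inclA_mul, comul_inclΛ_mul_inclΛ, superProd_assoc]
  refine lin_ext (f := fun x => comul H (x * y)) (g := fun x =>
      superProd (deg H) (comul H x) (comul H y)) (by fun_prop) (by fun_prop) (fun a η => ?_) x
  rw [mul_assoc, comul_inclA_mul, h₁, comul_inclA_mul, superProd_assoc]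

theorem sw_comul_apply (F : Bosonisation H → Bosonisation H → M)
    (h₁ : ∀ y, Lin k (fun x => F x y)) (h₂ : ∀ x, Lin k (fun y => F x y)) (a : A) (η : Λ) :
    sw (comul H (inclA H a * inclΛ H η)) F =
      sw (δ a) (fun a₁ a₂ => sw (H.comul η) (fun p q => sw (H.coact p) (fun p₀ p₁ =>
        F (inclA H a₁ * inclΛ H p₀) (inclA H (a₂ * p₁) * inclΛ H q)))) := by
  rw [comul_apply]
  simp (disch := fun_prop) only [sw_sw, sw_tmul]

theorem counit_apply (a : A) (η : Λ) : counit H (inclA H a * inclΛ H η) = ε a * H.counit η := by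
  rw [← ofTensor_tmul, counit]
  simp

theorem coassoc (x : Bosonisation H) :
    TensorProduct.assoc k _ _ _ ((comul H).rTensor (Bosonisation H) (comul H x)) =
      (comul H).lTensor (Bosonisation H) (comul H x) := by
  refine lin_ext (f := fun x => TensorProduct.assoc k _ _ _
    ((comul H).rTensor (Bosonisation H) (comul H x))) (g := fun x =>
      (comul H).lTensor (Bosonisation H) (comul H x)) (by fun_prop) (by fun_prop) (fun a η => ?_) x
  have h₀ (s : Bosonisation H ⊗[k] Bosonisation H) (z : Bosonisation H) :
      TensorProduct.assoc k _ _ _ (s ⊗ₜ z) = sw s (fun x y => x ⊗ₜ[k] (y ⊗ₜ[k] z)) := by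
    conv_lhs => rw [← sw_tmul_self s]
    simp only [sw_tmul_const, map_sw_equiv, TensorProduct.assoc_tmul]
  simp only [rTensor_eq_sw, lTensor_eq_sw, map_sw_equiv, h₀]
  simp (disch := fun_prop) only [sw_comul_apply]
  simp only [comul_apply, tmul_sw]
  -- Three rules bring the left-bracketed coproduct to a common form: braided coassociativity for
  -- `η`, colinearity of the braided coproduct for `p`, and coassociativity of the coaction.
  have hl : ∀ (a₁ a₂ : A), sw (H.comul η) (fun p r => sw (H.coact p) (fun p₀ p₁ =>
      sw (δ a₁) (fun b₁ b₂ => sw (H.comul p₀) (fun p q => sw (H.coact p) (fun p₀ p₂ =>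
        (inclA H b₁ * inclΛ H p₀) ⊗ₜ[k] ((inclA H (b₂ * p₂) * inclΛ H q) ⊗ₜ[k]
          (inclA H (a₂ * p₁) * inclΛ H r))))))) =
      sw (δ a₁) (fun b₁ b₂ => sw (H.comul η) (fun p s => sw (H.comul s) (fun q r =>
        sw (H.coact p) (fun p₀ p' => sw (δ p') (fun p₁ p₂ => sw (H.coact q) (fun q₀ q₁ =>
          (inclA H b₁ * inclΛ H p₀) ⊗ₜ[k] ((inclA H (b₂ * p₁) * inclΛ H q₀) ⊗ₜ[k]
            (inclA H (a₂ * (p₂ * q₁)) * inclΛ H r)))))))) := by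
    intro a₁ a₂
    simp only [sw_comm (H.coact _) (δ a₁)]
    rw [sw_comm]
    refine sw_congr _ fun b₁ b₂ => ?_
    rw [← H.sw_coassoc (fun p q r => sw (H.coact p) (fun p₀ p' => sw (δ p') (fun p₁ p₂ =>
      sw (H.coact q) (fun q₀ q₁ =>
          (inclA H b₁ * inclΛ H p₀) ⊗ₜ[k] ((inclA H (b₂ * p₁) * inclΛ H q₀) ⊗ₜ[k]
            (inclA H (a₂ * (p₂ * q₁)) * inclΛ H r))))))
      (by fun_prop) (by fun_prop) (by fun_prop)]
    refine sw_congr _ fun p r => ?_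
    rw [H.sw_comul_coact (fun p q c => sw (H.coact p) (fun p₀ p₂ =>
        (inclA H b₁ * inclΛ H p₀) ⊗ₜ[k] ((inclA H (b₂ * p₂) * inclΛ H q) ⊗ₜ[k]
          (inclA H (a₂ * c) * inclΛ H r)))) (by fun_prop) (by fun_prop) (by fun_prop)]
    refine sw_congr _ fun p q => ?_
    rw [← H.isCrossedModule.sw_coassoc (fun p₀ p₁ p₂ => sw (H.coact q) (fun q₀ q₁ =>
          (inclA H b₁ * inclΛ H p₀) ⊗ₜ[k] ((inclA H (b₂ * p₁) * inclΛ H q₀) ⊗ₜ[k]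
            (inclA H (a₂ * (p₂ * q₁)) * inclΛ H r)))) (by fun_prop) (by fun_prop) (by fun_prop)]
    refine sw_congr _ fun p₀ p₁ => ?_
    rw [sw_comm]
  simp only [hl]
  rw [BraidedCalculus.sw_coassoc (fun b₁ b₂ a₂ => sw (H.comul η) (fun p s => sw (H.comul s)
    (fun q r =>
        sw (H.coact p) (fun p₀ p' => sw (δ p') (fun p₁ p₂ => sw (H.coact q) (fun q₀ q₁ =>
          (inclA H b₁ * inclΛ H p₀) ⊗ₜ[k] ((inclA H (b₂ * p₁) * inclΛ H q₀) ⊗ₜ[k]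
            (inclA H (a₂ * (p₂ * q₁)) * inclΛ H r)))))))) (by fun_prop) (by fun_prop)
    (by fun_prop)]
  simp (disch := fun_prop) only [comul_mul_eq_sw, sw_sw, sw_tmul]
  refine sw_congr _ fun a₁ a₂ => ?_
  rw [sw_comm]
  refine sw_congr _ fun p s => ?_
  rw [sw_comm (H.coact p)]
  refine sw_congr _ fun x y => ?_
  rw [sw_comm]
  refine sw_congr _ fun p₀ p' => ?_
  rw [sw_comm]
  simp only [mul_assoc]

theorem counit_comul (x : Bosonisation H) :
    TensorProduct.lid k _ ((counit H).rTensor (Bosonisation H) (comul H x)) = x := by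
  refine lin_ext (f := fun x => TensorProduct.lid k _
    ((counit H).rTensor (Bosonisation H) (comul H x))) (g := fun x => x)
    (by fun_prop) (by fun_prop) (fun a η => ?_) x
  simp only [rTensor_eq_sw, map_sw_equiv, TensorProduct.lid_tmul]
  simp (disch := fun_prop) only [sw_comul_apply]
  have h (p : Λ) (f : A → Bosonisation H) (hf : Lin k f) :
      sw (H.coact p) (fun p₀ p₁ => H.counit p₀ • f p₁) = H.counit p • f 1 := by
    rw [← hf.map_smul, ← H.coact_comul_counit, hf.map_sw]
    simp only [hf.map_smul]
  simp only [counit_apply, mul_smul, ← smul_sw]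
  rw [BraidedCalculus.sw_counit_left (fun a₂ => sw (H.comul η) (fun p q => sw (H.coact p)
    (fun p₀ p₁ => H.counit p₀ • (inclA H (a₂ * p₁) * inclΛ H q)))) (by fun_prop)]
  have h₁ (p q : Λ) := h p (fun p₁ => inclA H (a * p₁) * inclΛ H q) (by fun_prop)
  simp only [h₁]
  rw [H.sw_counit_left (fun q => inclA H (a * 1) * inclΛ H q) (by fun_prop), mul_one]

theorem comul_counit (x : Bosonisation H) :
    TensorProduct.rid k _ ((counit H).lTensor (Bosonisation H) (comul H x)) = x := by
  refine lin_ext (f := fun x => TensorProduct.rid k _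
    ((counit H).lTensor (Bosonisation H) (comul H x))) (g := fun x => x)
    (by fun_prop) (by fun_prop) (fun a η => ?_) x
  simp only [lTensor_eq_sw, map_sw_equiv, TensorProduct.rid_tmul]
  simp (disch := fun_prop) only [sw_comul_apply]
  simp only [counit_apply, Bialgebra.counit_mul, mul_assoc]
  simp only [mul_comm (ε _) (H.counit _), mul_smul, ← smul_sw]
  rw [BraidedCalculus.sw_counit_right (fun a₁ => sw (H.comul η) (fun p q => H.counit q •
    sw (H.coact p) (fun p₀ p₁ => ε p₁ • (inclA H a₁ * inclΛ H p₀)))) (by fun_prop),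
    H.sw_counit_right (fun p => sw (H.coact p) (fun p₀ p₁ => ε p₁ • (inclA H a * inclΛ H p₀)))
    (by fun_prop), H.isCrossedModule.sw_counit (fun p₀ => inclA H a * inclΛ H p₀) (by fun_prop)]

/-- The antipode `S(a ⊗ η) = S(η₀) S(a η₁)`. -/
def antipode : Bosonisation H →ₗ[k] Bosonisation H :=
  Lin.toMap (fun t => sw t (fun a η => sw (H.coact η) (fun η₀ η₁ =>
    inclΛ H (H.antipode η₀) * inclA H (S (a * η₁))))) (by fun_prop) ∘ₗ
    (ofTensor H).symm.toLinearMap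

theorem antipode_apply (a : A) (η : Λ) : antipode (inclA H a * inclΛ H η) =
    sw (H.coact η) (fun η₀ η₁ => inclΛ H (H.antipode η₀) * inclA H (S (a * η₁))) := by
  rw [← ofTensor_tmul]
  simp (disch := fun_prop) only [antipode, LinearMap.comp_apply, LinearEquiv.coe_coe,
    LinearEquiv.symm_apply_apply, Lin.toMap_apply, sw_tmul]

theorem antipode_mem_deg {n : ℕ} {x : Bosonisation H} (hx : x ∈ deg H n) :
    antipode x ∈ deg H n := by
  refine deg_induction H (P := fun x => antipode x ∈ deg H n) (by simp) (fun a η hη => ?_)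
    (fun x y hx hy => by rw [map_add]; exact add_mem hx hy) hx
  rw [ofTensor_tmul, antipode_apply]
  have h (η₀ : Λ) (h₀ : η₀ ∈ 𝒜 n) (η₁ : A) :
      inclΛ H (H.antipode η₀) * inclA H (S (a * η₁)) ∈ deg H n := by
    have := SetLike.mul_mem_graded (inclΛ_mem_deg H (H.antipode_deg n η₀ h₀))
      (inclA_mem_deg H (S (a * η₁)))
    rwa [add_zero] at this
  exact sw_mem_of_mem_range_rTensor (H.coact_deg n η hη) (by fun_prop) (by fun_prop) h

/-- After coassociativity of the coaction the `A`-factors are `S((a p₁)₁) (a p₁)₂ = ε(a p₁)`, so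
they disappear and leave the braided antipode. -/
theorem sw_antipode_inclA (p q : Λ) (a : A) : sw (δ a) (fun a₁ a₂ => sw (H.coact p) (fun p₀ p₁ =>
    sw (H.coact p₀) (fun η₀ η₁ => inclΛ H (H.antipode η₀) * inclA H (S (a₁ * η₁))) *
      (inclA H (a₂ * p₁) * inclΛ H q))) = ε a • (inclΛ H (H.antipode p) * inclΛ H q) := by
  have h₁ (a₁ a₂ : A) := H.isCrossedModule.sw_coassoc (fun p₀ p₁ p₂ => inclΛ H (H.antipode p₀) *
    inclA H (S (a₁ * p₁)) * (inclA H (a₂ * p₂) * inclΛ H q)) (by fun_prop) (by fun_prop)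
    (by fun_prop) p
  have h₂ (p₀ : Λ) (p₁ : A) := (sw_comm _ _ _).trans (sw_comul_mul (k := k)
    (fun a₁ a₂ => inclΛ H (H.antipode p₀) * inclA H (S a₁) * (inclA H a₂ * inclΛ H q))
    (by fun_prop) (by fun_prop) a p₁).symm
  have h₃ (p₀ : Λ) (b : A) : sw (δ b) (fun a₁ a₂ => inclΛ H (H.antipode p₀) *
      inclA H (S a₁) * (inclA H a₂ * inclΛ H q)) =
      ε b • (inclΛ H (H.antipode p₀) * inclΛ H q) := by
    have := sw_antipode_left (k := k) (fun b =>
      inclΛ H (H.antipode p₀) * (inclA H b * inclΛ H q)) (by fun_prop) b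
    simpa only [map_mul, map_one, one_mul, mul_assoc] using this
  simp only [sw_mul, h₁]
  rw [sw_comm]
  simp only [sw_comm (δ a), h₂, h₃, Bialgebra.counit_mul, mul_smul, ← smul_sw]
  rw [H.isCrossedModule.sw_counit (fun p => inclΛ H (H.antipode p) * inclΛ H q) (by fun_prop)]

theorem mul_antipode_left (x : Bosonisation H) : LinearMap.mul' k _
    (antipode.rTensor (Bosonisation H) (comul H x)) = algebraMap k _ (counit H x) := by
  have h (t : Bosonisation H ⊗[k] Bosonisation H) : LinearMap.mul' k _
      (antipode.rTensor (Bosonisation H) t) = sw t (fun x y => antipode x * y) := by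
    simp only [rTensor_eq_sw, map_sw, LinearMap.mul'_apply]
  refine lin_ext (f := fun x => LinearMap.mul' k _
    (antipode.rTensor (Bosonisation H) (comul H x))) (g := fun x => algebraMap k _ (counit H x))
    (by fun_prop) (by fun_prop) (fun a η => ?_) x
  rw [h, sw_comul_apply _ (by fun_prop) (by fun_prop)]
  simp only [antipode_apply]
  rw [sw_comm]
  simp only [sw_antipode_inclA, ← map_mul, ← smul_sw]
  rw [← map_sw_algHom (inclΛ H), H.sw_antipode_left, counit_apply, map_smul, map_one, smul_smul, Algebra.algebraMap_eq_smul_one]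

theorem mul_antipode_right (x : Bosonisation H) : LinearMap.mul' k _
    (antipode.lTensor (Bosonisation H) (comul H x)) = algebraMap k _ (counit H x) := by
  have h (t : Bosonisation H ⊗[k] Bosonisation H) : LinearMap.mul' k _
      (antipode.lTensor (Bosonisation H) t) = sw t (fun x y => x * antipode y) := by
    simp only [lTensor_eq_sw, map_sw, LinearMap.mul'_apply]
  refine lin_ext (f := fun x => LinearMap.mul' k _
    (antipode.lTensor (Bosonisation H) (comul H x))) (g := fun x => algebraMap k _ (counit H x))
    (by fun_prop) (by fun_prop) (fun a η => ?_) x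
  rw [h, sw_comul_apply _ (by fun_prop) (by fun_prop)]
  -- Product and antipode are colinear, so the two coactions combine into the coaction of `p S(q)`,
  -- and the braided antipode axiom applies before the one of `A`.
  have h₁ (F : Λ → A → Bosonisation H) (hF₁ : ∀ y, Lin k (fun x => F x y))
      (hF₂ : ∀ x, Lin k (F x)) : sw (H.comul η) (fun p q => sw (H.coact p) (fun p₀ p₁ =>
        sw (H.coact q) (fun q₀ q₁ => F (p₀ * H.antipode q₀) (p₁ * q₁)))) =
      H.counit η • F 1 1 := by
    have h₂ (p q : Λ) := H.sw_coact_mul F hF₁ hF₂ p (H.antipode q)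
    have h₃ (p₀ : Λ) (p₁ : A) (q : Λ) := H.sw_coact_antipode (fun q₀ q₁ => F (p₀ * q₀) (p₁ * q₁))
      (by fun_prop) (by fun_prop) q
    simp only [h₃] at h₂
    have h₄ : Lin k (fun x => sw (H.coact x) F) := by fun_prop
    simp only [← h₂]
    rw [← h₄.map_sw, H.sw_antipode_right, h₄.map_smul, H.coact_one, sw_tmul _ _ _ hF₁ hF₂]
  have h₂ (a₁ a₂ : A) := h₁ (fun x b => inclA H a₁ * (inclΛ H x * inclA H (S (a₂ * b))))
    (by fun_prop) (by fun_prop)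
  simp only [map_mul, mul_assoc] at h₂
  simp only [antipode_apply, mul_sw, mul_assoc, h₂, map_one, one_mul, mul_one]
  have h₃ := sw_antipode_right (k := k) (fun b => H.counit η • inclA H b) (by fun_prop) a
  simp only [map_mul] at h₃
  rw [h₃, counit_apply, map_one, smul_smul, Algebra.algebraMap_eq_smul_one]

variable (H) in
theorem isSuperHopf : IsSuperHopf (deg H) (comul H) (counit H) where
  comul_deg n x hx := by
    refine deg_induction H (P := fun x => comul H x ∈ tensorDeg (deg H) n) (by simp)
      (fun a η hη => ?_) (fun x y hx hy => by rw [map_add]; exact add_mem hx hy) hx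
    rw [ofTensor_tmul, comul_apply]
    refine sw_mem _ fun a₁ a₂ => ?_
    refine tensorDeg_induction 𝒜 (f := fun t => sw t (fun p q => sw (H.coact p) (fun p₀ p₁ =>
      (inclA H a₁ * inclΛ H p₀) ⊗ₜ[k] (inclA H (a₂ * p₁) * inclΛ H q)))) (by fun_prop)
      (fun i j hij p hp q hq => ?_) (H.comul_deg n η hη)
    rw [sw_tmul _ _ _ (by fun_prop) (by fun_prop)]
    exact sw_mem_of_mem_range_rTensor (H.coact_deg i p hp) (by fun_prop) (by fun_prop)
      fun p₀ h₀ p₁ => tmul_mem_tensorDeg _ (inclA_mul_inclΛ_mem_deg H _ h₀)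
        (inclA_mul_inclΛ_mem_deg H _ hq) hij
  counit_deg n hn x hx := by
    refine deg_induction H (P := fun x => counit H x = 0) (by simp)
      (fun a η hη => ?_) (fun x y hx hy => by rw [map_add, hx, hy, add_zero]) hx
    rw [ofTensor_tmul, counit_apply, H.counit_deg n hn η hη, mul_zero]
  coassoc := coassoc
  counit_comul := counit_comul
  comul_counit := comul_counit
  comul_one := by
    rw [← map_one (inclA H), comul_inclA, comul_one_eq,
      sw_tmul _ _ _ (by fun_prop) (by fun_prop)]
  counit_one := by
    have h := counit_apply (H := H) 1 1
    rwa [map_one, map_one, mul_one, Bialgebra.counit_one, H.counit_one, mul_one] at h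
  counit_mul x y := by
    refine lin_ext (f := fun x => counit H (x * y)) (g := fun x => counit H x * counit H y)
      (by fun_prop) (by fun_prop) (fun a η => ?_) x
    refine lin_ext (f := fun y => counit H (inclA H a * inclΛ H η * y))
      (g := fun y => counit H (inclA H a * inclΛ H η) * counit H y)
      (by fun_prop) (by fun_prop) (fun b ω => ?_) y
    rw [inclA_mul_inclΛ_mul, map_sw]
    simp only [counit_apply, Bialgebra.counit_mul, H.counit_mul, H.counit_act]
    have h₁ := sw_counit_left (k := k) (fun b => ε a * (ε b * H.counit η * H.counit ω))
      (by fun_prop) b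
    refine Eq.trans (sw_congr _ fun b₁ b₂ => ?_) (h₁.trans ?_)
    · simp only [smul_eq_mul]
      ring
    · ring
  comul_mul := comul_mul
  exists_antipode := ⟨antipode, fun _ _ => antipode_mem_deg, mul_antipode_left, mul_antipode_right⟩

end Bosonisation

/-! ### The exterior derivative on the super-bosonisation -/

namespace Bosonisation

open MaxExterior

variable {k A V M : Type*} [Field k] [Ring A] [HopfAlgebra k A] [AddCommMonoid M] [Module k M]
  [AddCommGroup V] [Module k V] {ϖ : APlus k A →ₗ[k] V} {H : SuperBraidedHopf k A (MaxExterior.deg ϖ)}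
  {q : V →ₗ[k] MaxExterior ϖ} {d : MaxExterior ϖ →ₗ[k] MaxExterior ϖ}

local notation "δ" => Coalgebra.comul (R := k)
local notation "ε" => Coalgebra.counit (R := k)
local notation "S" => HopfAlgebra.antipode k
local notation "π" => parity (MaxExterior.deg ϖ)
local notation "D" => extD H (mcForm ϖ) d

theorem extD_apply (a : A) (η : MaxExterior ϖ) : D (inclA H a * inclΛ H η) =
    sw (δ a) (fun a₁ a₂ => inclA H a₁ * inclΛ H (mcForm ϖ a₂ * η)) +
      inclA H a * inclΛ H (d η) := by
  rw [← ofTensor_tmul, extD]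
  simp only [LinearMap.comp_apply, LinearMap.add_apply, LinearEquiv.coe_coe,
    LinearEquiv.symm_apply_apply, LinearMap.lTensor_tmul, LinearMap.rTensor_tmul, map_add]
  congr 1
  · conv_lhs => rw [← sw_tmul_self (δ a)]
    simp only [sw_tmul_const, map_sw_equiv, map_sw, ← ofTensor_tmul]
    rfl
  · rw [ofTensor_tmul]

variable (hd : IsDeriv q d)
include hd

theorem extD_inclA (a : A) : D (inclA H a) =
    sw (δ a) (fun a₁ a₂ => inclA H a₁ * inclΛ H (mcForm ϖ a₂)) := by
  have h := extD_apply (H := H) (d := d) a 1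
  simpa only [hd.one, map_zero, map_one, mul_zero, mul_one, add_zero] using h

theorem extD_inclΛ (η : MaxExterior ϖ) : D (inclΛ H η) = inclΛ H (d η) := by
  have h := extD_apply (H := H) (d := d) 1 η
  rw [comul_one_eq, sw_tmul _ _ _ (by fun_prop) (by fun_prop)] at h
  simpa only [mcForm_eq, mcV_one, map_zero, zero_mul, mul_zero, map_one, one_mul, zero_add] using h

/-- The product of two forms from differentiating `a` twice cancels, by coassociativity, against the
Maurer-Cartan derivative of the form; the terms with `d η` cancel by the sign in the Leibniz rule.
-/
theorem extD_extD (x : Bosonisation H) : D (D x) = 0 := by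
  refine lin_ext (f := fun x => D (D x)) (g := fun x => 0) (by fun_prop) (by fun_prop)
    (fun a η => ?_) x
  simp only [extD_apply, map_add, map_sw, hd.sq_zero, map_zero, mul_zero, add_zero]
  have h (a : A) (x : MaxExterior ϖ) : d (mcForm ϖ a * x) =
      -sw (δ a) (fun b c => mcForm ϖ b * (mcForm ϖ c * x)) - mcForm ϖ a * d x := by
    rw [mcForm_eq, hd.ι_mul, ← hd.sq, sw_mul]
    simp only [mul_assoc]
  simp only [h, map_sub, map_neg, map_sw_algHom, mul_sub, mul_neg, mul_sw, sw_fun_add, sw_fun_sub,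
    sw_fun_neg]
  rw [BraidedCalculus.sw_coassoc (fun b₁ b₂ b₃ => inclA H b₁ *
    inclΛ H (mcForm ϖ b₂ * (mcForm ϖ b₃ * η))) (by fun_prop) (by fun_prop) (by fun_prop)]
  abel

variable {X : ActCoact k A V} (hY : Extends X H.toActCoact)
  (hϖ : (augmentation k A).IsHom X ϖ)
include hY hϖ

/-- The Leibniz rule on products in `A` is the cocycle identity `mcForm (a b) = mcForm a ◁ b + ε(a)
mcForm b`. -/
theorem extD_inclA_mul (a : A) (x : Bosonisation H) :
    D (inclA H a * x) = D (inclA H a) * x + inclA H a * D x := by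
  refine lin_ext (f := fun x => D (inclA H a * x)) (g := fun x =>
    D (inclA H a) * x + inclA H a * D x) (by fun_prop) (by fun_prop) (fun b η => ?_) x
  have hm (a b : A) : mcForm ϖ (a * b) = H.act (mcForm ϖ a) b + ε a • mcForm ϖ b := by
    rw [mcForm_eq, mcV_mul hϖ, map_add, map_smul, ← hY.act_ι]
    rfl
  rw [← mul_assoc, ← map_mul, extD_apply, extD_inclA hd, extD_apply]
  simp (disch := fun_prop) only [sw_comul_mul, hm]
  have h₁ : sw (δ a) (fun a₁ a₂ => sw (δ b) (fun b₁ b₂ =>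
      ε a₂ • (inclA H (a₁ * b₁) * inclΛ H (mcForm ϖ b₂ * η)))) =
      sw (δ b) (fun b₁ b₂ => inclA H (a * b₁) * inclΛ H (mcForm ϖ b₂ * η)) := by
    rw [← BraidedCalculus.sw_counit_right (fun a => sw (δ b) (fun b₁ b₂ =>
      inclA H (a * b₁) * inclΛ H (mcForm ϖ b₂ * η))) (by fun_prop) a]
    simp only [← smul_sw]
  have h₂ (a₁ a₂ : A) : inclA H a₁ * inclΛ H (mcForm ϖ a₂) * (inclA H b * inclΛ H η) =
      sw (δ b) (fun b₁ b₂ => inclA H (a₁ * b₁) * inclΛ H (H.act (mcForm ϖ a₂) b₂ * η)) := by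
    rw [mul_assoc, ← mul_assoc (inclΛ H _), inclΛ_mul_inclA, sw_mul, mul_sw]
    simp only [map_mul, mul_assoc]
  simp only [sw_mul, h₂, add_mul, smul_mul_assoc, map_add, map_smul, mul_add, mul_smul_comm,
    sw_fun_add, h₁, mul_sw]
  simp only [map_mul, mul_assoc, add_assoc]

/-- Moving `η` past `b` creates `η ◁ b₂`. The failure of `d` to commute with the action, as given by
`act_d`, is exactly the difference between putting the form of `d b` before and after it. -/
theorem extD_inclΛ_mul (η : MaxExterior ϖ) (x : Bosonisation H) :
    D (inclΛ H η * x) = inclΛ H (d η) * x + inclΛ H (π η) * D x := by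
  refine lin_ext (f := fun x => D (inclΛ H η * x)) (g := fun x =>
    inclΛ H (d η) * x + inclΛ H (π η) * D x) (by fun_prop) (by fun_prop) (fun b ω => ?_) x
  have h (ζ ω : MaxExterior ϖ) (b : A) : inclΛ H ζ * (inclA H b * inclΛ H ω) =
      sw (δ b) (fun b₁ b₂ => inclA H b₁ * inclΛ H (H.act ζ b₂ * ω)) := by
    rw [← mul_assoc, inclΛ_mul_inclA, sw_mul]
    simp only [map_mul, mul_assoc]
  have ha (a : A) (x : MaxExterior ϖ) := hd.act_d hY hϖ a x
  simp only [h, extD_apply, map_sw, mul_add, mul_sw, hd.d_mul, ha, hY.parity_act]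
  simp only [add_mul, sub_mul, map_add, map_sub, mul_add, mul_sub, sw_mul, map_sw_algHom, mul_sw,
    sw_fun_add, sw_fun_sub]
  rw [BraidedCalculus.sw_coassoc (fun b₁ b₂ b₃ => inclA H b₁ *
    inclΛ H (mcForm ϖ b₂ * (H.act η b₃ * ω))) (by fun_prop) (by fun_prop) (by fun_prop),
    BraidedCalculus.sw_coassoc (fun b₁ b₂ b₃ => inclA H b₁ *
    inclΛ H (H.act (π η) b₂ * (mcForm ϖ b₃ * ω))) (by fun_prop) (by fun_prop) (by fun_prop)]
  simp only [map_mul, mul_assoc]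
  abel

theorem extD_mul (x y : Bosonisation H) :
    D (x * y) = D x * y + parity (deg H) x * D y := by
  refine lin_ext (f := fun x => D (x * y)) (g := fun x => D x * y + parity (deg H) x * D y)
    (by fun_prop) (by fun_prop) (fun a η => ?_) x
  rw [mul_assoc, extD_inclA_mul hd hY hϖ, extD_inclΛ_mul hd hY hϖ, extD_inclA_mul hd hY hϖ,
    parity_inclA_mul, extD_inclΛ hd]
  simp only [mul_add, add_mul, mul_assoc, add_assoc]

theorem isDGA_extD : IsDGA (deg H) D where
  map_deg n x hx := by
    refine deg_induction H (P := fun x => D x ∈ deg H (n + 1)) (by simp) (fun a η hη => ?_)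
      (fun x y hx hy => by rw [map_add]; exact add_mem hx hy) hx
    rw [ofTensor_tmul, extD_apply]
    refine add_mem (sw_mem _ fun a₁ a₂ => inclA_mul_inclΛ_mem_deg H _ ?_)
      (inclA_mul_inclΛ_mem_deg H _ (hd.map_deg hη))
    have := SetLike.mul_mem_graded (mcForm_mem_deg (ϖ := ϖ) a₂) hη
    rwa [add_comm] at this
  leibniz n x hx y := by
    rw [extD_mul hd hY hϖ, parity_of_mem _ hx, smul_mul_assoc]
  sq_zero := extD_extD hd

end Bosonisation

/-! ### The exterior derivative is a super-coderivation -/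

namespace Bosonisation

open MaxExterior

variable {k A V M : Type*} [Field k] [Ring A] [HopfAlgebra k A] [AddCommMonoid M] [Module k M]
  [AddCommGroup V] [Module k V] {ϖ : APlus k A →ₗ[k] V}
  {H : SuperBraidedHopf k A (MaxExterior.deg ϖ)}
  {q : V →ₗ[k] MaxExterior ϖ} {d : MaxExterior ϖ →ₗ[k] MaxExterior ϖ}

local notation "δ" => Coalgebra.comul (R := k)
local notation "ε" => Coalgebra.counit (R := k)
local notation "S" => HopfAlgebra.antipode k
local notation "D" => extD H (mcForm ϖ) d

variable (H d) in
/-- The super-derivation `d ⊗ id + (-1)^{| |} ⊗ d` of the tensor square of the bosonisation. -/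
def tensorD : Module.End k (Bosonisation H ⊗[k] Bosonisation H) :=
  (extD H (mcForm ϖ) d).rTensor (Bosonisation H) +
    TensorProduct.map (parity (deg H)) (extD H (mcForm ϖ) d)

theorem tensorD_tmul (x y : Bosonisation H) : tensorD H d (x ⊗ₜ y) =
    D x ⊗ₜ y + parity (deg H) x ⊗ₜ D y := rfl

variable (hd : IsDeriv q d) {X : ActCoact k A V} (hY : Extends X H.toActCoact)
  (hϖ : (augmentation k A).IsHom X ϖ)
include hd hY hϖ

/-- Of the two terms of the primitive coproduct, `1 ⊗ v` gives `a₁ ⊗ d a₂` at once, and `v ⊗ 1`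
gives `d a₁ ⊗ a₂` after `sw_mul_coact_mcV` absorbs the leg of `a` in front of the coaction. -/
theorem comul_extD_inclA (hprim : ∀ v, H.comul (ι ϖ v) = ι ϖ v ⊗ₜ 1 + 1 ⊗ₜ ι ϖ v) (a : A) :
    comul H (D (inclA H a)) = sw (δ a) (fun a₁ a₂ => tensorD H d (inclA H a₁ ⊗ₜ inclA H a₂)) := by
  have hp (a : A) : parity (deg H) (inclA H a) = inclA H a := by
    rw [parity_of_mem _ (inclA_mem_deg H a), pow_zero, one_smul]
  have h₁ (x y : MaxExterior ϖ) (F : MaxExterior ϖ → MaxExterior ϖ →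
      Bosonisation H ⊗[k] Bosonisation H) (h₁ : ∀ y, Lin k (fun x => F x y))
      (h₂ : ∀ x, Lin k (F x)) : sw (x ⊗ₜ[k] 1 + 1 ⊗ₜ[k] y) F = F x 1 + F 1 y := by
    rw [sw_add _ _ _ h₁ h₂, sw_tmul _ _ _ h₁ h₂, sw_tmul _ _ _ h₁ h₂]
  rw [extD_inclA hd, map_sw]
  simp (disch := fun_prop) only [comul_apply, mcForm_eq, hprim, h₁, hY.coact_one, hY.sw_coact_ι,
    sw_tmul, map_one, mul_one]
  simp only [tensorD_tmul, extD_inclA hd, hp, sw_fun_add, sw_tmul_const, tmul_sw, ← mcForm_eq]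
  congr 1
  · rw [BraidedCalculus.sw_coassoc (fun a₁ b₂ a₂ => sw (X.coact (mcV ϖ a₂)) (fun p₀ p₁ =>
      (inclA H a₁ * inclΛ H (ι ϖ p₀)) ⊗ₜ[k] inclA H (b₂ * p₁))) (by fun_prop) (by fun_prop)
      (by fun_prop), BraidedCalculus.sw_coassoc (fun a₁ b₂ a₂ =>
        (inclA H a₁ * inclΛ H (mcForm ϖ b₂)) ⊗ₜ[k] inclA H a₂) (by fun_prop) (by fun_prop)
      (by fun_prop)]
    exact sw_congr _ fun a₁ a₂ => sw_mul_coact_mcV hϖ (fun p b =>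
      (inclA H a₁ * inclΛ H (ι ϖ p)) ⊗ₜ[k] inclA H b) (by fun_prop) (by fun_prop) a₂
  · rw [BraidedCalculus.sw_coassoc (fun a₁ b₂ a₂ =>
      inclA H a₁ ⊗ₜ[k] (inclA H b₂ * inclΛ H (mcForm ϖ a₂))) (by fun_prop) (by fun_prop)
      (by fun_prop)]

theorem tensorD_superProd (a b : A) (t : Bosonisation H ⊗[k] Bosonisation H) :
    tensorD H d (superProd (deg H) (inclA H a ⊗ₜ inclA H b) t) =
      superProd (deg H) (tensorD H d (inclA H a ⊗ₜ inclA H b)) t +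
        superProd (deg H) (inclA H a ⊗ₜ inclA H b) (tensorD H d t) := by
  have hp (a : A) : parity (deg H) (inclA H a) = inclA H a := by
    rw [parity_of_mem _ (inclA_mem_deg H a), pow_zero, one_smul]
  have hD (b : A) := (isDGA_extD hd hY hϖ).map_deg 0 _ (inclA_mem_deg H b)
  induction t with
  | zero => simp
  | add s t hs ht =>
    simp only [map_add, hs, ht]
    abel
  | tmul x y =>
    simp only [superProd_of_mem_zero _ _ _ _ (inclA_mem_deg H _), tensorD_tmul, map_add,
      LinearMap.add_apply, superProd_of_mem_one _ _ _ _ (hD b), parity_mul, hp,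
      extD_inclA_mul hd hY hϖ, TensorProduct.add_tmul, TensorProduct.tmul_add]
    abel

/-- The coproduct inserts `p₁ ∈ A` between the two factors, and differentiating it gives `p₁
mcForm(p₂)`. By coassociativity of the coaction this is the sliding term of `tensorDeriv`. -/
theorem tensorD_comulΛ (t : MaxExterior ϖ ⊗[k] MaxExterior ϖ) :
    tensorD H d (comulΛ H t) = comulΛ H (IsDeriv.tensorDeriv d H.toActCoact t) := by
  have hp (x : MaxExterior ϖ) : parity (deg H) (inclΛ H x) =
      inclΛ H (parity (MaxExterior.deg ϖ) x) := by
    have := parity_inclA_mul (H := H) 1 x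
    rwa [map_one, one_mul, one_mul] at this
  induction t with
  | zero => simp
  | add s t hs ht => simp only [map_add, hs, ht]
  | tmul x y =>
    rw [IsDeriv.tensorDeriv_tmul, map_add, map_add, map_sw]
    simp (disch := fun_prop) only [comulΛ_tmul, map_sw, tensorD_tmul, extD_inclΛ hd, extD_apply,
      hp, hd.sw_coact_d hY hϖ, hY.sw_coact_parity, TensorProduct.tmul_add, sw_fun_add, tmul_sw]
    rw [H.isCrossedModule.sw_coassoc (fun x₀ x₁ x₂ =>
      inclΛ H (parity (MaxExterior.deg ϖ) x₀) ⊗ₜ[k] (inclA H x₁ * inclΛ H (mcForm ϖ x₂ * y)))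
      (by fun_prop) (by fun_prop) (by fun_prop)]
    abel

theorem comul_extD (hprim : ∀ v, H.comul (ι ϖ v) = ι ϖ v ⊗ₜ 1 + 1 ⊗ₜ ι ϖ v)
    (hcomul : ∀ x, H.comul (d x) = IsDeriv.tensorDeriv d H.toActCoact (H.comul x)) (x : Bosonisation H) :
    comul H (D x) = tensorD H d (comul H x) := by
  refine lin_ext (f := fun x => comul H (D x)) (g := fun x => tensorD H d (comul H x))
    (by fun_prop) (by fun_prop) (fun a η => ?_) x
  rw [extD_inclA_mul hd hY hϖ, map_add, comul_mul, comul_mul, comul_extD_inclA hd hY hϖ hprim,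
    comul_inclA, extD_inclΛ hd, comul_inclΛ, comul_inclΛ, hcomul, ← tensorD_comulΛ hd hY hϖ,
    comul_inclA_mul_inclΛ]
  simp only [map_sw, sw_apply_const, tensorD_superProd hd hY hϖ, sw_fun_add]

end Bosonisation

/-! ### The first order calculus -/

section FirstOrder

variable {k A V : Type*} [Field k] [Ring A] [HopfAlgebra k A] [AddCommGroup V] [Module k V]
  {X : ActCoact k A V} {ϖ : APlus k A →ₗ[k] V}

local notation "δ" => Coalgebra.comul (R := k)
local notation "ε" => Coalgebra.counit (R := k)
local notation "S" => HopfAlgebra.antipode k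

theorem firstOrder_left (a b : A) (v : V) :
    (firstOrder X ϖ).left a (b ⊗ₜ v) = (a * b) ⊗ₜ v := rfl

theorem firstOrder_right (c b : A) (v : V) : (firstOrder X ϖ).right c (b ⊗ₜ v) =
    sw (δ c) (fun c₁ c₂ => (b * c₁) ⊗ₜ[k] X.act v c₂) := by
  simp only [firstOrder, sweedler_eq_sw, sw_apply_const]
  rfl

theorem firstOrder_d (a : A) : (firstOrder X ϖ).d a =
    sw (δ a) (fun a₁ a₂ => a₁ ⊗ₜ[k] mcV ϖ a₂) := by
  simp only [firstOrder, LinearMap.comp_apply, lTensor_eq_sw]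
  rfl

theorem isFirstOrder (hX : X.IsCrossedModule) (hϖ : (augmentation k A).IsHom X ϖ)
    (hsurj : Function.Surjective ϖ) : (firstOrder X ϖ).IsFirstOrder where
  left_one m := by
    induction m with
    | zero => simp
    | add s t hs ht => simp only [map_add, hs, ht]
    | tmul a v => rw [firstOrder_left, one_mul]
  left_mul a b m := by
    induction m with
    | zero => simp
    | add s t hs ht => simp only [map_add, hs, ht]
    | tmul c v => simp only [firstOrder_left, mul_assoc]
  right_one m := by
    induction m with
    | zero => simp
    | add s t hs ht => simp only [map_add, hs, ht]
    | tmul a v =>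
      rw [firstOrder_right, comul_one_eq, sw_tmul _ _ _ (by fun_prop) (by fun_prop), mul_one,
        hX.act_one]
  right_mul a b m := by
    induction m with
    | zero => simp
    | add s t hs ht => simp only [map_add, hs, ht]
    | tmul c v =>
      simp (disch := fun_prop) only [firstOrder_right, Bosonisation.sw_comul_mul, map_sw, mul_assoc,
        hX.act_mul]
  left_right a b m := by
    induction m with
    | zero => simp
    | add s t hs ht => simp only [map_add, hs, ht]
    | tmul c v => simp only [firstOrder_left, firstOrder_right, map_sw, mul_assoc]
  leibniz a b := by
    simp (disch := fun_prop) only [firstOrder_d, Bosonisation.sw_comul_mul, map_sw, firstOrder_left,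
      firstOrder_right, mcV_mul hϖ, TensorProduct.tmul_add, TensorProduct.tmul_smul, sw_fun_add]
    congr 1
    rw [← sw_counit_right (fun a => sw (δ b) (fun b₁ b₂ => (a * b₁) ⊗ₜ[k] mcV ϖ b₂))
      (by fun_prop) a]
    simp only [← smul_sw]
  span_eq_top := by
    rw [eq_top_iff]
    rintro m -
    induction m with
    | zero => exact zero_mem _
    | add s t hs ht => exact add_mem hs ht
    | tmul b v =>
      obtain ⟨a, -, rfl⟩ := MaxExterior.exists_eq_mcV hsurj v
      -- This exhibits `b ⊗ mcV a` as `b S(a₁) d a₂`.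
      have h := sw_antipode_mul_cancel (k := k) (fun p a => (b * p) ⊗ₜ[k] mcV ϖ a) (by fun_prop)
        (by fun_prop) a
      rw [mul_one] at h
      rw [← h]
      refine sw_mem _ fun a₁ a₂ => Submodule.subset_span ⟨b * S a₁, a₂, ?_⟩
      simp only [firstOrder_d, map_sw, firstOrder_left, mul_assoc]

end FirstOrder

namespace MaxExterior

/-- In the square-zero extension of `k` by `V` all products of elements of `V` vanish, so every
quadratic relation holds and the extension receives a map from `Λ_max` that is injective on `V`. -/
theorem ι_injective {k A V : Type*} [Field k] [Ring A] [HopfAlgebra k A] [AddCommGroup V]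
    [Module k V] (ϖ : APlus k A →ₗ[k] V) : Function.Injective (ι ϖ) := by
  let : Module kᵐᵒᵖ V := Module.compHom _ ((RingHom.id k).fromOpposite mul_comm)
  have : IsCentralScalar k V := ⟨fun r m => rfl⟩
  obtain ⟨F, hF⟩ := exists_lift (ϖ := ϖ) (TrivSqZeroExt.inrHom k V) (fun a _ _ => by
    simp only [TrivSqZeroExt.inrHom_apply, TrivSqZeroExt.inr_mul_inr, sw_fun_zero])
  intro v w h
  have h' := congrArg F h
  rw [hF, hF] at h'
  exact TrivSqZeroExt.inr_injective h'

end MaxExterior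

/-! ### The maximal prolongation -/

namespace Bosonisation

open MaxExterior

variable {k A V : Type*} [Field k] [Ring A] [HopfAlgebra k A]
  [AddCommGroup V] [Module k V] {ϖ : APlus k A →ₗ[k] V}
  {H : SuperBraidedHopf k A (MaxExterior.deg ϖ)}
  {q : V →ₗ[k] MaxExterior ϖ} {d : MaxExterior ϖ →ₗ[k] MaxExterior ϖ}

local notation "δ" => Coalgebra.comul (R := k)
local notation "ε" => Coalgebra.counit (R := k)
local notation "S" => HopfAlgebra.antipode k
local notation "D" => extD H (mcForm ϖ) d

theorem inclOne_tmul (a : A) (v : V) : inclOne H (a ⊗ₜ v) = inclA H a * inclΛ H (ι ϖ v) := by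
  rw [← ofTensor_tmul]
  rfl

theorem inclA_injective : Function.Injective (inclA H) := by
  have h (a : A) : TensorProduct.rid k A (H.counit.lTensor A ((ofTensor H).symm (inclA H a))) =
      a := by
    have : (ofTensor H).symm (inclA H a) = a ⊗ₜ 1 := rfl
    rw [this, LinearMap.lTensor_tmul, H.counit_one, TensorProduct.rid_tmul, one_smul]
  intro a b hab
  rw [← h a, hab, h]

theorem range_inclA : LinearMap.range (inclA H).toLinearMap = deg H 0 := by
  refine le_antisymm ?_ fun x hx => ?_
  · rintro _ ⟨a, rfl⟩
    exact inclA_mem_deg H a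
  · refine deg_induction H (P := fun x => x ∈ LinearMap.range (inclA H).toLinearMap)
      (zero_mem _) (fun a η hη => ?_) (fun x y hx hy => add_mem hx hy) hx
    rw [MaxExterior.deg, pow_zero, Submodule.mem_one] at hη
    obtain ⟨c, rfl⟩ := hη
    refine ⟨c • a, ?_⟩
    rw [ofTensor_tmul, AlgHom.commutes, AlgHom.toLinearMap_apply, map_smul,
      Algebra.algebraMap_eq_smul_one, mul_smul_comm, mul_one]

theorem inclOne_injective : Function.Injective (inclOne H) :=
  (ofTensor H).injective.comp
    (Module.Flat.lTensor_preserves_injective_linearMap (M := A) _ (ι_injective ϖ))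

theorem inclOne_mem_deg (m : A ⊗[k] V) : inclOne H m ∈ deg H 1 := by
  induction m with
  | zero => simp
  | add s t hs ht =>
    rw [map_add]
    exact add_mem hs ht
  | tmul a v =>
    rw [inclOne_tmul]
    exact inclA_mul_inclΛ_mem_deg H a (ι_mem_deg v)

theorem range_inclOne : LinearMap.range (inclOne H) = deg H 1 := by
  refine le_antisymm ?_ fun x hx => ?_
  · rintro _ ⟨m, rfl⟩
    exact inclOne_mem_deg m
  · refine deg_induction H (P := fun x => x ∈ LinearMap.range (inclOne H))
      (zero_mem _) (fun a η hη => ?_) (fun x y hx hy => add_mem hx hy) hx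
    rw [MaxExterior.deg, pow_one] at hη
    obtain ⟨v, rfl⟩ := hη
    exact ⟨a ⊗ₜ v, by rw [inclOne_tmul, ofTensor_tmul]⟩

theorem adjoin_range : Algebra.adjoin k (Set.range (inclA H) ∪ Set.range (inclOne H)) = ⊤ := by
  rw [eq_top_iff]
  rintro x -
  set T := Algebra.adjoin k (Set.range (inclA H) ∪ Set.range (inclOne H))
  have hA (a : A) : inclA H a ∈ T := Algebra.subset_adjoin (Or.inl ⟨a, rfl⟩)
  have hΛ : (⊤ : Subalgebra k (MaxExterior ϖ)) ≤ T.comap (inclΛ H) := by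
    rw [← adjoin_range_ι]
    refine Algebra.adjoin_le ?_
    rintro _ ⟨v, rfl⟩
    refine Algebra.subset_adjoin (Or.inr ⟨1 ⊗ₜ v, ?_⟩)
    rw [inclOne_tmul, map_one, one_mul]
    rfl
  obtain ⟨t, rfl⟩ := (ofTensor H).surjective x
  induction t with
  | zero =>
    rw [map_zero]
    exact zero_mem _
  | add s t hs ht =>
    rw [map_add]
    exact add_mem hs ht
  | tmul a η =>
    rw [ofTensor_tmul]
    exact mul_mem (hA a) (hΛ (Algebra.mem_top (x := η)))

variable (hd : IsDeriv q d) {X : ActCoact k A V} (hY : Extends X H.toActCoact)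
  (hϖ : (augmentation k A).IsHom X ϖ)
include hd hY hϖ

theorem isExteriorAlgebra : (firstOrder X ϖ).IsExteriorAlgebra (deg H) D (inclA H) (inclOne H) where
  isDGA := isDGA_extD hd hY hϖ
  deg_zero := inclA_mem_deg H
  deg_one := inclOne_mem_deg
  left a m := by
    induction m with
    | zero => simp
    | add s t hs ht => simp only [map_add, hs, ht, mul_add]
    | tmul b v => rw [firstOrder_left, inclOne_tmul, inclOne_tmul, map_mul, mul_assoc]
  right a m := by
    induction m with
    | zero => simp
    | add s t hs ht => simp only [map_add, hs, ht, add_mul]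
    | tmul b v =>
      have h (c : A) : H.act (ι ϖ v) c = ι ϖ (X.act v c) := hY.act_ι v c
      rw [firstOrder_right, map_sw, inclOne_tmul, mul_assoc, inclΛ_mul_inclA, mul_sw]
      simp only [inclOne_tmul, map_mul, mul_assoc, h]
  d_comm a := by
    rw [extD_inclA hd, firstOrder_d, map_sw]
    simp only [inclOne_tmul, mcForm_eq]
  injective_zero := inclA_injective
  range_zero := range_inclA
  injective_one := inclOne_injective
  range_one := range_inclOne
  generated := adjoin_range

/-! ### Differential graded algebras that receive the first order calculus -/

section Universal

variable {B : Type*} [Ring B] [Algebra k B] {ℬ : ℕ → Submodule k B} [GradedAlgebra ℬ]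
  {dB : B →ₗ[k] B} {j₀ : A →ₐ[k] B} {j₁ : A ⊗[k] V →ₗ[k] B}
  (hj : (firstOrder X ϖ).MapsTo ℬ dB j₀ j₁)
include hj

omit hd hY hϖ

theorem mapsTo_tmul (a : A) (v : V) : j₁ (a ⊗ₜ v) = j₀ a * j₁ (1 ⊗ₜ v) := by
  rw [← hj.left, firstOrder_left, mul_one]

theorem mapsTo_mul (v : V) (b : A) : j₁ (1 ⊗ₜ v) * j₀ b =
    sw (δ b) (fun b₁ b₂ => j₀ b₁ * j₁ (1 ⊗ₜ X.act v b₂)) := by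
  rw [← hj.right, firstOrder_right, map_sw]
  simp only [one_mul]
  exact sw_congr _ fun b₁ b₂ => mapsTo_tmul hj b₁ _

theorem mapsTo_d (a : A) : dB (j₀ a) =
    sw (δ a) (fun a₁ a₂ => j₀ a₁ * j₁ (1 ⊗ₜ mcV ϖ a₂)) := by
  rw [hj.d_comm, firstOrder_d, map_sw]
  exact sw_congr _ fun a₁ a₂ => mapsTo_tmul hj a₁ _

/-- Expanding `d² j₀(a) = 0` gives the Maurer-Cartan expression of `a₂` with the factor `j₀ a₁` in
front. Multiplying by `j₀ (S a₁)` and cancelling removes that factor. -/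
theorem mapsTo_maurerCartan (a : A) : dB (j₁ (1 ⊗ₜ mcV ϖ a)) =
    -sw (δ a) (fun a₁ a₂ => j₁ (1 ⊗ₜ mcV ϖ a₁) * j₁ (1 ⊗ₜ mcV ϖ a₂)) := by
  have h (a : A) : sw (δ a) (fun a₁ a₂ => j₀ a₁ * (sw (δ a₂) (fun b c =>
      j₁ (1 ⊗ₜ mcV ϖ b) * j₁ (1 ⊗ₜ mcV ϖ c)) + dB (j₁ (1 ⊗ₜ mcV ϖ a₂)))) = 0 := by
    have h := hj.isDGA.sq_zero (j₀ a)
    rw [mapsTo_d hj, map_sw] at h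
    have h₂ (a : A) (y : B) : dB (j₀ a * y) =
        sw (δ a) (fun a₁ a₂ => j₀ a₁ * j₁ (1 ⊗ₜ mcV ϖ a₂)) * y + j₀ a * dB y := by
      rw [hj.isDGA.leibniz 0 _ (hj.deg_zero a), pow_zero, one_smul, mapsTo_d hj]
    simp only [h₂, sw_mul, sw_fun_add] at h
    rw [sw_coassoc (fun b c a₂ => j₀ b * j₁ (1 ⊗ₜ mcV ϖ c) * j₁ (1 ⊗ₜ mcV ϖ a₂)) (by fun_prop)
      (by fun_prop) (by fun_prop)] at h
    simpa only [mul_add, sw_fun_add, mul_sw, mul_assoc] using h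
  have h₁ := sw_antipode_mul_cancel (k := k) (fun p a => j₀ p * (sw (δ a) (fun b c =>
      j₁ (1 ⊗ₜ mcV ϖ b) * j₁ (1 ⊗ₜ mcV ϖ c)) + dB (j₁ (1 ⊗ₜ mcV ϖ a)))) (by fun_prop)
      (by fun_prop) a
  rw [map_one, one_mul] at h₁
  rw [eq_neg_iff_add_eq_zero, add_comm, ← h₁]
  refine (sw_congr _ fun a₁ a₂ => ?_).trans (sw_fun_zero _)
  simp only [map_mul, mul_assoc]
  rw [← mul_sw, h, mul_zero]

/-- When `mcV a = 0` the left side of `mapsTo_maurerCartan` vanishes, and what is left is the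
quadratic relation in `B`. -/
theorem exists_algHom : ∃ F : MaxExterior ϖ →ₐ[k] B, ∀ v, F (ι ϖ v) = j₁ (1 ⊗ₜ v) := by
  refine exists_lift (Lin.toMap (fun v => j₁ (1 ⊗ₜ v)) (by fun_prop)) fun a _ h => ?_
  have := mapsTo_maurerCartan hj a
  rw [h, TensorProduct.tmul_zero, map_zero, map_zero, zero_eq_neg] at this
  exact this

variable {F : MaxExterior ϖ →ₐ[k] B} (hF : ∀ v, F (ι ϖ v) = j₁ (1 ⊗ₜ v))
include hF

theorem algHom_mul (hY : Extends X H.toActCoact) (η : MaxExterior ϖ) (b : A) : F η * j₀ b =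
    sw (δ b) (fun b₁ b₂ => j₀ b₁ * F (H.act η b₂)) := by
  refine MaxExterior.lin_ext (f := fun b η => F η * j₀ b)
    (g := fun b η => sw (δ b) (fun b₁ b₂ => j₀ b₁ * F (H.act η b₂)))
    (fun _ => by fun_prop) (fun _ => by fun_prop) (fun b => ?_) (fun v η h b => ?_) b η
  · have h (b : A) : H.act 1 b = ε b • 1 := hY.one_act b
    simp only [h, map_smul, map_one, mul_smul_comm, mul_one, one_mul]
    rw [BraidedCalculus.sw_counit_right (fun b => j₀ b) (by fun_prop)]
  · have h₁ (b : A) : H.act (ι ϖ v * η) b =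
        sw (δ b) (fun b₁ b₂ => ι ϖ (X.act v b₁) * H.act η b₂) := by
      refine (hY.mul_act _ _ _).trans (sw_congr _ fun b₁ b₂ => ?_)
      rw [hY.act_ι]
    simp only [h₁, map_sw_algHom, mul_sw, map_mul, mul_assoc, h, hF]
    simp only [← mul_assoc, mapsTo_mul hj, sw_mul]
    rw [BraidedCalculus.sw_coassoc (fun b₁ c b₂ =>
      j₀ b₁ * j₁ (1 ⊗ₜ X.act v c) * F (H.act η b₂)) (by fun_prop) (by fun_prop) (by fun_prop)]

theorem algHom_d (hd : IsDeriv q d) (η : MaxExterior ϖ) : F (d η) = dB (F η) := by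
  refine MaxExterior.lin_ext (J := Unit) (f := fun _ η => F (d η)) (g := fun _ η => dB (F η))
    (fun _ => by fun_prop) (fun _ => by fun_prop) (fun _ => ?_) (fun v η h _ => ?_) () η
  · have h := hj.isDGA.leibniz 0 1 SetLike.GradedOne.one_mem 1
    rw [pow_zero, one_smul, mul_one, mul_one, one_mul, left_eq_add] at h
    rw [hd.one, map_one, map_zero, h]
  · obtain ⟨a, -, rfl⟩ := exists_eq_mcV hd.surj v
    have h₁ : F (q (mcV ϖ a)) =
        sw (δ a) (fun a₁ a₂ => j₁ (1 ⊗ₜ mcV ϖ a₁) * j₁ (1 ⊗ₜ mcV ϖ a₂)) := by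
      rw [← hd.sq, map_sw_algHom]
      simp only [map_mul, mcForm_eq, hF]
    rw [hd.ι_mul, map_sub, map_neg, map_mul, map_mul, map_mul, h₁, h (), hF,
      hj.isDGA.leibniz 1 _ (hj.deg_one _), mapsTo_maurerCartan hj, pow_one, neg_one_smul, neg_mul,
      sub_eq_add_neg]

theorem algHom_mem_deg {n : ℕ} {η : MaxExterior ϖ} (hη : η ∈ MaxExterior.deg ϖ n) :
    F η ∈ ℬ n := by
  refine mem_of_mem_deg (J := Unit) (f := fun _ η => F η) (fun _ => by fun_prop) (fun _ => ?_)
    (fun n v x _ h _ => ?_) hη ()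
  · rw [map_one]
    exact SetLike.GradedOne.one_mem
  · have := SetLike.mul_mem_graded (hj.deg_one (1 ⊗ₜ v)) (h ())
    rwa [map_mul, hF, add_comm n]

end Universal

theorem isMaximalProlongation : Calculus.IsMaximalProlongation.{w} (firstOrder X ϖ) (deg H) D
    (inclA H) (inclOne H) where
  toIsExteriorAlgebra := isExteriorAlgebra hd hY hϖ
  universal B _ _ ℬ _ dB j₀ j₁ hj := by
    obtain ⟨F, hF⟩ := exists_algHom hj
    -- The value on `a ⊗ η` is forced, as `a ⊗ η` is the product of `a` and `η`. Multiplicativity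
    -- holds because `F η * j₀ b` obeys the cross relation.
    let G : Bosonisation H →ₗ[k] B := Lin.toMap (fun t => sw t (fun a η => j₀ a * F η))
      (by fun_prop) ∘ₗ (ofTensor H).symm.toLinearMap
    have hG (a : A) (η : MaxExterior ϖ) : G (inclA H a * inclΛ H η) = j₀ a * F η := by
      rw [← ofTensor_tmul]
      simp (disch := fun_prop) only [G, LinearMap.comp_apply, LinearEquiv.coe_coe,
        LinearEquiv.symm_apply_apply, Lin.toMap_apply, sw_tmul]
    have hG_one : G 1 = 1 := by
      have := hG 1 1
      simpa only [map_one, mul_one] using this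
    have hG_mul (x y : Bosonisation H) : G (x * y) = G x * G y := by
      refine lin_ext (f := fun x => G (x * y)) (g := fun x => G x * G y) (by fun_prop)
        (by fun_prop) (fun a η => ?_) x
      refine lin_ext (f := fun y => G (inclA H a * inclΛ H η * y))
        (g := fun y => G (inclA H a * inclΛ H η) * G y) (by fun_prop)
        (by fun_prop) (fun b ω => ?_) y
      rw [inclA_mul_inclΛ_mul, map_sw, hG, hG]
      simp only [hG]
      simp only [map_mul, mul_assoc]
      rw [← mul_assoc (F η), algHom_mul hj hF hY, sw_mul, mul_sw]
      simp only [mul_assoc]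
    let G' : Bosonisation H →ₐ[k] B := AlgHom.ofLinearMap G hG_one hG_mul
    have hG₀ (a : A) : G' (inclA H a) = j₀ a := by
      have : G (inclA H a) = j₀ a := by simpa only [map_one, mul_one] using hG a 1
      exact this
    have hG₁ (m : A ⊗[k] V) : G' (inclOne H m) = j₁ m := by
      induction m with
      | zero => simp
      | add s t hs ht => simp only [map_add, hs, ht]
      | tmul a v =>
        rw [inclOne_tmul, mapsTo_tmul hj, ← hF]
        exact hG a (ι ϖ v)
    refine ⟨G', ⟨fun n x hx => ?_, fun x => ?_, hG₀, hG₁⟩, ?_⟩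
    · refine deg_induction H (P := fun x => G' x ∈ ℬ n) (by simp) (fun a η hη => ?_)
        (fun x y hx hy => by rw [map_add]; exact add_mem hx hy) hx
      have := SetLike.mul_mem_graded (hj.deg_zero a) (algHom_mem_deg hj hF hη)
      rw [zero_add] at this
      rw [ofTensor_tmul]
      exact (hG a η).symm ▸ this
    · change G (D x) = dB (G x)
      refine lin_ext (f := fun x => G (D x)) (g := fun x => dB (G x)) (by fun_prop)
        (by fun_prop) (fun a η => ?_) x
      rw [extD_apply, map_add, map_sw, hG, hG, hj.isDGA.leibniz 0 _ (hj.deg_zero a), pow_zero,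
        one_smul, mapsTo_d hj, algHom_d hj hF hd, sw_mul]
      simp only [hG]
      simp only [map_mul, mcForm_eq, hF, mul_assoc]
    · rintro G'' ⟨-, -, h₀, h₁⟩
      refine AlgHom.ext_of_adjoin_eq_top adjoin_range ?_
      rintro _ (⟨a, rfl⟩ | ⟨m, rfl⟩)
      · rw [h₀, hG₀]
      · rw [h₁, hG₁]

end Bosonisation

end BraidedCalculus

end

theorem proposition2p2 {k : Type u} {A : Type v} {V : Type x} [Field k] [Ring A] [HopfAlgebra k A]
    [AddCommGroup V] [Module k V] (X : ActCoact k A V) (hX : X.IsCrossedModule)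
    (ϖ : APlus k A →ₗ[k] V) (hϖ : (augmentation k A).IsHom X ϖ)
    (hsurj : Function.Surjective ϖ) :
    ∃ H : SuperBraidedHopf k A (MaxExterior.deg ϖ),
      X.IsHom H.toActCoact (MaxExterior.ι ϖ) ∧
      (∀ v, H.comul (MaxExterior.ι ϖ v) =
        MaxExterior.ι ϖ v ⊗ₜ 1 + 1 ⊗ₜ MaxExterior.ι ϖ v) ∧
      ∃ d : MaxExterior ϖ →ₗ[k] MaxExterior ϖ,
        IsDGA (MaxExterior.deg ϖ) d ∧
        MaurerCartan ϖ d ∧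
        (∀ d' : MaxExterior ϖ →ₗ[k] MaxExterior ϖ,
          (∀ n, ∀ η ∈ MaxExterior.deg ϖ n, ∀ ω,
            d' (η * ω) = d' η * ω + (-1 : k) ^ n • (η * d' ω)) →
          MaurerCartan ϖ d' → d' = d) ∧
        (∀ η, H.coact (d η) = d.rTensor A (H.coact η)) ∧
        ActionCompatible H d ∧
        CoproductCompatible H d ∧
        (firstOrder X ϖ).IsFirstOrder ∧
        Calculus.IsMaximalProlongation.{w} (firstOrder X ϖ) (Bosonisation.deg H)
          (Bosonisation.extD H (MaxExterior.mcForm ϖ) d) (Bosonisation.inclA H) (inclOne H) ∧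
        IsSuperHopf (Bosonisation.deg H) (Bosonisation.comul H) (Bosonisation.counit H) ∧
        (∀ x, Bosonisation.comul H (Bosonisation.extD H (MaxExterior.mcForm ϖ) d x) =
          (Bosonisation.extD H (MaxExterior.mcForm ϖ) d).rTensor _ (Bosonisation.comul H x) +
          TensorProduct.map (parity (Bosonisation.deg H))
            (Bosonisation.extD H (MaxExterior.mcForm ϖ) d) (Bosonisation.comul H x)) := by
  obtain ⟨Y, hY⟩ := MaxExterior.exists_extends hϖ hsurj
  obtain ⟨Δ, hΔ⟩ := hY.exists_isComul hX hϖ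
  obtain ⟨q, d, hd⟩ := MaxExterior.exists_isDeriv hsurj
  have hprim := hΔ.comul_ι hY hX
  exact ⟨MaxExterior.hopf hΔ hY hX, MaxExterior.ι_isHom_hopf hΔ hY hX, hprim, d, hd.isDGA,
    hd.maurerCartan, fun _ => hd.eq_of_maurerCartan, hd.coact_d hY hϖ,
    hd.actionCompatible hY hϖ rfl, hd.coproductCompatible hY hϖ hX hΔ,
    isFirstOrder hX hϖ hsurj, Bosonisation.isMaximalProlongation hd hY hϖ,
    Bosonisation.isSuperHopf _,
    Bosonisation.comul_extD hd hY hϖ hprim (hd.comul_d hY hϖ hX hΔ)⟩
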